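/- \textbf{Setting.} Let $\mathbb T^2=\mathbb R^2/2\pi\mathbb Z^2$ (integrals over $\mathbb T^2$ are Lebesgue integrals over $[-\pi,\pi]^2$), and let $\mathcal D'(\mathbb T^2)$ be the space of distributions, i.e. of continuous linear functionals on the real $C^\infty$ functions on $\mathbb T^2$. \emph{Hölder--Zygmund norms.} For $\varphi\in C_c^\infty(\mathbb R^2)$ with support in the open unit ball $B_1(0)$, $x\in\mathbb R^2$ and $\lambda\in(0,1]$, put $\varphi^\lambda_x(y)=\lambda^{-2}\varphi((y-x)/\lambda)$, $\varphi_x=\varphi_x^1$, and regard it as a function on $\mathbb T^2$ by periodization. Let $\mathscr B^r$ be the set of such real $\varphi$ with $\|\partial^k\varphi\|_\infty\le1$ for $0\le|k|\le r$, and for $\alpha\ge 0$ let $\mathscr B^0_\alpha$ be the set of $\varphi\in\mathscr B^0$ with $\int\varphi(z)z^k\,dz=0$ for $0\le|k|\le\alpha$. For real $f$ set $$|f|_\alpha=\sup_{x,\ \lambda\in(0,1],\ \varphi\in\mathscr B^{r}}\frac{|f(\varphi^\lambda_x)|}{\lambda^{\alpha}}\quad(\alpha<0,\ r=\lfloor-\alpha+1\rfloor),\qquad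 |f|_\alpha=\sup_{x,\ \psi\in\mathscr B^0}|f(\psi_x)|+\sup_{x,\ \lambda\in(0,1],\ \varphi\in\mathscr B^0_\alpha}\frac{|f(\varphi^\lambda_x)|}{\lambda^{\alpha}}\quad(\alpha\ge0).$$ For complex $f$, $|f|_\alpha^2=|\mathrm{Re} f|_\alpha^2+|\mathrm{Im} f|_\alpha^2$; for vectors, $\|f\|_\alpha^2=\sum_k|f_k|_\alpha^2$. The little space $\mathcal Z^\alpha$ is the closure of $C^\infty(\mathbb T^2)$ in the space of distributions with $|f|_\alpha<\infty$, and $E_\alpha$ is the space of $\mathbb C^3$-valued distributions with all three components in $\mathcal Z^\alpha$. \emph{Noise.} Let $\mathscr W=(\mathscr W_1,\mathscr W_2,\mathscr W_3)$ be a three-dimensional white noise on $\mathbb T^2$: a random element of $\mathcal D'(\mathbb T^2)^3$ with, almost surely, $\mathscr W_j=\eta_j+\mathrm{Re}\sum_{k\in\mathbb Z^2\setminus\{0\}}\eta_{kj}e^{i(k,x)}$ in $\mathcal D'(\mathbb T^2)$, where all $\eta_j,\eta_{kj}$ are independent, the $\eta_{kj}$ are complex Gaussian variables whose real and imaginary parts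 are independent, centred and of a common variance $v$ (for instance standard complex Gaussians), and each $\eta_j$ is a standard real Gaussian variable, or is identically zero if $\mathscr W_j$ is a noise with zero mean over $\mathbb T^2$. Let $\rho\ge0$ be smooth on $\mathbb R^2$ with support in the closed unit ball and $\int\rho=1$, let $\rho_\varepsilon=\varepsilon^{-2}\rho(\cdot/\varepsilon)$ and $\mathscr W^\varepsilon_j=\rho_\varepsilon*\mathscr W_j$. Let $K=(4\pi^2)^{-1}\sum_{k\ne0}|k|^{-2}e^{i(k,\cdot)}$ be the mean-zero Green function of $-\Delta$ on $\mathbb T^2$, $G=2\partial_zK=\partial_1K-i\partial_2K$, and for $\varepsilon>0$ $$\xi^\varepsilon_j=2i\,G*\mathscr W_j^\varepsilon,\qquad \theta^\varepsilon=\xi^\varepsilon\times\overline{\xi^\varepsilon},\qquad \zeta^\varepsilon=2\,G*\theta^\varepsilon .$$ \textbf{Statement.} There are constants $C_\kappa$, $\kappa\in(0,\frac12)$, depending on $\kappa$ only, such that almost surely the following holds. For every $\varepsilon>0$, $\theta^\varepsilon$ and $\zeta^\varepsilon$ are smooth, and the limits $\theta=\lim_{\varepsilon\to0}\theta^\varepsilon$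 and $\zeta=\lim_{\varepsilon\to0}\zeta^\varepsilon$ exist in $\mathcal D'(\mathbb T^2)^3$, with $\zeta=2\,G*\theta$. Put $\theta^0=\theta$, $\zeta^0=\zeta$, $\mathscr W^0=\mathscr W$. For every $\kappa\in(0,\frac12)$ one has $\mathscr W_j\in\mathcal Z^{-1-\kappa/4}$ for $j=1,2,3$, $$\theta\in E_{-\kappa},\qquad \zeta\in E_{1-\kappa},$$ and for all $\varepsilon\ge0$ and $j=1,2,3$, with $j_1=j+1$ and $j_2=j+2$ modulo $3$, $$|\theta^\varepsilon_j|_{-\kappa}\le C_\kappa\,|\mathscr W_{j_1}|_{-1-\frac\kappa4}\,|\mathscr W_{j_2}|_{-1-\frac\kappa4},$$ $$|\theta^\varepsilon_j-\theta_j|_{-\kappa}\le C_\kappa\Big(|\mathscr W^\varepsilon_{j_1}-\mathscr W_{j_1}|_{-1-\frac\kappa4}|\mathscr W_{j_2}|_{-1-\frac\kappa4}+|\mathscr W^\varepsilon_{j_2}-\mathscr W_{j_2}|_{-1-\frac\kappa4}|\mathscr W_{j_1}|_{-1-\frac\kappa4}\Big),$$ $$\|\zeta^\varepsilon\|_{1-\kappa}\le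 C_\kappa\,\|\mathscr W\|^2_{-1-\frac\kappa4},$$ $$|\zeta^\varepsilon_j-\zeta_j|_{1-\kappa}\le C_\kappa\Big(|\mathscr W^\varepsilon_{j_1}-\mathscr W_{j_1}|_{-1-\frac\kappa4}|\mathscr W_{j_2}|_{-1-\frac\kappa4}+|\mathscr W^\varepsilon_{j_2}-\mathscr W_{j_2}|_{-1-\frac\kappa4}|\mathscr W_{j_1}|_{-1-\frac\kappa4}\Big).$$ -/

import Mathlib

open MeasureTheory ProbabilityTheory Filter Topology Set
open scoped ENNReal NNReal ComplexConjugate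

noncomputable section

namespace TorusCR

/-! ### The torus `ℝ² / 2πℤ²`: functions on it are `2πℤ²`-periodic functions on the plane -/

/-- The Euclidean plane. -/
abbrev Plane := EuclideanSpace ℝ (Fin 2)

/-- The vectors of the standard basis. -/
def stdVec (i : Fin 2) : Plane := EuclideanSpace.single i (1 : ℝ)

/-- The point `2πn` of the period lattice. -/
def latticeVec (n : Fin 2 → ℤ) : Plane := WithLp.toLp 2 (fun i => 2 * Real.pi * (n i : ℝ))

/-- The fundamental cell `[-π, π]²`; integrals over the torus are Lebesgue integrals over it. -/
def cell : Set Plane := {x | ∀ i, x i ∈ Icc (-Real.pi) Real.pi}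

/-- The character `e^{i(k,x)}`. -/
def character (k : Fin 2 → ℤ) (x : Plane) : ℂ :=
  Complex.exp (Complex.I * ((∑ i, (k i : ℝ) * x i : ℝ) : ℂ))

/-- Functions of class `C^∞`. -/
abbrev IsSmooth {F : Type*} [NormedAddCommGroup F] [NormedSpace ℝ F] (g : Plane → F) : Prop :=
  ContDiff ℝ ((⊤ : ℕ∞) : WithTop ℕ∞) g

/-- `2πℤ²`-periodicity. -/
def IsPeriodic {F : Type*} (g : Plane → F) : Prop := ∀ n x, g (x + latticeVec n) = g x

/-- The space of (real) test functions on the torus: smooth periodic functions. -/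
def TestSpace : Submodule ℝ (Plane → ℝ) where
  carrier := {φ | IsSmooth φ ∧ IsPeriodic φ}
  add_mem' := by
    rintro a b ⟨ha, ha'⟩ ⟨hb, hb'⟩
    exact ⟨ha.add hb, fun n x => by simp [ha' n x, hb' n x]⟩
  zero_mem' := ⟨contDiff_const, fun _ _ => rfl⟩
  smul_mem' := by
    rintro c a ⟨ha, ha'⟩
    exact ⟨contDiff_const.smul ha, fun n x => by simp [ha' n x]⟩

/-- Distributions on the torus with values in `F` (`F = ℝ` or `F = ℂ`): linear functionals on the
test functions that are continuous for the Fréchet topology given by the seminorms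
`sup ‖D^k φ‖`, `k = 0, 1, 2, …`. -/
structure TorusDist (F : Type*) [NormedAddCommGroup F] [NormedSpace ℝ F] where
  toLin : TestSpace →ₗ[ℝ] F
  cont : ∃ (N : ℕ) (C : ℝ), ∀ (φ : TestSpace) (M : ℝ),
    (∀ k ≤ N, ∀ x, ‖iteratedFDeriv ℝ k (φ : Plane → ℝ) x‖ ≤ M) → ‖toLin φ‖ ≤ C * M

instance (F : Type*) [NormedAddCommGroup F] [NormedSpace ℝ F] :
    CoeFun (TorusDist F) (fun _ => TestSpace → F) := ⟨fun f => f.toLin⟩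

/-- A function on the torus as a functional on test functions, `φ ↦ ∫ φ g`. -/
def funDist {F : Type*} [NormedAddCommGroup F] [NormedSpace ℝ F] (g : Plane → F)
    (φ : TestSpace) : F := ∫ x in cell, (φ : Plane → ℝ) x • g x

/-! ### Periodization of a compactly supported function -/

theorem latticeVec_add (m n : Fin 2 → ℤ) :
    latticeVec (m + n) = latticeVec m + latticeVec n := by
  ext i
  simp [latticeVec, mul_add]

theorem locallyFinite_translates {φ : Plane → ℝ} (hc : HasCompactSupport φ) :
    LocallyFinite (fun n : Fin 2 → ℤ => Function.support (fun y => φ (y + latticeVec n))) := by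
  intro x
  obtain ⟨R, hR⟩ := hc.isCompact.isBounded.subset_closedBall (0 : Plane)
  refine ⟨Metric.ball x 1, Metric.ball_mem_nhds x one_pos, ?_⟩
  obtain ⟨N, hN⟩ := exists_nat_ge (R + ‖x‖ + 1)
  refine (Set.finite_Icc (fun _ : Fin 2 => -(N : ℤ)) (fun _ => (N : ℤ))).subset ?_
  rintro n ⟨y, hy, hyx⟩
  have h1 : ‖y + latticeVec n‖ ≤ R := by
    have := hR (subset_tsupport φ hy)
    simpa using this
  have h2 : ‖y‖ ≤ ‖x‖ + 1 := by
    have h3 : ‖y - x‖ < 1 := by simpa [dist_eq_norm] using hyx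
    have h4 : ‖y‖ ≤ ‖y - x‖ + ‖x‖ := by simpa using norm_add_le (y - x) x
    linarith
  have h5 : ‖latticeVec n‖ ≤ N := by
    have : ‖latticeVec n‖ ≤ ‖y + latticeVec n‖ + ‖y‖ := by
      simpa using norm_sub_le (y + latticeVec n) y
    linarith
  have h6 : ∀ i, |n i| ≤ (N : ℤ) := by
    intro i
    have h7 : ‖latticeVec n i‖ ≤ ‖latticeVec n‖ := PiLp.norm_apply_le _ i
    have h8 : ‖latticeVec n i‖ = 2 * Real.pi * |(n i : ℝ)| := by
      simp [latticeVec, abs_of_pos Real.pi_pos]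
    have h9 : |(n i : ℝ)| ≤ 2 * Real.pi * |(n i : ℝ)| := by
      nlinarith [abs_nonneg (n i : ℝ), Real.pi_gt_three]
    have : |(n i : ℝ)| ≤ (N : ℝ) := by linarith
    exact_mod_cast this
  exact ⟨fun i => (abs_le.1 (h6 i)).1, fun i => (abs_le.1 (h6 i)).2⟩

theorem periodization_mem {φ : Plane → ℝ} (h : IsSmooth φ) (hc : HasCompactSupport φ) :
    (fun y => ∑ᶠ n : Fin 2 → ℤ, φ (y + latticeVec n)) ∈ TestSpace := by
  refine ⟨?_, ?_⟩
  · unfold IsSmooth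
    rw [← contMDiff_iff_contDiff]
    refine contMDiff_finsum (fun n => ?_) (locallyFinite_translates hc)
    rw [contMDiff_iff_contDiff]
    exact h.comp (contDiff_id.add contDiff_const)
  · intro m y
    have := finsum_comp_equiv (Equiv.addLeft m) (f := fun n => φ (y + latticeVec n))
    simpa [latticeVec_add, add_assoc] using this

open Classical in
/-- The periodization `y ↦ ∑_n φ(y + 2πn)`, as a test function on the torus, of a smooth compactly
supported function `φ` on the plane. It is used for such `φ` only. -/
def periodize (φ : Plane → ℝ) : TestSpace :=
  if h : IsSmooth φ ∧ HasCompactSupport φ then ⟨_, periodization_mem h.1 h.2⟩ else 0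

/-! ### Hölder–Zygmund norms and little Hölder–Zygmund spaces -/

/-- The rescaled centred function `φ^lam_x(y) = lam⁻² φ((y - x)/lam)`. -/
def rescale (φ : Plane → ℝ) (lam : ℝ) (x y : Plane) : ℝ := lam⁻¹ ^ 2 * φ (lam⁻¹ • (y - x))

/-- Smooth functions supported in the open unit ball all of whose partial derivatives of
order at most `r` are bounded by `1`. -/
def ballTests (r : ℕ) : Set (Plane → ℝ) :=
  {φ | IsSmooth φ ∧ HasCompactSupport φ ∧ tsupport φ ⊆ Metric.ball 0 1 ∧
    ∀ k ≤ r, ∀ (i : Fin k → Fin 2) (x : Plane),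
      |iteratedFDeriv ℝ k φ x (fun j => stdVec (i j))| ≤ 1}

/-- Functions annihilating all monomials of degree at most `α`. -/
def annihilating (α : ℝ) : Set (Plane → ℝ) :=
  {φ | ∀ k : Fin 2 → ℕ, ((∑ i, k i : ℕ) : ℝ) ≤ α → ∫ z : Plane, φ z * ∏ i, z i ^ k i = 0}

/-- The Hölder–Zygmund norm of order `α` of a real functional on test functions. -/
def hzReal (α : ℝ) (f : TestSpace → ℝ) : ℝ≥0∞ :=
  if 0 ≤ α then
    (⨆ (x : Plane) (φ ∈ ballTests 0), ENNReal.ofReal |f (periodize (rescale φ 1 x))|) +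
    ⨆ (x : Plane) (lam ∈ Ioc (0 : ℝ) 1) (φ ∈ ballTests 0 ∩ annihilating α),
      ENNReal.ofReal (|f (periodize (rescale φ lam x))| / lam ^ α)
  else
    ⨆ (x : Plane) (lam ∈ Ioc (0 : ℝ) 1) (φ ∈ ballTests ⌊-α + 1⌋₊),
      ENNReal.ofReal (|f (periodize (rescale φ lam x))| / lam ^ α)

/-- Euclidean norm of a vector of extended nonnegative numbers. -/
def l2norm {ι : Type*} [Fintype ι] (a : ι → ℝ≥0∞) : ℝ≥0∞ := (∑ i, a i ^ 2) ^ (1 / 2 : ℝ)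

/-- The Hölder–Zygmund norm of a complex functional `f`: `|f|² = |Re f|² + |Im f|²`. -/
def hzNorm (α : ℝ) (f : TestSpace → ℂ) : ℝ≥0∞ :=
  l2norm ![hzReal α (fun φ => (f φ).re), hzReal α (fun φ => (f φ).im)]

/-- Membership in the little Hölder–Zygmund space: the closure of the smooth functions for the
Hölder–Zygmund norm of order `α`. -/
def MemLittleHZ (α : ℝ) (f : TorusDist ℂ) : Prop :=
  hzNorm α f < ⊤ ∧ ∀ δ : ℝ≥0∞, 0 < δ → ∃ g : Plane → ℂ, IsSmooth g ∧ IsPeriodic g ∧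
    hzNorm α (fun φ => f φ - funDist g φ) < δ

/-- A real distribution regarded as a complex one. -/
def TorusDist.toComplex (f : TorusDist ℝ) : TorusDist ℂ where
  toLin := Complex.ofRealCLM.toLinearMap.comp f.toLin
  cont := by simpa using f.cont

/-- The space `E_α` of `ℂ³`-valued distributions. -/
def MemE (α : ℝ) (f : Fin 3 → TorusDist ℂ) : Prop := ∀ j, MemLittleHZ α (f j)

/-! ### Green functions -/

/-- The mean-zero Green function of `-Δ` on the torus as a distribution,
`K = (4π²)⁻¹ ∑_{k ≠ 0} |k|⁻² e^{i(k,·)}`, paired with the function `g`. -/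
def greenK (g : Plane → ℂ) : ℂ :=
  (4 * (Real.pi : ℂ) ^ 2)⁻¹ * ∑' k : Fin 2 → ℤ,
    if k = 0 then 0 else ((∑ i, (k i : ℂ) ^ 2))⁻¹ * ∫ y in cell, character k y * g y

/-- The partial derivative `∂_i g`. -/
def pderiv (i : Fin 2) (g : Plane → ℂ) (x : Plane) : ℂ := fderiv ℝ g x (stdVec i)

/-- The Green function `G = 2∂_z K = ∂₁K - i∂₂K` as a distribution, paired with `g`. -/
def greenG (g : Plane → ℂ) : ℂ :=
  -greenK (pderiv 0 g) - Complex.I * (-greenK (pderiv 1 g))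

/-- The convolution `G * g` with a smooth function `g`: `(G * g)(x) = ⟨G, g(x - ·)⟩`. -/
def convG (g : Plane → ℂ) (x : Plane) : ℂ := greenG (fun y => g (x - y))

/-- `h = G * f` for distributions `f`, `h`: for every test function `φ` the function
`χ(y) = ⟨G, φ(· + y)⟩` is a complex test function, and `h(φ) = f(χ)`. -/
def IsConvG (f h : TorusDist ℂ) : Prop :=
  ∀ φ : TestSpace, ∃ χ₁ χ₂ : TestSpace,
    (∀ y, greenG (fun x => (((φ : Plane → ℝ) (x + y) : ℝ) : ℂ)) =
      ((χ₁ : Plane → ℝ) y : ℂ) + Complex.I * ((χ₂ : Plane → ℝ) y : ℂ)) ∧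
    h φ = f χ₁ + Complex.I * f χ₂

/-! ### Mollification and the regularized objects -/

/-- A mollifier profile: smooth, nonnegative, supported in the closed unit ball, of integral 1. -/
structure IsMollifier (ρ : Plane → ℝ) : Prop where
  smooth : IsSmooth ρ
  nonneg : ∀ x, 0 ≤ ρ x
  supp : tsupport ρ ⊆ Metric.closedBall 0 1
  integral_eq : ∫ x, ρ x = 1

/-- The mollification `w^ε = ρ_ε * w`, that is `w^ε(x) = w(ρ_ε(x - ·))` with
`ρ_ε = ε⁻² ρ(·/ε)`. -/
def mollify (ρ : Plane → ℝ) (ε : ℝ) (w : TorusDist ℝ) (x : Plane) : ℝ :=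
  w (periodize (fun y => ε⁻¹ ^ 2 * ρ (ε⁻¹ • (x - y))))

/-- `ξ^ε_j = 2i G * w^ε_j`. -/
def xiEps (ρ : Plane → ℝ) (ε : ℝ) (w : Fin 3 → TorusDist ℝ) (j : Fin 3) (x : Plane) : ℂ :=
  2 * Complex.I * convG (fun y => ((mollify ρ ε (w j) y : ℝ) : ℂ)) x

/-- `θ^ε = ξ^ε × conj ξ^ε`. -/
def thetaEps (ρ : Plane → ℝ) (ε : ℝ) (w : Fin 3 → TorusDist ℝ) (j : Fin 3) (x : Plane) : ℂ :=
  crossProduct (fun k => xiEps ρ ε w k x) (fun k => conj (xiEps ρ ε w k x)) j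

/-- `ζ^ε = 2 G * θ^ε`. -/
def zetaEps (ρ : Plane → ℝ) (ε : ℝ) (w : Fin 3 → TorusDist ℝ) (j : Fin 3) (x : Plane) : ℂ :=
  2 * convG (thetaEps ρ ε w j) x

/-! ### White noise -/

/-- `W` is a three-dimensional white noise on the torus:
`W_j = η_{0j} + Re ∑_{k ≠ 0} η_{kj} e^{i(k,·)}`, the series converging in the sense of
distributions. The coefficients are independent; `η_{0j}` is a real standard Gaussian
(or zero, if `W_j` is a noise with zero mean over the torus), and for `k ≠ 0`, `η_{kj}` is a complex
Gaussian whose real and imaginary parts are independent, centred, of variance `v`. -/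
structure IsWhiteNoise {Ω : Type*} [MeasurableSpace Ω] (P : Measure Ω) (v : ℝ≥0)
    (W : Fin 3 → Ω → TorusDist ℝ) (η : (Fin 2 → ℤ) → Fin 3 → Ω → ℂ) : Prop where
  meas : ∀ k j, Measurable (η k j)
  indep : iIndepFun (fun (p : (Fin 2 → ℤ) × Fin 3) => η p.1 p.2) P
  law : ∀ k, k ≠ 0 → ∀ j, P.map (fun ω => ((η k j ω).re, (η k j ω).im)) =
    (gaussianReal 0 v).prod (gaussianReal 0 v)
  zero_im : ∀ j ω, (η 0 j ω).im = 0
  zero_law : ∀ j, P.map (fun ω => (η 0 j ω).re) = gaussianReal 0 1 ∨ ∀ ω, (η 0 j ω).re = 0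
  series : ∀ᵐ ω ∂P, ∀ j (φ : TestSpace),
    HasSum (fun k => ∫ y in cell, (φ : Plane → ℝ) y * (η k j ω * character k y).re) (W j ω φ)

end TorusCR

end

/-! Write `u_j = K * W_j`, the potential of the noise. As `G * w = ∂₁u - i ∂₂u` for `u = K * w`, the
`j`-th component of `ξ × conj ξ` is `2i Im(ξ_{j+1} conj ξ_{j+2}) = 8i J(u_{j+1}, u_{j+2})`, where
`J` is the Jacobian determinant (`jac`). The scalar product of the two gradients cancels. This null
structure makes the limit a deterministic, continuous function of the noise: no renormalization is
needed, and probability enters only to show that the noise has finite norms.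

The analytic core is `exists_abs_integral_jac_le`. In `∫ φ J(u, v)` one derivative can be moved onto
`φ` without creating a second derivative of the other factor (`integral_mul_jac`). If `u`, `v` are
`β`-Hölder and are mollified at the scales `t_n = λ 2⁻ⁿ`, the change from one scale to the next,
tested at scale `λ`, is of order `λ⁻¹ t_n^β t_n^(β-1)`. This is summable exactly when `β > 1/2` and
sums to `λ^(2β-2)`.

The Hölder norms come from Schauder estimates. A radial kernel `χ` with `z χ(z) = -∇Φ(z)` expresses
a function through averages of its Laplacian over all scales (`avg_one_sub_eq`). Integrating over
scales gives `exists_holderBound_potential`, which takes noise of order `-1 - κ/4` to potentials of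
order `1 - κ/4`, and `exists_holderBound_pd_potential`, which takes `θ` of order `-κ` to `ζ` of
order `1 - κ`. With `β = 1 - κ/4` the Jacobian has order `-κ/2`, better than required. Bilinearity
gives the difference estimates, so the regularized objects are Cauchy as `ε → 0`; lower
semicontinuity of the norms carries the bounds to the limits.

It remains that almost every noise is a limit of smooth functions in the norms of order `-1 - κ/4`
(`Approximates`). Each dyadic Fourier block is Gaussian at every point, so exponential moments
control its mass on small balls up to a logarithm. The same holds for its inverse Laplacian.
Interpolating the two resulting bounds (`hzBound_block`) yields a summable series of block norms. -/

namespace TorusCR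

/-! ### Integration over the torus -/

noncomputable section TorusIntegration

open scoped Pointwise

variable {F : Type*} [NormedAddCommGroup F] [NormedSpace ℝ F]

theorem latticeVec_zero : latticeVec 0 = 0 := by
  ext i
  simp [latticeVec]

/-- The period lattice acts on the plane by translations. -/
instance latticeAction : AddAction (Fin 2 → ℤ) Plane where
  vadd n x := latticeVec n + x
  zero_vadd x := by
    change latticeVec 0 + x = x
    rw [latticeVec_zero, zero_add]
  add_vadd m n x := by
    change latticeVec (m + n) + x = latticeVec m + (latticeVec n + x)
    rw [latticeVec_add, add_assoc]

theorem lattice_vadd (n : Fin 2 → ℤ) (x : Plane) : n +ᵥ x = x + latticeVec n :=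
  add_comm (latticeVec n) x

instance : MeasurableConstVAdd (Fin 2 → ℤ) Plane where
  measurable_const_vadd n := by
    change Measurable fun x : Plane => latticeVec n + x
    fun_prop

instance : VAddInvariantMeasure (Fin 2 → ℤ) Plane volume where
  measure_preimage_vadd n s _ := by
    change volume ((fun x => latticeVec n + x) ⁻¹' s) = volume s
    exact measure_preimage_add _ _ _

/-- The half-open fundamental cell. -/
def halfCell : Set Plane := {x | ∀ i, x i ∈ Ioc (-Real.pi) Real.pi}

/-- Reduction modulo `2π` in each coordinate gives exactly one representative per orbit. The closed
`cell` counts its boundary more than once, so uniqueness is available only for the half-open version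
and is transferred afterwards up to null sets. -/
theorem isAddFundamentalDomain_halfCell :
    IsAddFundamentalDomain (Fin 2 → ℤ) halfCell (volume : Measure Plane) := by
  refine IsAddFundamentalDomain.mk' ?_ fun x => ?_
  · have : halfCell = ⋂ i : Fin 2, (fun x : Plane => x i) ⁻¹' Ioc (-Real.pi) Real.pi := by
      ext x
      simp [halfCell]
    rw [this]
    exact (MeasurableSet.iInter fun i =>
      measurableSet_Ioc.preimage (by fun_prop)).nullMeasurableSet
  · have h : ∀ i, ∃! m : ℤ, x i + m • (2 * Real.pi) ∈ Ioc (-Real.pi) (-Real.pi + 2 * Real.pi) :=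
      fun i => existsUnique_add_zsmul_mem_Ioc (by positivity) _ _
    have e : -Real.pi + 2 * Real.pi = Real.pi := by ring
    simp only [e] at h
    choose m hm hu using h
    have key : ∀ n : Fin 2 → ℤ, n +ᵥ x ∈ halfCell ↔
        ∀ i, x i + n i • (2 * Real.pi) ∈ Ioc (-Real.pi) Real.pi := by
      intro n
      rw [lattice_vadd]
      simp only [halfCell, mem_ofPred_eq, latticeVec, PiLp.add_apply, zsmul_eq_mul, mul_comm]
    refine ⟨m, (key m).2 hm, fun n hn => funext fun i => hu i _ ((key n).1 hn i)⟩

theorem cell_ae_eq_halfCell : cell =ᵐ[volume] halfCell := by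
  have h := (PiLp.volume_preserving_ofLp (Fin 2)).quasiMeasurePreserving.preimage_ae_eq
    (Measure.univ_pi_Ioc_ae_eq_Icc (μ := fun _ : Fin 2 => (volume : Measure ℝ))
      (f := fun _ => -Real.pi) (g := fun _ => Real.pi))
  have h1 : halfCell = (@WithLp.ofLp 2 (Fin 2 → ℝ)) ⁻¹'
      (univ.pi fun _ => Ioc (-Real.pi) Real.pi) := by
    ext x
    simp [halfCell]
  have h2 : cell = (@WithLp.ofLp 2 (Fin 2 → ℝ)) ⁻¹'
      (Icc (fun _ : Fin 2 => -Real.pi) fun _ => Real.pi) := by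
    ext x
    simp [cell, Pi.le_def, forall_and]
  rw [h1, h2]
  exact h.symm

theorem isAddFundamentalDomain_cell :
    IsAddFundamentalDomain (Fin 2 → ℤ) cell (volume : Measure Plane) := by
  have h := isAddFundamentalDomain_halfCell
  refine ⟨h.nullMeasurableSet.congr cell_ae_eq_halfCell.symm, ?_, ?_⟩
  · filter_upwards [h.ae_covers] with x ⟨g, hg⟩
    refine ⟨g, fun i => ⟨(hg i).1.le, (hg i).2⟩⟩
  · intro m n hmn
    have key : ∀ k : Fin 2 → ℤ, (k +ᵥ cell : Set Plane) =ᵐ[volume] (k +ᵥ halfCell : Set Plane) := by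
      intro k
      have := (measurePreserving_vadd (-k)
        (volume : Measure Plane)).quasiMeasurePreserving.preimage_ae_eq cell_ae_eq_halfCell
      simpa [← Set.preimage_vadd_neg] using this
    exact (h.aedisjoint hmn).congr (key m) (key n)

theorem isCompact_cell : IsCompact cell := by
  have : cell = (EuclideanSpace.equiv (Fin 2) ℝ) ⁻¹'
      (Icc (fun _ : Fin 2 => -Real.pi) fun _ => Real.pi) := by
    ext x
    simp [cell, Pi.le_def, -mem_Icc, mem_Icc, forall_and, EuclideanSpace.equiv]
  rw [this, ← ContinuousLinearEquiv.image_symm_eq_preimage]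
  exact isCompact_Icc.image (ContinuousLinearEquiv.continuous _)

theorem measurableSet_cell : MeasurableSet cell := isCompact_cell.isClosed.measurableSet

theorem volume_cell_lt_top : volume cell < ⊤ := isCompact_cell.measure_lt_top

instance : IsFiniteMeasure (volume.restrict cell : Measure Plane) :=
  ⟨by simpa using volume_cell_lt_top⟩

theorem volume_cell : (volume : Measure Plane).real cell = (2 * Real.pi) ^ 2 := by
  have h : cell = (@WithLp.ofLp 2 (Fin 2 → ℝ)) ⁻¹'
      (Icc (fun _ : Fin 2 => -Real.pi) fun _ => Real.pi) := by
    ext x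
    simp [cell, Pi.le_def, forall_and]
  have h2 : MeasurableSet (Icc (fun _ : Fin 2 => -Real.pi) fun _ => Real.pi) := measurableSet_Icc
  rw [measureReal_def, h, (PiLp.volume_preserving_ofLp (Fin 2)).measure_preimage
    h2.nullMeasurableSet, Real.volume_Icc_pi]
  simp only [sub_neg_eq_add, Finset.prod_const, Finset.card_univ, Fintype.card_fin]
  rw [← ENNReal.ofReal_pow (by positivity), ENNReal.toReal_ofReal (by positivity)]
  ring

theorem IsPeriodic.vadd {G : Type*} {P : Plane → G} (hP : IsPeriodic P) (n : Fin 2 → ℤ) (x : Plane) :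
    P (n +ᵥ x) = P x := by rw [lattice_vadd, hP]

theorem IsPeriodic.comp_add {G : Type*} {P : Plane → G} (hP : IsPeriodic P) (a : Plane) :
    IsPeriodic fun x => P (x + a) := fun n x => by
  simp only [add_right_comm x, hP n]

theorem latticeVec_neg (n : Fin 2 → ℤ) : latticeVec (-n) = -latticeVec n := by
  ext i
  simp [latticeVec]

theorem IsPeriodic.comp_sub_left {G : Type*} {P : Plane → G} (hP : IsPeriodic P) (a : Plane) :
    IsPeriodic fun x => P (a - x) := fun n x => by
  have := hP (-n) (a - x)
  rw [latticeVec_neg, ← sub_eq_add_neg, sub_sub] at this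
  exact this

theorem IsPeriodic.comp {G H : Type*} {P : Plane → G} (hP : IsPeriodic P) (f : G → H) :
    IsPeriodic fun x => f (P x) := fun n x => by simp only [hP n x]

theorem IsPeriodic.comp₂ {G G' H : Type*} {P : Plane → G} {Q : Plane → G'} (hP : IsPeriodic P)
    (hQ : IsPeriodic Q) (f : G → G' → H) : IsPeriodic fun x => f (P x) (Q x) :=
  fun n x => by simp only [hP n x, hQ n x]

/-- A translate of the cell is again a fundamental domain, and the integral of a periodic function
does not depend on the domain chosen. -/
theorem setIntegral_cell_add {P : Plane → F} (hP : IsPeriodic P) (a : Plane) :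
    ∫ x in cell, P (x + a) = ∫ x in cell, P x := by
  have h1 := isAddFundamentalDomain_cell
  have h2 : IsAddFundamentalDomain (Fin 2 → ℤ) ((fun x => x + a) ⁻¹' cell)
      (volume : Measure Plane) := by
    refine ⟨h1.nullMeasurableSet.preimage
      (measurePreserving_add_right volume a).quasiMeasurePreserving, ?_, ?_⟩
    · filter_upwards [(measurePreserving_add_right volume a).quasiMeasurePreserving.ae
        h1.ae_covers] with x ⟨g, hg⟩
      refine ⟨g, ?_⟩
      simp only [mem_preimage, lattice_vadd] at hg ⊢
      rwa [add_right_comm]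
    · intro m n hmn
      have key : ∀ k : Fin 2 → ℤ, (k +ᵥ ((fun x => x + a) ⁻¹' cell) : Set Plane) =
          (fun x => x + a) ⁻¹' (k +ᵥ cell) := by
        intro k
        ext x
        simp only [← Set.preimage_vadd_neg, mem_preimage, lattice_vadd, add_right_comm]
      change AEDisjoint volume (m +ᵥ ((fun x => x + a) ⁻¹' cell)) (n +ᵥ ((fun x => x + a) ⁻¹' cell))
      rw [key, key]
      exact (h1.aedisjoint hmn).preimage
        (measurePreserving_add_right volume a).quasiMeasurePreserving
  rw [← h2.setIntegral_eq h1 (f := fun x => P x) fun g x => hP.vadd g x]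
  have := (measurePreserving_add_right (volume : Measure Plane) a).setIntegral_preimage_emb
    (measurableEmbedding_addRight a) (fun x => P x) cell
  rw [h2.setIntegral_eq h1 (f := fun x => P x) fun g x => hP.vadd g x, ← this]
  exact (h1.setIntegral_eq h2 (f := fun x => P (x + a)) fun g x =>
    (hP.comp_add a).vadd g x)

theorem setIntegral_cell_neg (P : Plane → F) : ∫ x in cell, P (-x) = ∫ x in cell, P x := by
  have h : (fun x : Plane => -x) ⁻¹' cell = cell := by
    ext x
    simp only [cell, mem_preimage, mem_ofPred_eq, PiLp.neg_apply, mem_Icc]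
    exact forall_congr' fun i => ⟨fun h => ⟨by linarith [h.2], by linarith [h.1]⟩,
      fun h => ⟨by linarith [h.2], by linarith [h.1]⟩⟩
  conv_lhs => rw [← h]
  exact (Measure.measurePreserving_neg (volume : Measure Plane)).setIntegral_preimage_emb
    (Homeomorph.neg Plane).measurableEmbedding P cell

theorem setIntegral_cell_sub_left {P : Plane → F} (hP : IsPeriodic P) (a : Plane) :
    ∫ x in cell, P (a - x) = ∫ x in cell, P x := by
  rw [← setIntegral_cell_add hP a, ← setIntegral_cell_neg fun x => P (x + a)]
  simp only [neg_add_eq_sub]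

theorem periodize_apply {φ : Plane → ℝ} (h : IsSmooth φ) (hc : HasCompactSupport φ) (y : Plane) :
    (periodize φ : Plane → ℝ) y = ∑ᶠ n : Fin 2 → ℤ, φ (y + latticeVec n) := by
  rw [periodize, dif_pos ⟨h, hc⟩]

/-- Unfolding: pairing a periodization with a periodic function. -/
theorem setIntegral_periodize_smul {φ : Plane → ℝ} (h : IsSmooth φ) (hc : HasCompactSupport φ)
    {P : Plane → F} (hP : IsPeriodic P) (hPc : Continuous P) :
    ∫ x in cell, (periodize φ : Plane → ℝ) x • P x = ∫ x, φ x • P x := by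
  -- Only finitely many translates of the support meet the cell, so the sum over the lattice is
  -- finite and commutes with the integral.
  have hfin := (locallyFinite_translates hc).finite_nonempty_inter_compact isCompact_cell
  have hint : Integrable fun x => φ x • P x :=
    (h.continuous.smul hPc).integrable_of_hasCompactSupport hc.smul_right
  rw [isAddFundamentalDomain_cell.integral_eq_tsum'' _ hint]
  have hz : ∀ n ∉ hfin.toFinset, ∀ x ∈ cell, φ (x + latticeVec n) = 0 := by
    intro n hn x hx
    by_contra hne
    exact hn (hfin.mem_toFinset.2 ⟨x, hne, hx⟩)
  rw [tsum_eq_sum (s := hfin.toFinset)]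
  · simp only [lattice_vadd, hP _ _]
    rw [← integral_finsetSum]
    · refine setIntegral_congr_fun measurableSet_cell fun x hx => ?_
      rw [periodize_apply h hc, finsum_eq_sum_of_support_subset (s := hfin.toFinset),
        Finset.sum_smul]
      intro n hn
      by_contra hne
      exact hn (hz n hne x hx)
    · intro n _
      have h1 := h.continuous
      have h2 : Continuous fun x => φ (x + latticeVec n) • P (x + latticeVec n) := by fun_prop
      simpa only [lattice_vadd, hP n, IntegrableOn] using h2.continuousOn.integrableOn_compact isCompact_cell
  · intro n hn
    rw [setIntegral_congr_fun (g := fun _ => (0 : F)) measurableSet_cell]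
    · simp
    · intro x hx
      simp only [lattice_vadd]
      rw [hz n hn x hx, zero_smul]

/-- A continuous periodic function is bounded. -/
theorem IsPeriodic.exists_bound {E : Type*} [NormedAddCommGroup E] {P : Plane → E}
    (hP : IsPeriodic P) (hc : Continuous P) :
    ∃ M, 0 ≤ M ∧ ∀ x, ‖P x‖ ≤ M := by
  obtain ⟨M, hM⟩ := isCompact_cell.exists_bound_of_continuousOn hc.continuousOn
  refine ⟨max M 0, le_max_right _ _, fun x => ?_⟩
  have h : ∀ i, ∃ m : ℤ, x i + m • (2 * Real.pi) ∈ Ioc (-Real.pi) (-Real.pi + 2 * Real.pi) :=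
    fun i => (existsUnique_add_zsmul_mem_Ioc (by positivity) _ _).exists
  choose m hm using h
  rw [← hP m x]
  refine (hM _ fun i => ?_).trans (le_max_left _ _)
  have e : -Real.pi + 2 * Real.pi = Real.pi := by ring
  have := hm i
  simp only [e, zsmul_eq_mul] at this
  simp only [PiLp.add_apply, latticeVec]
  rw [mul_comm]
  exact ⟨this.1.le, this.2⟩

theorem IsPeriodic.fderiv {P : Plane → F} (hP : IsPeriodic P) : IsPeriodic (fderiv ℝ P) := by
  intro n x
  rw [← fderiv_comp_add_right]
  congr 1
  exact funext fun y => hP n y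

theorem IsSmooth.fderiv {P : Plane → F} (hP : IsSmooth P) : IsSmooth (fderiv ℝ P) :=
  ContDiff.fderiv_right hP (by simp)

theorem IsSmooth.fderiv_apply {P : Plane → F} (hP : IsSmooth P) (v : Plane) :
    IsSmooth fun x => _root_.fderiv ℝ P x v := hP.fderiv.clm_apply contDiff_const

theorem IsPeriodic.fderiv_apply {P : Plane → F} (hP : IsPeriodic P) (v : Plane) :
    IsPeriodic fun x => _root_.fderiv ℝ P x v := hP.fderiv.comp fun L => L v

/-- By translation invariance `t ↦ ∫ P(x + t v) dx` is constant; differentiating under the integral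
at `t = 0` gives the claim. This is integration by parts on the torus. -/
theorem setIntegral_cell_fderiv {P : Plane → F} (hP : IsPeriodic P) (hs : IsSmooth P)
    (v : Plane) : ∫ x in cell, fderiv ℝ P x v = 0 := by
  by_cases hF : CompleteSpace F
  swap
  -- The Bochner integral is zero by definition when the target is not complete.
  · simp [integral, hF]
  obtain ⟨M, hM0, hM⟩ := hP.fderiv.exists_bound hs.fderiv.continuous
  have hd := (hasDerivAt_integral_of_dominated_loc_of_deriv_le (μ := volume.restrict cell)
    (F := fun (t : ℝ) x => P (x + t • v)) (F' := fun t x => fderiv ℝ P (x + t • v) v)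
    (x₀ := 0) (s := univ) (bound := fun _ => M * ‖v‖) univ_mem
    (Eventually.of_forall fun t => by
      have := hs.continuous
      exact Continuous.aestronglyMeasurable (by fun_prop))
    (by
      have := hs.continuous
      exact ContinuousOn.integrableOn_compact isCompact_cell
        (Continuous.continuousOn (by fun_prop)))
    (by
      have := hs.fderiv.continuous
      exact Continuous.aestronglyMeasurable (by fun_prop))
    (Eventually.of_forall fun x t _ => (ContinuousLinearMap.le_opNorm _ _).trans
      (mul_le_mul_of_nonneg_right (hM _) (norm_nonneg _)))
    (integrable_const _)
    (Eventually.of_forall fun x t _ => by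
      have h1 : HasFDerivAt P (fderiv ℝ P (x + t • v)) (x + t • v) :=
        (hs.differentiable (by simp) _).hasFDerivAt
      have h2 : HasDerivAt (fun t : ℝ => x + t • v) v t := by
        simpa using ((hasDerivAt_id t).smul_const v).const_add x
      exact h1.comp_hasDerivAt t h2)).2
  simp only [setIntegral_cell_add hP, zero_smul, add_zero] at hd
  exact hd.unique (hasDerivAt_const _ _)

end TorusIntegration

end TorusCR

namespace TorusCR

/-! ### Fourier coefficients and multipliers -/

noncomputable section FourierSeries

/-- Rapidly decaying families of coefficients. -/
def RapidDecay (c : (Fin 2 → ℤ) → ℂ) : Prop :=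
  ∀ m : ℕ, ∃ C : ℝ, ∀ k, ‖c k‖ * (1 + ‖k‖) ^ m ≤ C

/-- Families of coefficients of polynomial growth. -/
def PolyGrowth (c : (Fin 2 → ℤ) → ℂ) : Prop :=
  ∃ (m : ℕ) (C : ℝ), 0 ≤ C ∧ ∀ k, ‖c k‖ ≤ C * (1 + ‖k‖) ^ m

theorem summable_weight : Summable fun k : Fin 2 → ℤ => ((1 + ‖k‖) ^ 3)⁻¹ := by
  refine Summable.of_norm_bounded_eventually
    (EisensteinSeries.summable_one_div_norm_rpow (k := 3) (by norm_num)) ?_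
  -- The comparison with the lattice sum of `‖k‖⁻³` fails only at `k = 0`, where the real power `0 ^
  -- (-3)` is zero.
  refine (Set.finite_singleton (0 : Fin 2 → ℤ)).subset fun k hk => ?_
  by_contra hk0
  refine hk ?_
  have h : 0 < ‖k‖ := norm_pos_iff.2 hk0
  change ‖((1 + ‖k‖) ^ 3)⁻¹‖ ≤ ‖k‖ ^ (-3 : ℝ)
  rw [Real.norm_of_nonneg (by positivity), Real.rpow_neg h.le]
  norm_cast
  gcongr
  linarith

theorem RapidDecay.mul_poly {c d : (Fin 2 → ℤ) → ℂ} (hd : PolyGrowth d) (hc : RapidDecay c) :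
    RapidDecay fun k => d k * c k := by
  intro m
  obtain ⟨n, D, hD0, hD⟩ := hd
  obtain ⟨C, hC⟩ := hc (n + m)
  refine ⟨D * C, fun k => ?_⟩
  calc ‖d k * c k‖ * (1 + ‖k‖) ^ m ≤ D * (1 + ‖k‖) ^ n * ‖c k‖ * (1 + ‖k‖) ^ m := by
        rw [norm_mul]
        gcongr
        exact hD k
    _ = D * (‖c k‖ * (1 + ‖k‖) ^ (n + m)) := by ring
    _ ≤ D * C := by gcongr; exact hC k

theorem RapidDecay.summable {c : (Fin 2 → ℤ) → ℂ} (hc : RapidDecay c) :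
    Summable fun k => ‖c k‖ := by
  obtain ⟨C, hC⟩ := hc 3
  refine Summable.of_nonneg_of_le (fun _ => norm_nonneg _) (fun k => ?_)
    (summable_weight.mul_left C)
  rw [← div_eq_mul_inv, le_div_iff₀ (by positivity)]
  exact hC k

/-- The phase `(k, x)`. -/
def phase (k : Fin 2 → ℤ) : Plane →L[ℝ] ℝ :=
  ∑ i, (k i : ℝ) • (EuclideanSpace.proj i : Plane →L[ℝ] ℝ)

theorem phase_apply (k : Fin 2 → ℤ) (x : Plane) : phase k x = ∑ i, (k i : ℝ) * x i := by
  simp [phase]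

theorem phase_stdVec (k : Fin 2 → ℤ) (i : Fin 2) : phase k (stdVec i) = k i := by
  fin_cases i <;> simp [phase_apply, stdVec]

theorem phase_neg (k : Fin 2 → ℤ) (x : Plane) : phase (-k) x = -phase k x := by
  simp only [phase_apply, Fin.sum_univ_two, Pi.neg_apply, Int.cast_neg]
  ring

theorem abs_coord_le_norm (k : Fin 2 → ℤ) (i : Fin 2) : |(k i : ℝ)| ≤ ‖k‖ := by
  simpa [Int.norm_eq_abs] using norm_le_pi_norm k i

theorem abs_phase_le (k : Fin 2 → ℤ) (x : Plane) : |phase k x| ≤ 2 * ‖x‖ * (1 + ‖k‖) := by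
  have h1 : ∀ i, |(k i : ℝ) * x i| ≤ ‖k‖ * ‖x‖ := fun i => by
    rw [abs_mul]
    exact mul_le_mul (abs_coord_le_norm k i) (PiLp.norm_apply_le x i) (abs_nonneg _)
      (norm_nonneg _)
  rw [phase_apply, Fin.sum_univ_two]
  refine (abs_add_le _ _).trans ?_
  nlinarith [h1 0, h1 1, norm_nonneg x]

theorem character_eq (k : Fin 2 → ℤ) (x : Plane) :
    character k x = Complex.exp (Complex.I * (phase k x : ℂ)) := by
  rw [character, phase_apply]

theorem norm_character (k : Fin 2 → ℤ) (x : Plane) : ‖character k x‖ = 1 := by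
  rw [character_eq, mul_comm, Complex.norm_exp_ofReal_mul_I]

theorem character_add (k : Fin 2 → ℤ) (x y : Plane) :
    character k (x + y) = character k x * character k y := by
  simp only [character_eq, map_add, Complex.ofReal_add, mul_add, Complex.exp_add]

theorem character_neg (k : Fin 2 → ℤ) (x : Plane) : character k (-x) = character (-k) x := by
  simp only [character_eq, map_neg, phase_neg]

theorem character_sub (k : Fin 2 → ℤ) (x y : Plane) :
    character k (x - y) = character k x * character (-k) y := by
  rw [sub_eq_add_neg, character_add, character_neg]

theorem character_conj (k : Fin 2 → ℤ) (x : Plane) :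
    conj (character k x) = character (-k) x := by
  simp only [character_eq, phase_neg, ← Complex.exp_conj, map_mul, Complex.conj_I,
    Complex.conj_ofReal, Complex.ofReal_neg]
  congr 1
  ring

theorem character_zero (x : Plane) : character 0 x = 1 := by simp [character]

theorem isPeriodic_character (k : Fin 2 → ℤ) : IsPeriodic (character k) := by
  intro n x
  rw [character_add, character_eq k (latticeVec n)]
  have : Complex.I * (phase k (latticeVec n) : ℂ) =
      ((k 0 * n 0 + k 1 * n 1 : ℤ) : ℂ) * (2 * Real.pi * Complex.I) := by
    simp only [phase_apply, Fin.sum_univ_two, latticeVec]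
    push_cast
    ring
  rw [this, Complex.exp_int_mul_two_pi_mul_I, mul_one]

theorem hasFDerivAt_character (k : Fin 2 → ℤ) (x : Plane) :
    HasFDerivAt (character k)
      ((Complex.I * character k x) • (Complex.ofRealCLM.comp (phase k))) x := by
  have h1 : HasFDerivAt (fun x => Complex.I * (phase k x : ℂ))
      (Complex.I • (Complex.ofRealCLM.comp (phase k))) x :=
    ((Complex.ofRealCLM.comp (phase k)).hasFDerivAt).const_mul Complex.I
  have h2 := h1.cexp
  have e : (fun x => Complex.exp (Complex.I * (phase k x : ℂ))) = character k :=
    funext fun x => (character_eq k x).symm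
  rw [e, ← character_eq, smul_smul, mul_comm] at h2
  exact h2

theorem isSmooth_character (k : Fin 2 → ℤ) : IsSmooth (character k) := by
  have e : (fun x => Complex.exp (Complex.I * (phase k x : ℂ))) = character k :=
    funext fun x => (character_eq k x).symm
  rw [← e]
  exact ((contDiff_const (c := Complex.I)).mul
    (Complex.ofRealCLM.comp (phase k)).contDiff).cexp

/-- The function with given Fourier coefficients. -/
def synth (c : (Fin 2 → ℤ) → ℂ) (x : Plane) : ℂ := ∑' k, c k * character k x

theorem norm_mul_character (a : ℂ) (k : Fin 2 → ℤ) (x : Plane) :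
    ‖a * character k x‖ = ‖a‖ := by rw [norm_mul, norm_character, mul_one]

theorem RapidDecay.hasSum {c : (Fin 2 → ℤ) → ℂ} (hc : RapidDecay c) (x : Plane) :
    HasSum (fun k => c k * character k x) (synth c x) := by
  refine (Summable.of_norm ?_).hasSum
  simpa only [norm_mul_character] using hc.summable

theorem isPeriodic_synth (c : (Fin 2 → ℤ) → ℂ) : IsPeriodic (synth c) := fun n x => by
  simp only [synth, isPeriodic_character _ n x]

theorem polyGrowth_phase (v : Plane) :
    PolyGrowth fun k => Complex.I * (phase k v : ℂ) := by
  refine ⟨1, 2 * ‖v‖, by positivity, fun k => ?_⟩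
  simpa using abs_phase_le k v

theorem RapidDecay.phase_mul {c : (Fin 2 → ℤ) → ℂ} (hc : RapidDecay c) (v : Plane) :
    RapidDecay fun k => Complex.I * (phase k v : ℂ) * c k := hc.mul_poly (polyGrowth_phase v)

theorem plane_eq_sum (v : Plane) : v = v 0 • stdVec 0 + v 1 • stdVec 1 := by
  ext i
  fin_cases i <;> simp [stdVec]

/-- The coordinate functionals. -/
def coordL (i : Fin 2) : Plane →L[ℝ] ℂ := Complex.ofRealCLM.comp (EuclideanSpace.proj i)

/-- Termwise differentiation. The derivative is written through `synth` of two other rapidly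
decaying families, so that smoothness follows by induction on the order. -/
theorem RapidDecay.hasFDerivAt {c : (Fin 2 → ℤ) → ℂ} (hc : RapidDecay c) (x : Plane) :
    HasFDerivAt (synth c)
      (synth (fun k => Complex.I * (phase k (stdVec 0) : ℂ) * c k) x • coordL 0 +
        synth (fun k => Complex.I * (phase k (stdVec 1) : ℂ) * c k) x • coordL 1) x := by
  have hb : ∀ k x, ‖c k • ((Complex.I * character k x) • (Complex.ofRealCLM.comp (phase k)))‖ ≤
      2 * (‖c k‖ * (1 + ‖k‖)) := by
    intro k x
    refine ContinuousLinearMap.opNorm_le_bound _ (by positivity) fun v => ?_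
    simp only [_root_.smul_apply, ContinuousLinearMap.comp_apply, norm_smul,
      norm_mul, Complex.norm_I, norm_character, one_mul, Complex.ofRealCLM_apply,
      Complex.norm_real, Real.norm_eq_abs]
    calc ‖c k‖ * |phase k v| ≤ ‖c k‖ * (2 * ‖v‖ * (1 + ‖k‖)) := by
          gcongr
          exact abs_phase_le k v
      _ = _ := by ring
  have hs : Summable fun k => 2 * (‖c k‖ * (1 + ‖k‖)) := by
    have h1 : PolyGrowth fun k : Fin 2 → ℤ => ((1 + ‖k‖ : ℝ) : ℂ) :=
      ⟨1, 1, zero_le_one, fun k => by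
        rw [Complex.norm_real, Real.norm_of_nonneg (by positivity)]
        simp⟩
    refine ((hc.mul_poly h1).summable.congr fun k => ?_).mul_left 2
    rw [norm_mul, Complex.norm_real, Real.norm_of_nonneg (by positivity), mul_comm]
  have := hasFDerivAt_tsum hs (fun k x => (hasFDerivAt_character k x).const_mul (c k))
    (fun k x => hb k x) (x₀ := x) (hc.hasSum x).summable x
  convert! this using 1
  have hsum : Summable fun k => c k • ((Complex.I * character k x) •
      (Complex.ofRealCLM.comp (phase k))) := Summable.of_norm_bounded hs fun k => hb k x
  have e : ∀ i, synth (fun k => Complex.I * (phase k (stdVec i) : ℂ) * c k) x =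
      ∑' k, c k * (Complex.I * character k x * (phase k (stdVec i) : ℂ)) := fun i => by
    refine tsum_congr fun k => ?_
    ring
  ext v
  have h0 : ∀ w : Plane, (∑' k, c k • ((Complex.I * character k x) •
      (Complex.ofRealCLM.comp (phase k)))) w =
      ∑' k, c k * (Complex.I * character k x * (phase k w : ℂ)) := by
    intro w
    have := (ContinuousLinearMap.apply ℝ ℂ w).map_tsum hsum
    simpa using this
  rw [e, e, ← h0, ← h0]
  conv_rhs => rw [plane_eq_sum v]
  simp [coordL, mul_comm]

theorem RapidDecay.isSmooth_synth {c : (Fin 2 → ℤ) → ℂ} (hc : RapidDecay c) :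
    IsSmooth (synth c) := by
  have h : ∀ (n : ℕ) (c : (Fin 2 → ℤ) → ℂ), RapidDecay c → ContDiff ℝ n (synth c) := by
    intro n
    induction n with
    | zero =>
      intro c hc
      exact contDiff_zero.2 (continuous_iff_continuousAt.2 fun x => (hc.hasFDerivAt x).continuousAt)
    | succ n ih =>
      intro c hc
      refine contDiff_succ_iff_hasFDerivAt.2 ⟨_, ?_, fun x => hc.hasFDerivAt x⟩
      exact ((ih _ (hc.phase_mul _)).smul contDiff_const).add
        ((ih _ (hc.phase_mul _)).smul contDiff_const)
  exact contDiff_infty.2 fun n => h n c hc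

theorem RapidDecay.fderiv_synth {c : (Fin 2 → ℤ) → ℂ} (hc : RapidDecay c) (x : Plane)
    (i : Fin 2) : fderiv ℝ (synth c) x (stdVec i) =
      synth (fun k => Complex.I * (k i : ℂ) * c k) x := by
  rw [(hc.hasFDerivAt x).fderiv]
  fin_cases i <;> simp [coordL, stdVec, phase_apply]

/-- The (unnormalised) Fourier coefficient `∫ e^{i(k,y)} g(y) dy`. -/
def fcoef (k : Fin 2 → ℤ) (g : Plane → ℂ) : ℂ := ∫ y in cell, character k y * g y

theorem integrableOn_cell {F : Type*} [NormedAddCommGroup F] {g : Plane → F} (hg : Continuous g) :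
    Integrable g (volume.restrict cell) :=
  hg.continuousOn.integrableOn_compact isCompact_cell

theorem norm_fcoef_le (k : Fin 2 → ℤ) {g : Plane → ℂ} {M : ℝ} (hM : ∀ x, ‖g x‖ ≤ M) :
    ‖fcoef k g‖ ≤ M * (2 * Real.pi) ^ 2 := by
  rw [← volume_cell]
  refine norm_setIntegral_le_of_norm_le_const volume_cell_lt_top fun x _ => ?_
  rw [mul_comm, norm_mul_character]
  exact hM x

/-- Integration by parts against the character. The minus sign reflects that `fcoef` pairs with
`e^{i(k,y)}` and not with its conjugate. -/
theorem fcoef_pderiv (k : Fin 2 → ℤ) {g : Plane → ℂ} (hg : IsSmooth g) (hp : IsPeriodic g)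
    (i : Fin 2) : fcoef k (pderiv i g) = -(Complex.I * (k i : ℂ) * fcoef k g) := by
  have h := setIntegral_cell_fderiv ((isPeriodic_character k).comp₂ hp (fun a b => a * b))
    ((isSmooth_character k).mul hg) (stdVec i)
  have e : ∀ x, fderiv ℝ (fun x => character k x * g x) x (stdVec i) =
      character k x * pderiv i g x + Complex.I * (k i : ℂ) * (character k x * g x) := by
    intro x
    have := ((hasFDerivAt_character k x).mul (hg.differentiable (by simp) x).hasFDerivAt).fderiv
    rw [show (fun x => character k x * g x) = character k * g from rfl, this]
    simp only [_root_.add_apply, _root_.smul_apply,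
      ContinuousLinearMap.comp_apply, phase_stdVec, pderiv, smul_eq_mul,
      Complex.ofRealCLM_apply]
    push_cast
    ring
  simp only [e] at h
  have hc1 := (isSmooth_character k).continuous
  have hc2 := hg.continuous
  have hc3 : Continuous (pderiv i g) := (hg.fderiv_apply (stdVec i)).continuous
  rw [integral_add (integrableOn_cell (by fun_prop)) (integrableOn_cell (by fun_prop)),
    integral_const_mul] at h
  exact eq_neg_of_add_eq_zero_left h

/-- Each power of `1 + ‖k‖` is paid for by one derivative of `g`, through `‖k‖ ≤ |k 0| + |k 1|` and
`fcoef_pderiv`. -/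
theorem rapidDecay_fcoef {g : Plane → ℂ} (hg : IsSmooth g) (hp : IsPeriodic g) :
    RapidDecay fun k => fcoef k g := by
  intro m
  induction m generalizing g with
  | zero =>
    obtain ⟨M, -, hM⟩ := hp.exists_bound hg.continuous
    exact ⟨_, fun k => by simpa using norm_fcoef_le k hM⟩
  | succ m ih =>
    obtain ⟨C, hC⟩ := ih hg hp
    have hd : ∀ i, ∃ C, ∀ k, ‖fcoef k (pderiv i g)‖ * (1 + ‖k‖) ^ m ≤ C := fun i =>
      ih (hg.fderiv_apply (stdVec i)) (hp.fderiv_apply (stdVec i))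
    choose D hD using hd
    refine ⟨C + D 0 + D 1, fun k => ?_⟩
    have hn : ‖k‖ ≤ |(k 0 : ℝ)| + |(k 1 : ℝ)| := by
      refine (pi_norm_le_iff_of_nonneg (by positivity)).2 fun i => ?_
      rw [Int.norm_eq_abs]
      fin_cases i
      · simp
      · simp
    have h0 := hD 0 k
    have h1 := hD 1 k
    rw [fcoef_pderiv k hg hp, norm_neg, norm_mul, norm_mul, Complex.norm_I, one_mul,
      Complex.norm_intCast] at h0 h1
    have h2 : 0 ≤ ‖fcoef k g‖ * (1 + ‖k‖) ^ m := by positivity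
    calc ‖fcoef k g‖ * (1 + ‖k‖) ^ (m + 1)
        = ‖fcoef k g‖ * (1 + ‖k‖) ^ m * (1 + ‖k‖) := by ring
      _ ≤ ‖fcoef k g‖ * (1 + ‖k‖) ^ m * (1 + (|(k 0 : ℝ)| + |(k 1 : ℝ)|)) := by gcongr
      _ ≤ C + D 0 + D 1 := by nlinarith [hC k]

theorem RapidDecay.comp_neg {c : (Fin 2 → ℤ) → ℂ} (hc : RapidDecay c) :
    RapidDecay fun k => c (-k) := fun m => by
  obtain ⟨C, hC⟩ := hc m
  exact ⟨C, fun k => by simpa using hC (-k)⟩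

/-- The Fourier multiplier with symbol `m`. -/
def multiplier (m : (Fin 2 → ℤ) → ℂ) (g : Plane → ℂ) : Plane → ℂ :=
  synth fun k => m k * fcoef (-k) g

theorem rapidDecay_multiplier {m : (Fin 2 → ℤ) → ℂ} (hm : PolyGrowth m) {g : Plane → ℂ}
    (hg : IsSmooth g) (hp : IsPeriodic g) : RapidDecay fun k => m k * fcoef (-k) g :=
  (rapidDecay_fcoef hg hp).comp_neg.mul_poly hm

theorem fcoef_sub_left (k : Fin 2 → ℤ) {g : Plane → ℂ} (hp : IsPeriodic g) (x : Plane) :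
    fcoef k (fun y => g (x - y)) = character k x * fcoef (-k) g := by
  have h := setIntegral_cell_sub_left
    (P := fun y => character k (x - y) * g y) (((isPeriodic_character k).comp_sub_left x).comp₂ hp
      (fun a b => a * b)) x
  simp only [sub_sub_cancel] at h
  rw [fcoef, h, fcoef, ← integral_const_mul]
  refine integral_congr_ae (Eventually.of_forall fun y => ?_)
  simp only [character_sub]
  ring

theorem setIntegral_mul_synth {c : (Fin 2 → ℤ) → ℂ} (hc : RapidDecay c) {H : Plane → ℂ}
    (hH : Continuous H) (hp : IsPeriodic H) (x : Plane) :
    ∫ y in cell, H y * synth c (x - y) = synth (fun k => c k * fcoef (-k) H) x := by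
  obtain ⟨M, hM0, hM⟩ := hp.exists_bound hH
  have h := hasSum_integral_of_summable_integral_norm (μ := volume.restrict cell)
    (F := fun (k : Fin 2 → ℤ) y => H y * (c k * character k (x - y))) (fun k => by
      have := (isSmooth_character k).continuous
      exact integrableOn_cell (by fun_prop)) (by
      refine Summable.of_nonneg_of_le (fun k => by positivity) (fun k => ?_)
        (hc.summable.mul_left (M * (2 * Real.pi) ^ 2))
      have : ∀ y, ‖H y * (c k * character k (x - y))‖ = ‖c k‖ * ‖H y‖ := fun y => by
        rw [norm_mul, norm_mul_character, mul_comm]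
      simp only [this]
      rw [integral_const_mul, mul_comm]
      gcongr
      have := norm_setIntegral_le_of_norm_le_const (μ := volume) (f := fun y => ‖H y‖)
        volume_cell_lt_top (fun x _ => by simpa using hM x)
      rw [volume_cell] at this
      exact (le_abs_self _).trans this)
  simp only [tsum_mul_left] at h
  refine h.tsum_eq.symm.trans (tsum_congr fun k => ?_)
  simp only [fcoef]
  have : ∀ y, H y * (c k * character k (x - y)) =
      (c k * character k x) * (character (-k) y * H y) := fun y => by
    rw [character_sub]; ring
  simp only [this]
  rw [integral_const_mul]
  ring

/-- Multipliers are convolution operators: they commute with convolution. -/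
theorem setIntegral_mul_multiplier {m : (Fin 2 → ℤ) → ℂ} (hm : PolyGrowth m) {H w : Plane → ℂ}
    (hH : IsSmooth H) (hpH : IsPeriodic H) (hw : IsSmooth w) (hpw : IsPeriodic w) (x : Plane) :
    ∫ y in cell, H y * multiplier m w (x - y) = ∫ y in cell, w y * multiplier m H (x - y) := by
  rw [multiplier, multiplier, setIntegral_mul_synth (rapidDecay_multiplier hm hw hpw)
    hH.continuous hpH, setIntegral_mul_synth (rapidDecay_multiplier hm hH hpH) hw.continuous hpw]
  refine tsum_congr fun k => ?_
  ring

end FourierSeries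

end TorusCR

namespace TorusCR

/-! ### Fourier inversion -/

noncomputable section FourierInversion

open scoped Pointwise

/-- The point of the plane with coordinates `2πt`. -/
def dilate (t : Fin 2 → ℝ) : Plane := WithLp.toLp 2 ((2 * Real.pi) • t)

/-- A periodic function on the plane as a function on the unit torus. -/
def toUnitTorus (g : Plane → ℂ) (z : UnitAddTorus (Fin 2)) : ℂ :=
  g (dilate fun i => (AddCircle.equivIoc 1 (-(1 / 2)) (z i) : ℝ))

theorem toUnitTorus_mk {g : Plane → ℂ} (hp : IsPeriodic g) (t : Fin 2 → ℝ) :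
    toUnitTorus g (fun i => (t i : UnitAddCircle)) = g (dilate t) := by
  have h : ∀ i, ∃ n : ℤ, (AddCircle.equivIoc 1 (-(1 / 2)) (t i : UnitAddCircle) : ℝ) =
      t i + n := by
    intro i
    have h1 : ((AddCircle.equivIoc 1 (-(1 / 2)) (t i : UnitAddCircle) : ℝ) : UnitAddCircle) =
        (t i : UnitAddCircle) :=
      (AddCircle.equivIoc (1 : ℝ) (-(1 / 2))).symm_apply_apply (t i : UnitAddCircle)
    obtain ⟨n, hn⟩ := AddSubgroup.mem_zmultiples_iff.1 (QuotientAddGroup.eq.1 h1)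
    refine ⟨-n, ?_⟩
    rw [zsmul_eq_mul, mul_one] at hn
    push_cast
    linarith
  choose n hn using h
  rw [toUnitTorus, ← hp n (dilate t)]
  congr 1
  ext i
  simp only [dilate, latticeVec, hn, PiLp.add_apply, Pi.smul_apply, smul_eq_mul]
  ring

/-- The choice of representatives in `toUnitTorus` is discontinuous, so continuity is tested after
composition with the open quotient map from the plane, where periodicity removes the choice. -/
theorem continuous_toUnitTorus {g : Plane → ℂ} (hg : Continuous g) (hp : IsPeriodic g) :
    Continuous (toUnitTorus g) := by
  have hq : IsOpenQuotientMap (Pi.map fun (_ : Fin 2) (s : ℝ) => (s : UnitAddCircle)) :=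
    IsOpenQuotientMap.piMap fun _ => QuotientAddGroup.isOpenQuotientMap_mk
  rw [← hq.continuous_comp_iff]
  have e : toUnitTorus g ∘ (Pi.map fun (_ : Fin 2) (s : ℝ) => (s : UnitAddCircle)) =
      fun t => g (dilate t) := funext fun t => toUnitTorus_mk hp t
  rw [e]
  unfold dilate
  fun_prop

theorem mFourier_mk (k : Fin 2 → ℤ) (t : Fin 2 → ℝ) :
    UnitAddTorus.mFourier k (fun i => (t i : UnitAddCircle)) = character k (dilate t) := by
  simp only [UnitAddTorus.mFourier, ContinuousMap.coe_mk, Fin.prod_univ_two, fourier_coe_apply,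
    ← Complex.exp_add, character_eq, phase_apply, Fin.sum_univ_two, dilate, Pi.smul_apply,
    smul_eq_mul]
  congr 1
  push_cast
  ring

theorem mFourierCoeff_toUnitTorus {g : Plane → ℂ} (hp : IsPeriodic g) (k : Fin 2 → ℤ) :
    UnitAddTorus.mFourierCoeff (toUnitTorus g) k =
      (4 * (Real.pi : ℂ) ^ 2)⁻¹ * fcoef (-k) g := by
  rw [UnitAddTorus.mFourierCoeff_eq_integral _ _ fun _ => -(1 / 2)]
  simp only [mFourier_mk, toUnitTorus_mk hp, smul_eq_mul]
  set f : (Fin 2 → ℝ) → ℂ := fun t =>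
    character (-k) (WithLp.toLp 2 t) * g (WithLp.toLp 2 t) with hf
  -- The substitution `x = 2πt` maps the unit cell onto the half-open cell and produces the factor
  -- `(4π²)⁻¹`.
  have h1 := Measure.setIntegral_comp_smul_of_pos (volume : Measure (Fin 2 → ℝ)) f
    {x : Fin 2 → ℝ | ∀ i, x i ∈ Ioc (-(1 / 2) : ℝ) (-(1 / 2) + 1)}
    (show 0 < 2 * Real.pi by positivity)
  have h2 : (2 * Real.pi) • {x : Fin 2 → ℝ | ∀ i, x i ∈ Ioc (-(1 / 2) : ℝ) (-(1 / 2) + 1)} =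
      {x : Fin 2 → ℝ | ∀ i, x i ∈ Ioc (-Real.pi) Real.pi} := by
    ext x
    rw [Set.mem_smul_set_iff_inv_smul_mem₀ (by positivity)]
    simp only [mem_ofPred_eq, Pi.smul_apply, smul_eq_mul, mem_Ioc]
    refine forall_congr' fun i => ?_
    rw [lt_inv_mul_iff₀ (by positivity), inv_mul_le_iff₀ (by positivity)]
    constructor <;> rintro ⟨a, b⟩ <;> constructor <;> linarith
  rw [h2] at h1
  refine h1.trans ?_
  have h3 := (PiLp.volume_preserving_ofLp (Fin 2)).setIntegral_preimage_emb
    (MeasurableEquiv.toLp 2 (Fin 2 → ℝ)).symm.measurableEmbedding f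
    {x : Fin 2 → ℝ | ∀ i, x i ∈ Ioc (-Real.pi) Real.pi}
  rw [← h3, fcoef, setIntegral_congr_set cell_ae_eq_halfCell]
  have h4 : (((2 * Real.pi) ^ Module.finrank ℝ (Fin 2 → ℝ))⁻¹ : ℝ) = (4 * Real.pi ^ 2)⁻¹ := by
    simp
    ring
  rw [h4, Complex.real_smul]
  push_cast
  rfl

/-- Pointwise Fourier inversion for smooth functions on the torus. -/
theorem multiplier_const {g : Plane → ℂ} (hg : IsSmooth g) (hp : IsPeriodic g) :
    multiplier (fun _ => (4 * (Real.pi : ℂ) ^ 2)⁻¹) g = g := by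
  funext x
  set f : C(UnitAddTorus (Fin 2), ℂ) := ⟨toUnitTorus g, continuous_toUnitTorus hg.continuous hp⟩
  have hco : ∀ k, UnitAddTorus.mFourierCoeff f k = (4 * (Real.pi : ℂ) ^ 2)⁻¹ * fcoef (-k) g :=
    mFourierCoeff_toUnitTorus hp
  have hr := (rapidDecay_fcoef hg hp).comp_neg
  have hs : Summable (UnitAddTorus.mFourierCoeff f) := by
    simp only [funext hco]
    exact (Summable.of_norm hr.summable).mul_left _
  set t : Fin 2 → ℝ := fun i => (2 * Real.pi)⁻¹ * x i
  have ht : dilate t = x := by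
    ext i
    simp only [dilate, t, Pi.smul_apply, smul_eq_mul]
    field_simp
  have h := UnitAddTorus.hasSum_mFourier_series_apply_of_summable hs
    (fun i => (t i : UnitAddCircle))
  simp only [mFourier_mk, ht, hco, smul_eq_mul] at h
  refine h.tsum_eq.trans ?_
  exact (toUnitTorus_mk hp t).trans (by rw [ht])

/-! ### The Green functions as multipliers -/

/-- The symbol of `K`. -/
def symbolK (k : Fin 2 → ℤ) : ℂ :=
  if k = 0 then 0 else (4 * (Real.pi : ℂ) ^ 2)⁻¹ * (∑ i, (k i : ℂ) ^ 2)⁻¹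

/-- The convolution `K * g`. -/
def convK (g : Plane → ℂ) (x : Plane) : ℂ := greenK fun y => g (x - y)

theorem polyGrowth_symbolK : PolyGrowth symbolK := by
  refine ⟨0, ‖(4 * (Real.pi : ℂ) ^ 2)⁻¹‖, norm_nonneg _, fun k => ?_⟩
  rw [pow_zero, mul_one, symbolK]
  split_ifs with hk
  · rw [norm_zero]
    exact norm_nonneg _
  · rw [norm_mul]
    refine mul_le_of_le_one_right (norm_nonneg _) ?_
    have h : ((∑ i, (k i) ^ 2 : ℤ) : ℂ) = ∑ i, (k i : ℂ) ^ 2 := by push_cast; rfl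
    rw [← h, norm_inv, Complex.norm_intCast]
    refine inv_le_one_of_one_le₀ ?_
    have h1 : 0 < ∑ i, (k i) ^ 2 := by
      obtain ⟨i, hi⟩ := Function.ne_iff.1 hk
      exact Finset.sum_pos' (fun i _ => sq_nonneg _) ⟨i, Finset.mem_univ _, by
        have : k i ≠ 0 := hi
        positivity⟩
    have h2 : (1 : ℝ) ≤ ((∑ i, (k i) ^ 2 : ℤ) : ℝ) := by exact_mod_cast h1
    exact h2.trans (le_abs_self _)

theorem convK_eq_multiplier {g : Plane → ℂ} (hp : IsPeriodic g) :
    convK g = multiplier symbolK g := by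
  funext x
  rw [convK, greenK, multiplier, synth, ← tsum_mul_left]
  refine tsum_congr fun k => ?_
  have := fcoef_sub_left k hp x
  rw [fcoef] at this
  rw [symbolK]
  split_ifs with hk
  · simp
  · rw [this]
    ring

theorem multiplier_smooth {m : (Fin 2 → ℤ) → ℂ} (hm : PolyGrowth m) {g : Plane → ℂ}
    (hg : IsSmooth g) (hp : IsPeriodic g) : IsSmooth (multiplier m g) :=
  (rapidDecay_multiplier hm hg hp).isSmooth_synth

theorem pderiv_multiplier {m : (Fin 2 → ℤ) → ℂ} (hm : PolyGrowth m) {g : Plane → ℂ}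
    (hg : IsSmooth g) (hp : IsPeriodic g) (i : Fin 2) :
    pderiv i (multiplier m g) = multiplier m (pderiv i g) := by
  funext x
  rw [pderiv, multiplier, (rapidDecay_multiplier hm hg hp).fderiv_synth]
  refine tsum_congr fun k => ?_
  simp only [fcoef_pderiv _ hg hp, Pi.neg_apply]
  push_cast
  ring

variable {g h : Plane → ℂ}

theorem IsSmooth.pderiv (hg : IsSmooth g) (i : Fin 2) : IsSmooth (pderiv i g) :=
  hg.fderiv_apply _

theorem IsPeriodic.pderiv (hp : IsPeriodic g) (i : Fin 2) : IsPeriodic (pderiv i g) :=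
  hp.fderiv_apply _

theorem convK_smooth (hg : IsSmooth g) (hp : IsPeriodic g) : IsSmooth (convK g) := by
  rw [convK_eq_multiplier hp]
  exact multiplier_smooth polyGrowth_symbolK hg hp

theorem convK_periodic (hp : IsPeriodic g) : IsPeriodic (convK g) := by
  rw [convK_eq_multiplier hp]
  exact isPeriodic_synth _

theorem pderiv_convK (hg : IsSmooth g) (hp : IsPeriodic g) (i : Fin 2) :
    pderiv i (convK g) = convK (pderiv i g) := by
  rw [convK_eq_multiplier hp, convK_eq_multiplier (hp.pderiv i),
    pderiv_multiplier polyGrowth_symbolK hg hp]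

/-- `K * g` solves the Poisson equation. -/
theorem laplacian_convK (hg : IsSmooth g) (hp : IsPeriodic g) (x : Plane) :
    pderiv 0 (pderiv 0 (convK g)) x + pderiv 1 (pderiv 1 (convK g)) x =
      (4 * (Real.pi : ℂ) ^ 2)⁻¹ * fcoef 0 g - g x := by
  have hr := rapidDecay_multiplier polyGrowth_symbolK hg hp
  have hd : ∀ i, HasSum (fun k => -((k i : ℂ) ^ 2 * symbolK k * fcoef (-k) g) * character k x)
      (pderiv i (pderiv i (convK g)) x) := by
    intro i
    have h1 := (rapidDecay_multiplier polyGrowth_symbolK ((hg.pderiv i).pderiv i)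
      ((hp.pderiv i).pderiv i)).hasSum x
    rw [pderiv_convK hg hp, pderiv_convK (hg.pderiv i) (hp.pderiv i),
      convK_eq_multiplier ((hp.pderiv i).pderiv i)]
    change HasSum _ (synth _ x)
    convert h1 using 2 with k
    rw [fcoef_pderiv _ (hg.pderiv i) (hp.pderiv i), fcoef_pderiv _ hg hp]
    simp only [Pi.neg_apply]
    push_cast
    linear_combination -(k i : ℂ) ^ 2 * symbolK k * fcoef (-k) g * character k x * Complex.I_sq
  have h2 : HasSum (fun k => (4 * (Real.pi : ℂ) ^ 2)⁻¹ * fcoef (-k) g * character k x) (g x) := by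
    have hc : PolyGrowth fun _ => (4 * (Real.pi : ℂ) ^ 2)⁻¹ :=
      ⟨0, _, norm_nonneg _, fun k => by rw [pow_zero, mul_one]⟩
    have h3 := (rapidDecay_multiplier hc hg hp).hasSum x
    have h4 := congrFun (multiplier_const hg hp) x
    rw [multiplier] at h4
    rwa [h4] at h3
  have h5 := ((hd 0).add (hd 1)).add h2
  -- The symbol of `ΔK` is `-(4π²)⁻¹` at every nonzero frequency and cancels against the inversion
  -- formula for `g`; only the mean survives.
  have h6 : ∀ k, -((k 0 : ℂ) ^ 2 * symbolK k * fcoef (-k) g) * character k x +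
      -((k 1 : ℂ) ^ 2 * symbolK k * fcoef (-k) g) * character k x +
      (4 * (Real.pi : ℂ) ^ 2)⁻¹ * fcoef (-k) g * character k x =
      if k = 0 then (4 * (Real.pi : ℂ) ^ 2)⁻¹ * fcoef 0 g else 0 := by
    intro k
    split_ifs with hk
    · subst hk
      simp [symbolK, character_zero]
    · have hne : ∑ i, (k i : ℂ) ^ 2 ≠ 0 := by
        have h : ((∑ i, (k i) ^ 2 : ℤ) : ℂ) = ∑ i, (k i : ℂ) ^ 2 := by push_cast; rfl
        rw [← h, Int.cast_ne_zero]
        obtain ⟨i, hi⟩ := Function.ne_iff.1 hk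
        have : k i ≠ 0 := hi
        exact (Finset.sum_pos' (fun i _ => sq_nonneg _)
          ⟨i, Finset.mem_univ _, by positivity⟩).ne'
      have e : (k 0 : ℂ) ^ 2 * symbolK k + (k 1 : ℂ) ^ 2 * symbolK k =
          (4 * (Real.pi : ℂ) ^ 2)⁻¹ := by
        rw [← add_mul, symbolK, if_neg hk, ← Fin.sum_univ_two (fun i => (k i : ℂ) ^ 2)]
        field_simp
      linear_combination -fcoef (-k) g * character k x * e
  simp only [h6] at h5
  have h7 := h5.unique (hasSum_ite_eq 0 _)
  linear_combination h7

/-- The sign from the distributional derivative of `K` and the sign from differentiating `g(x - ·)`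
cancel. -/
theorem convG_eq (hg : IsSmooth g) (hp : IsPeriodic g) (x : Plane) :
    convG g x = pderiv 0 (convK g) x - Complex.I * pderiv 1 (convK g) x := by
  have h1 : ∀ i, pderiv i (fun y => g (x - y)) = fun y => -(pderiv i g (x - y)) := by
    intro i
    funext y
    have h2 : HasFDerivAt (fun y : Plane => x - y) (-ContinuousLinearMap.id ℝ Plane) y := by
      simpa using (hasFDerivAt_id y).const_sub x
    have h3 := ((hg.differentiable (by simp) (x - y)).hasFDerivAt.comp y h2).fderiv
    rw [TorusCR.pderiv, show (fun y => g (x - y)) = g ∘ fun y => x - y from rfl, h3]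
    simp [TorusCR.pderiv]
  have h4 : ∀ f : Plane → ℂ, greenK (fun y => -f y) = -greenK f := by
    intro f
    rw [greenK, greenK, ← mul_neg, ← tsum_neg]
    congr 1
    refine tsum_congr fun k => ?_
    split_ifs
    · simp
    · simp [integral_neg]
  rw [convG, greenG, h1, h1, h4, h4, neg_neg, neg_neg, pderiv_convK hg hp, pderiv_convK hg hp]
  rfl

theorem setIntegral_mul_convK (hg : IsSmooth g) (hp : IsPeriodic g) (hh : IsSmooth h)
    (hhp : IsPeriodic h) (x : Plane) :
    ∫ y in cell, g y * convK h (x - y) = ∫ y in cell, h y * convK g (x - y) := by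
  rw [convK_eq_multiplier hp, convK_eq_multiplier hhp]
  exact setIntegral_mul_multiplier polyGrowth_symbolK hg hp hh hhp x

theorem convK_add (hg : IsSmooth g) (hp : IsPeriodic g) (hh : IsSmooth h) (hhp : IsPeriodic h) :
    convK (fun x => g x + h x) = fun x => convK g x + convK h x := by
  rw [convK_eq_multiplier hp, convK_eq_multiplier hhp, convK_eq_multiplier (hp.comp₂ hhp _)]
  funext x
  have h1 := (rapidDecay_multiplier polyGrowth_symbolK hg hp).hasSum x
  have h2 := (rapidDecay_multiplier polyGrowth_symbolK hh hhp).hasSum x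
  refine Eq.trans (tsum_congr fun k => ?_) (h1.add h2).tsum_eq
  have c1 := hg.continuous
  have c2 := hh.continuous
  have c3 := (isSmooth_character (-k)).continuous
  simp only [fcoef, mul_add]
  rw [integral_add (integrableOn_cell (by fun_prop)) (integrableOn_cell (by fun_prop))]
  ring

theorem convK_const_mul (hp : IsPeriodic g) (c : ℂ) :
    convK (fun x => c * g x) = fun x => c * convK g x := by
  rw [convK_eq_multiplier hp, convK_eq_multiplier (hp.comp fun z => c * z)]
  funext x
  rw [multiplier, multiplier, synth, synth, ← tsum_mul_left]
  refine tsum_congr fun k => ?_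
  have : ∀ y, character (-k) y * (c * g y) = c * (character (-k) y * g y) := fun y => by ring
  simp only [fcoef, this]
  rw [integral_const_mul]
  ring

/-- The symbol of `K` is real and even, so conjugation amounts to the reindexing `k ↦ -k`. -/
theorem convK_ofReal_im {w : Plane → ℝ} (hp : IsPeriodic w) (x : Plane) :
    (convK (fun y => (w y : ℂ)) x).im = 0 := by
  rw [← Complex.conj_eq_iff_im, convK_eq_multiplier (hp.comp fun r => (r : ℂ)), multiplier, synth,
    Complex.conj_tsum, ← (Equiv.neg (Fin 2 → ℤ)).tsum_eq]
  refine tsum_congr fun k => ?_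
  have h1 : conj (symbolK (-k)) = symbolK k := by
    simp only [symbolK, neg_eq_zero]
    split_ifs
    · simp
    · simp [Complex.conj_ofReal, map_ofNat]
  have h2 : conj (fcoef k fun y => (w y : ℂ)) = fcoef (-k) fun y => (w y : ℂ) := by
    rw [fcoef, ← integral_conj]
    simp [fcoef, character_conj]
  simp only [Equiv.neg_apply, map_mul, h1, neg_neg, h2, character_conj]

end FourierInversion

end TorusCR

namespace TorusCR

/-! ### Averages against a compactly supported kernel -/

noncomputable section Averages

/-- The partial derivative of a real function. -/
def pd (i : Fin 2) (f : Plane → ℝ) (x : Plane) : ℝ := fderiv ℝ f x (stdVec i)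

/-- The average `∫ Φ(z) f(x + t z) dz`. -/
def avg {F : Type*} [NormedAddCommGroup F] [NormedSpace ℝ F] (Φ : Plane → ℝ) (t : ℝ)
    (f : Plane → F) (x : Plane) : F := ∫ z, Φ z • f (x + t • z)

theorem IsSmooth.pd {f : Plane → ℝ} (hf : IsSmooth f) (i : Fin 2) : IsSmooth (pd i f) :=
  hf.fderiv_apply _

theorem IsPeriodic.pd {f : Plane → ℝ} (hf : IsPeriodic f) (i : Fin 2) : IsPeriodic (pd i f) :=
  hf.fderiv_apply _

theorem norm_stdVec (i : Fin 2) : ‖stdVec i‖ = 1 := by simp [stdVec]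

theorem hasCompactSupport_pd {f : Plane → ℝ} (hf : HasCompactSupport f) (i : Fin 2) :
    HasCompactSupport (pd i f) := hf.fderiv_apply (𝕜 := ℝ) (stdVec i)

theorem tsupport_pd_subset (f : Plane → ℝ) (i : Fin 2) : tsupport (pd i f) ⊆ tsupport f :=
  tsupport_fderiv_apply_subset ℝ (stdVec i)

theorem norm_fderiv_le_pd {f : Plane → ℝ} {B : ℝ} {x : Plane} (h : ∀ i, |pd i f x| ≤ B) :
    ‖fderiv ℝ f x‖ ≤ 2 * B := by
  have hB : 0 ≤ B := (abs_nonneg _).trans (h 0)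
  refine ContinuousLinearMap.opNorm_le_bound _ (by positivity) fun v => ?_
  have h0 := PiLp.norm_apply_le v 0
  have h1 := PiLp.norm_apply_le v 1
  rw [plane_eq_sum v, map_add, map_smul, map_smul, ← plane_eq_sum v]
  refine (norm_add_le _ _).trans ?_
  rw [norm_smul, norm_smul]
  have a0 := mul_le_mul h0 (h 0) (abs_nonneg _) (norm_nonneg v)
  have a1 := mul_le_mul h1 (h 1) (abs_nonneg _) (norm_nonneg v)
  simp only [pd, ← Real.norm_eq_abs] at a0 a1
  linarith

/-- A bound on the partial derivatives gives a Lipschitz bound. -/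
theorem abs_sub_le_of_pd {f : Plane → ℝ} (hf : IsSmooth f) {B : ℝ}
    (h : ∀ i x, |pd i f x| ≤ B) (x y : Plane) : |f x - f y| ≤ 2 * B * ‖x - y‖ :=
  Convex.norm_image_sub_le_of_norm_fderiv_le (𝕜 := ℝ) (s := univ)
    (fun z _ => hf.differentiable (by simp) z) (fun z _ => norm_fderiv_le_pd fun i => h i z)
    convex_univ (mem_univ y) (mem_univ x)

section AvgVector

variable {F : Type*} [NormedAddCommGroup F] [NormedSpace ℝ F]

theorem integrable_avg {Φ : Plane → ℝ} (hΦ : Continuous Φ) (hc : HasCompactSupport Φ)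
    {f : Plane → F} (hf : Continuous f) (t : ℝ) (x : Plane) :
    Integrable fun z => Φ z • f (x + t • z) :=
  Continuous.integrable_of_hasCompactSupport (by fun_prop) hc.smul_right

theorem norm_avg_le {Φ : Plane → ℝ} (hΦ : Continuous Φ) (hc : HasCompactSupport Φ)
    {f : Plane → F} {M : ℝ} {t : ℝ} {x : Plane} (hM : ∀ z ∈ tsupport Φ, ‖f (x + t • z)‖ ≤ M) :
    ‖avg Φ t f x‖ ≤ (∫ z, |Φ z|) * M := by
  rw [← integral_mul_const]
  refine norm_integral_le_of_norm_le ((hΦ.integrable_of_hasCompactSupport hc).abs.mul_const M)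
    (Eventually.of_forall fun z => ?_)
  rw [norm_smul, Real.norm_eq_abs]
  by_cases hz : z ∈ tsupport Φ
  · exact mul_le_mul_of_nonneg_left (hM z hz) (abs_nonneg _)
  · simp [image_eq_zero_of_notMem_tsupport hz]

theorem IsPeriodic.avg {f : Plane → F} (hf : IsPeriodic f) (Φ : Plane → ℝ) (t : ℝ) :
    IsPeriodic (avg Φ t f) := fun n x => by
  have : ∀ z : Plane, f (x + latticeVec n + t • z) = f (x + t • z) := fun z => by
    rw [add_right_comm, hf n]
  simp only [TorusCR.avg, this]

theorem hasFDerivAt_avg {Φ : Plane → ℝ} (hΦ : Continuous Φ) (hc : HasCompactSupport Φ)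
    {f : Plane → F} (hf : IsSmooth f) (hp : IsPeriodic f) (t : ℝ) (x : Plane) :
    HasFDerivAt (avg Φ t f) (avg Φ t (fderiv ℝ f) x) x := by
  obtain ⟨M, hM0, hM⟩ := hp.fderiv.exists_bound hf.fderiv.continuous
  refine hasFDerivAt_integral_of_dominated_of_fderiv_le (s := univ)
    (F' := fun x z => Φ z • fderiv ℝ f (x + t • z)) (bound := fun z => |Φ z| * M) univ_mem
    (Eventually.of_forall fun y => (integrable_avg hΦ hc hf.continuous t y).aestronglyMeasurable)
    (integrable_avg hΦ hc hf.continuous t x)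
    (integrable_avg hΦ hc hf.fderiv.continuous t x).aestronglyMeasurable
    (Eventually.of_forall fun z y _ => ?_)
    ((hΦ.integrable_of_hasCompactSupport hc).abs.mul_const M)
    (Eventually.of_forall fun z y _ => ?_)
  · rw [norm_smul, Real.norm_eq_abs]
    exact mul_le_mul_of_nonneg_left (hM _) (abs_nonneg _)
  · have h1 := (hf.differentiable (by simp) (y + t • z)).hasFDerivAt
    have h2 : HasFDerivAt (fun y : Plane => y + t • z) (ContinuousLinearMap.id ℝ Plane) y :=
      (hasFDerivAt_id y).add_const _
    exact (h1.comp y h2).const_smul (Φ z)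

end AvgVector

theorem IsSmooth.avg {F : Type} [NormedAddCommGroup F] [NormedSpace ℝ F] {Φ : Plane → ℝ}
    (hΦ : Continuous Φ) (hc : HasCompactSupport Φ) {f : Plane → F} (hf : IsSmooth f)
    (hp : IsPeriodic f) (t : ℝ) : IsSmooth (avg Φ t f) := by
  -- Differentiation replaces the target by a space of linear maps, so the induction on the order
  -- has to range over all targets.
  have key : ∀ (n : ℕ) (F : Type) [NormedAddCommGroup F] [NormedSpace ℝ F] (f : Plane → F),
      IsSmooth f → IsPeriodic f → ContDiff ℝ n (TorusCR.avg Φ t f) := by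
    intro n
    induction n with
    | zero =>
      intro F _ _ f hf hp
      exact contDiff_zero.2 (continuous_iff_continuousAt.2 fun x =>
        (hasFDerivAt_avg hΦ hc hf hp t x).continuousAt)
    | succ n ih =>
      intro F _ _ f hf hp
      exact contDiff_succ_iff_hasFDerivAt.2 ⟨_, ih _ _ hf.fderiv hp.fderiv,
        fun x => hasFDerivAt_avg hΦ hc hf hp t x⟩
  exact contDiff_infty.2 fun n => key n F f hf hp

theorem pd_avg {Φ : Plane → ℝ} (hΦ : Continuous Φ) (hc : HasCompactSupport Φ)
    {f : Plane → ℝ} (hf : IsSmooth f) (hp : IsPeriodic f) (t : ℝ) (i : Fin 2) :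
    pd i (avg Φ t f) = avg Φ t (pd i f) := by
  funext x
  rw [pd, (hasFDerivAt_avg hΦ hc hf hp t x).fderiv]
  exact ContinuousLinearMap.integral_apply
    (integrable_avg hΦ hc hf.fderiv.continuous t x) (stdVec i)

/-- Integration by parts on the plane. -/
theorem integral_mul_pd {φ f : Plane → ℝ} (hφ : IsSmooth φ) (hc : HasCompactSupport φ)
    (hf : IsSmooth f) (i : Fin 2) : ∫ x, φ x * pd i f x = -∫ x, pd i φ x * f x := by
  have h1 := hφ.continuous
  have h2 := hf.continuous
  have h3 := (hf.pd i).continuous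
  have h4 := (hφ.pd i).continuous
  exact integral_mul_fderiv_eq_neg_fderiv_mul_of_integrable
    (Continuous.integrable_of_hasCompactSupport (h4.mul h2) (hasCompactSupport_pd hc i).mul_right)
    (Continuous.integrable_of_hasCompactSupport (h1.mul h3) hc.mul_right)
    (Continuous.integrable_of_hasCompactSupport (h1.mul h2) hc.mul_right)
    (fun x _ => hφ.differentiable (by simp) x) (fun x _ => hf.differentiable (by simp) x)

theorem pd_comp_affine {f : Plane → ℝ} (hf : IsSmooth f) (x : Plane) (t : ℝ) (i : Fin 2) :
    pd i (fun z => f (x + t • z)) = fun z => t * pd i f (x + t • z) := by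
  funext z
  have h1 := (hf.differentiable (by simp) (x + t • z)).hasFDerivAt
  have h2 : HasFDerivAt (fun z : Plane => x + t • z) (t • ContinuousLinearMap.id ℝ Plane) z :=
    ((hasFDerivAt_id z).const_smul t).const_add x
  rw [pd, show (fun z => f (x + t • z)) = f ∘ fun z => x + t • z from rfl, (h1.comp z h2).fderiv]
  simp [pd]

/-- A derivative moves from `f` onto the kernel at the price of one factor `1/t`. All gains and
losses of powers of the scale below come from this identity, kept free of division so that it also
holds at `t = 0`. -/
theorem mul_avg_pd {Φ f : Plane → ℝ} (hΦ : IsSmooth Φ) (hc : HasCompactSupport Φ)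
    (hf : IsSmooth f) (t : ℝ) (i : Fin 2) (x : Plane) :
    t * avg Φ t (pd i f) x = -avg (pd i Φ) t f x := by
  have hs : IsSmooth fun z => f (x + t • z) :=
    hf.comp (contDiff_const.add (contDiff_id.const_smul t))
  have h := integral_mul_pd hΦ hc hs i
  rw [pd_comp_affine hf] at h
  simp only [avg, smul_eq_mul, ← h, ← integral_const_mul]
  exact integral_congr_ae (Eventually.of_forall fun z => by simp only; ring)

theorem continuous_avg_scale {Φ f : Plane → ℝ} (hΦ : Continuous Φ) (hc : HasCompactSupport Φ)
    (hf : Continuous f) (hp : IsPeriodic f) (x : Plane) : Continuous fun t => avg Φ t f x := by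
  obtain ⟨M, hM0, hM⟩ := hp.exists_bound hf
  refine continuous_of_dominated (bound := fun z => |Φ z| * M)
    (fun t => (integrable_avg hΦ hc hf t x).aestronglyMeasurable)
    (fun t => Eventually.of_forall fun z => ?_)
    ((hΦ.integrable_of_hasCompactSupport hc).abs.mul_const M)
    (Eventually.of_forall fun z => by fun_prop)
  rw [norm_smul, Real.norm_eq_abs]
  exact mul_le_mul_of_nonneg_left (hM _) (abs_nonneg _)

end Averages

/-! ### Hölder–Zygmund bounds -/

noncomputable section HolderZygmund

/-- `A` bounds the Hölder–Zygmund norm of negative order `α` of `f`. -/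
def HZBound (α : ℝ) (f : TestSpace → ℝ) (A : ℝ) : Prop :=
  ∀ (x : Plane), ∀ lam ∈ Ioc (0 : ℝ) 1, ∀ φ ∈ ballTests ⌊-α + 1⌋₊,
    |f (periodize (rescale φ lam x))| ≤ A * lam ^ α

theorem hzReal_le_iff {α : ℝ} (hα : α < 0) {f : TestSpace → ℝ} {A : ℝ} (hA : 0 ≤ A) :
    hzReal α f ≤ ENNReal.ofReal A ↔ HZBound α f A := by
  rw [hzReal, if_neg (not_le.2 hα)]
  simp only [iSup_le_iff, HZBound]
  refine forall_congr' fun x => forall_congr' fun lam => forall_congr' fun hl =>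
    forall_congr' fun φ => forall_congr' fun _ => ?_
  rw [ENNReal.ofReal_le_ofReal_iff hA, div_le_iff₀ (Real.rpow_pos_of_pos hl.1 _)]

theorem HZBound.mono {α : ℝ} {f : TestSpace → ℝ} {A B : ℝ} (h : HZBound α f A) (hAB : A ≤ B) :
    HZBound α f B := fun x lam hl φ hφ =>
  (h x lam hl φ hφ).trans (mul_le_mul_of_nonneg_right hAB (Real.rpow_nonneg hl.1.le _))

theorem ballTests_smooth {r : ℕ} {φ : Plane → ℝ} (h : φ ∈ ballTests r) : IsSmooth φ := h.1

theorem ballTests_compact {r : ℕ} {φ : Plane → ℝ} (h : φ ∈ ballTests r) : HasCompactSupport φ :=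
  h.2.1

theorem abs_le_one_of_mem_ballTests {r : ℕ} {φ : Plane → ℝ} (h : φ ∈ ballTests r) (x : Plane) :
    |φ x| ≤ 1 := by
  simpa using h.2.2.2 0 (Nat.zero_le _) Fin.elim0 x

theorem abs_pd_le_one_of_mem_ballTests {r : ℕ} (hr : 1 ≤ r) {φ : Plane → ℝ} (h : φ ∈ ballTests r)
    (i : Fin 2) (x : Plane) : |pd i φ x| ≤ 1 := by
  simpa [iteratedFDeriv_one_apply, pd] using h.2.2.2 1 hr (fun _ => i) x

theorem zero_mem_ballTests (r : ℕ) : (fun _ => 0 : Plane → ℝ) ∈ ballTests r := by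
  refine ⟨contDiff_const, HasCompactSupport.zero, ?_, fun k _ i x => ?_⟩
  · rw [show (fun _ => 0 : Plane → ℝ) = 0 from rfl, tsupport_zero]
    exact empty_subset _
  · rw [show (fun _ => 0 : Plane → ℝ) = 0 from rfl, iteratedFDeriv_zero]
    simp

theorem HZBound.nonneg {α : ℝ} {f : TestSpace → ℝ} {A : ℝ} (h : HZBound α f A) : 0 ≤ A := by
  have := h 0 1 ⟨one_pos, le_rfl⟩ _ (zero_mem_ballTests _)
  rw [Real.one_rpow, mul_one] at this
  exact (abs_nonneg _).trans this

theorem rescale_smooth {φ : Plane → ℝ} (h : IsSmooth φ) (lam : ℝ) (x : Plane) :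
    IsSmooth (rescale φ lam x) :=
  contDiff_const.mul (h.comp ((contDiff_id.sub contDiff_const).const_smul lam⁻¹))

theorem rescale_compact {φ : Plane → ℝ} (h : HasCompactSupport φ) {lam : ℝ} (hl : lam ≠ 0)
    (x : Plane) : HasCompactSupport (rescale φ lam x) := by
  have h1 := h.comp_homeomorph ((Homeomorph.subRight x).trans
    (Homeomorph.smulOfNeZero lam⁻¹ (inv_ne_zero hl)))
  exact h1.mul_left

theorem integral_rescale_smul {F : Type*} [NormedAddCommGroup F] [NormedSpace ℝ F]
    (φ : Plane → ℝ) {lam : ℝ} (hl : 0 < lam) (x : Plane) (f : Plane → F) :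
    ∫ y, rescale φ lam x y • f y = avg φ lam f x := by
  have h1 := integral_sub_right_eq_self (μ := (volume : Measure Plane))
    (fun y => (lam⁻¹ ^ 2 * φ (lam⁻¹ • y)) • f (x + y)) x
  simp only [add_sub_cancel] at h1
  have h2 := Measure.integral_comp_inv_smul_of_nonneg (volume : Measure Plane)
    (fun z => φ z • f (x + lam • z)) hl.le
  simp only [smul_inv_smul₀ hl.ne', finrank_euclideanSpace_fin] at h2
  simp only [rescale, avg]
  rw [h1]
  simp only [mul_smul]
  rw [integral_smul, h2, smul_smul, ← mul_pow, inv_mul_cancel₀ hl.ne', one_pow, one_smul]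

theorem funDist_rescale {F : Type*} [NormedAddCommGroup F] [NormedSpace ℝ F]
    {φ : Plane → ℝ} (h : IsSmooth φ) (hc : HasCompactSupport φ) {lam : ℝ}
    (hl : 0 < lam) (x : Plane) {f : Plane → F} (hf : Continuous f) (hp : IsPeriodic f) :
    funDist f (periodize (rescale φ lam x)) = avg φ lam f x := by
  rw [funDist, setIntegral_periodize_smul (rescale_smooth h lam x) (rescale_compact hc hl.ne' x)
    hp hf, integral_rescale_smul φ hl]

/-- Testing a function with a kernel which is bounded in `C^r`. -/
theorem HZBound.abs_avg_le {α A M t : ℝ} {f Φ : Plane → ℝ} (h : HZBound α (funDist f) A)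
    (hf : Continuous f) (hp : IsPeriodic f) (hΦ : IsSmooth Φ) (hc : HasCompactSupport Φ)
    (hs : tsupport Φ ⊆ Metric.ball 0 1)
    (hM : ∀ k ≤ ⌊-α + 1⌋₊, ∀ x, ‖iteratedFDeriv ℝ k Φ x‖ ≤ M) (ht : t ∈ Ioc (0 : ℝ) 1)
    (x : Plane) : |avg Φ t f x| ≤ M * A * t ^ α := by
  have hM0 : 0 ≤ M := (norm_nonneg _).trans (hM 0 (Nat.zero_le _) 0)
  -- For `M = 0` the kernel vanishes; otherwise `M⁻¹ Φ` is an admissible test function.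
  rcases hM0.eq_or_lt with rfl | hMpos
  · have : ∀ z, Φ z = 0 := fun z => by
      simpa using hM 0 (Nat.zero_le _) z
    simp [avg, this]
  have hmem : (fun z => M⁻¹ • Φ z) ∈ ballTests ⌊-α + 1⌋₊ := by
    refine ⟨hΦ.const_smul M⁻¹, hc.smul_left (f := fun _ => M⁻¹),
      (tsupport_smul_subset_right (fun _ => M⁻¹) Φ).trans hs, fun k hk i x => ?_⟩
    have hle : ((k : ℕ∞) : WithTop ℕ∞) ≤ ((⊤ : ℕ∞) : WithTop ℕ∞) := by
      exact_mod_cast le_top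
    rw [iteratedFDeriv_const_smul_apply' ((hΦ.of_le hle).contDiffAt)]
    rw [_root_.smul_apply, smul_eq_mul, abs_mul, abs_inv, abs_of_pos hMpos,
      inv_mul_le_iff₀ hMpos, mul_one]
    have h3 := (iteratedFDeriv ℝ k Φ x).le_opNorm fun j => stdVec (i j)
    simp only [norm_stdVec, Finset.prod_const_one, mul_one] at h3
    exact h3.trans (hM k hk x)
  have h1 := h x t ht _ hmem
  rw [funDist_rescale (ballTests_smooth hmem) (ballTests_compact hmem) ht.1 x hf hp] at h1
  have h2 : avg (fun z => M⁻¹ • Φ z) t f x = M⁻¹ * avg Φ t f x := by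
    simp only [avg, smul_eq_mul, mul_assoc, integral_const_mul]
  rw [h2, abs_mul, abs_inv, abs_of_pos hMpos, inv_mul_le_iff₀ hMpos] at h1
  linarith

/-- A common bound for the derivatives up to order `r` of a kernel. -/
theorem exists_iteratedFDeriv_bound {Φ : Plane → ℝ} (hΦ : IsSmooth Φ)
    (hc : HasCompactSupport Φ) (r : ℕ) :
    ∃ M, 0 ≤ M ∧ ∀ k ≤ r, ∀ x, ‖iteratedFDeriv ℝ k Φ x‖ ≤ M := by
  have h1 : ∀ k : ℕ, ∃ M, ∀ x, ‖iteratedFDeriv ℝ k Φ x‖ ≤ M := fun k =>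
    (hΦ.continuous_iteratedFDeriv (by exact_mod_cast le_top)).bounded_above_of_compact_support
      (hc.iteratedFDeriv k)
  choose M hM using h1
  refine ⟨∑ k ∈ Finset.range (r + 1), |M k|, by positivity, fun k hk x => ?_⟩
  refine ((hM k x).trans (le_abs_self _)).trans ?_
  exact Finset.single_le_sum (f := fun k => |M k|) (fun _ _ => abs_nonneg _)
    (Finset.mem_range.2 (by omega))

theorem IsPeriodic.iteratedFDeriv {F : Type*} [NormedAddCommGroup F] [NormedSpace ℝ F]
    {S : Plane → F} (hp : IsPeriodic S) (k : ℕ) : IsPeriodic (iteratedFDeriv ℝ k S) := by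
  intro n x
  rw [← iteratedFDeriv_comp_add_right]
  congr 1
  exact funext fun y => hp n y

theorem IsPeriodic.exists_iteratedFDeriv_bound {S : Plane → ℝ} (hp : IsPeriodic S)
    (hS : IsSmooth S) (r : ℕ) :
    ∃ M, 0 ≤ M ∧ ∀ k ≤ r, ∀ x, ‖_root_.iteratedFDeriv ℝ k S x‖ ≤ M := by
  have h1 : ∀ k : ℕ, ∃ M, 0 ≤ M ∧ ∀ x, ‖_root_.iteratedFDeriv ℝ k S x‖ ≤ M := fun k =>
    (hp.iteratedFDeriv k).exists_bound (hS.continuous_iteratedFDeriv (by exact_mod_cast le_top))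
  choose M hM0 hM using h1
  refine ⟨∑ k ∈ Finset.range (r + 1), M k, Finset.sum_nonneg fun k _ => hM0 k, fun k hk x => ?_⟩
  exact (hM k x).trans (Finset.single_le_sum (f := M) (fun k _ => hM0 k)
    (Finset.mem_range.2 (by omega)))

/-- A smooth bump function with integral one, supported in the unit ball. -/
theorem exists_unit_bump : ∃ b : Plane → ℝ, IsSmooth b ∧ HasCompactSupport b ∧
    tsupport b ⊆ Metric.ball 0 1 ∧ ∫ z, b z = 1 := by
  let f : ContDiffBump (0 : Plane) := ⟨1 / 4, 1 / 2, by norm_num, by norm_num⟩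
  refine ⟨f.normed volume, f.contDiff_normed, f.hasCompactSupport_normed, ?_, f.integral_normed⟩
  rw [f.tsupport_normed_eq]
  exact Metric.closedBall_subset_ball (by norm_num [f])

/-- A continuous partition of unity: averaging over translates of a bump. -/
theorem setIntegral_cell_eq_avg {b P : Plane → ℝ} (hb : Continuous b) (hc : HasCompactSupport b)
    (hb1 : ∫ z, b z = 1) (hP : Continuous P) (hp : IsPeriodic P) :
    ∫ x in cell, P x = ∫ x in cell, ∫ z, b z * P (x + z) := by
  obtain ⟨M, hM0, hM⟩ := hp.exists_bound hP
  have hint : Integrable (fun q : Plane × Plane => b q.2 * P (q.1 + q.2))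
      ((volume.restrict cell).prod volume) := by
    have h1 : Integrable (fun q : Plane × Plane => (M : ℝ) * b q.2)
        ((volume.restrict cell).prod volume) :=
      Integrable.mul_prod (f := fun _ => M) (integrable_const M)
        (hb.integrable_of_hasCompactSupport hc)
    refine h1.mono (Continuous.aestronglyMeasurable (by fun_prop))
      (Eventually.of_forall fun q => ?_)
    rw [norm_mul, norm_mul, mul_comm, Real.norm_of_nonneg hM0]
    exact mul_le_mul_of_nonneg_right (hM _) (norm_nonneg _)
  rw [integral_integral_swap hint]
  simp only [integral_const_mul, setIntegral_cell_add hp, integral_mul_const, hb1, one_mul]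

/-- Testing a function with a smooth function on the torus. -/
theorem exists_abs_setIntegral_mul_le (r : ℕ) : ∃ C : ℝ, 0 ≤ C ∧ ∀ (α A M : ℝ) (f S : Plane → ℝ),
    ⌊-α + 1⌋₊ = r → Continuous f → IsPeriodic f → HZBound α (funDist f) A → IsSmooth S →
    IsPeriodic S → (∀ k ≤ r, ∀ x, ‖iteratedFDeriv ℝ k S x‖ ≤ M) →
    |∫ x in cell, f x * S x| ≤ C * A * M := by
  obtain ⟨b, hb, hbc, hbs, hb1⟩ := exists_unit_bump
  obtain ⟨B, hB0, hB⟩ := exists_iteratedFDeriv_bound hb hbc r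
  -- `2 ^ r` bounds the sum of binomial coefficients in the Leibniz rule for `b(z) S(x + z)`, and
  -- `(2π)²` is the area of the cell over which the localization point `x` is integrated.
  refine ⟨2 ^ r * B * (2 * Real.pi) ^ 2, by positivity, ?_⟩
  rintro α A M f S rfl hf hpf hA hS hpS hM
  have hM0 : 0 ≤ M := (norm_nonneg _).trans (hM 0 (Nat.zero_le _) 0)
  rw [setIntegral_cell_eq_avg (P := fun x => f x * S x) hb.continuous hbc hb1
    (hf.mul hS.continuous) (hpf.comp₂ hpS fun a b => a * b), ← volume_cell]
  have key : ∀ x ∈ cell, ‖∫ z, b z * (f (x + z) * S (x + z))‖ ≤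
      2 ^ ⌊-α + 1⌋₊ * B * M * A := by
    intro x _
    have hSx : IsSmooth fun z => S (x + z) := hS.comp (contDiff_const.add contDiff_id)
    have h1 := hA.abs_avg_le (Φ := fun z => b z * S (x + z)) (t := 1)
      (M := 2 ^ ⌊-α + 1⌋₊ * B * M) hf hpf (hb.mul hSx) hbc.mul_right
      ((tsupport_mul_subset_left).trans hbs) ?_ ⟨one_pos, le_rfl⟩ x
    · rw [Real.one_rpow, mul_one] at h1
      rw [Real.norm_eq_abs]
      convert h1 using 2
      rw [avg]
      refine integral_congr_ae (Eventually.of_forall fun z => ?_)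
      simp only [smul_eq_mul, one_smul]
      ring
    · intro k hk z
      have hle : ((k : ℕ∞) : WithTop ℕ∞) ≤ ((⊤ : ℕ∞) : WithTop ℕ∞) := by exact_mod_cast le_top
      refine (norm_iteratedFDeriv_mul_le hb hSx z hle).trans ?_
      have h2 : ∀ j ∈ Finset.range (k + 1), (k.choose j : ℝ) * ‖iteratedFDeriv ℝ j b z‖ *
          ‖iteratedFDeriv ℝ (k - j) (fun z => S (x + z)) z‖ ≤ (k.choose j : ℝ) * (B * M) := by
        intro j hj
        have hj' : j ≤ k := by simpa [Nat.lt_succ_iff] using hj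
        rw [iteratedFDeriv_comp_add_left, mul_assoc]
        gcongr
        · exact hB j (hj'.trans hk) z
        · exact hM _ ((Nat.sub_le _ _).trans hk) _
      refine (Finset.sum_le_sum h2).trans ?_
      rw [← Finset.sum_mul, ← Nat.cast_sum, Nat.sum_range_choose]
      push_cast
      rw [← mul_assoc]
      gcongr
      exact one_le_two
  refine (norm_setIntegral_le_of_norm_le_const volume_cell_lt_top key).trans (le_of_eq ?_)
  ring

end HolderZygmund

end TorusCR

namespace TorusCR

/-! ### The Jacobian of two Hölder functions -/

noncomputable section Jacobian

/-- The Jacobian determinant of two real functions. -/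
def jac (u v : Plane → ℝ) (x : Plane) : ℝ := pd 0 u x * pd 1 v x - pd 1 u x * pd 0 v x

/-- Local Hölder continuity, at distances at most one. -/
def HolderBound (β : ℝ) (u : Plane → ℝ) (A : ℝ) : Prop :=
  ∀ x y, ‖x - y‖ ≤ 1 → |u x - u y| ≤ A * ‖x - y‖ ^ β

theorem HolderBound.nonneg {β : ℝ} {u : Plane → ℝ} {A : ℝ} (h : HolderBound β u A) : 0 ≤ A := by
  have := h (stdVec 0) 0 (by simp [norm_stdVec])
  rw [sub_zero, norm_stdVec, Real.one_rpow, mul_one] at this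
  exact (abs_nonneg _).trans this

theorem pd_pd_comm {f : Plane → ℝ} (hf : IsSmooth f) (i j : Fin 2) (x : Plane) :
    pd i (pd j f) x = pd j (pd i f) x := by
  have h1 : ∀ i j : Fin 2, pd i (pd j f) x = fderiv ℝ (fderiv ℝ f) x (stdVec i) (stdVec j) := by
    intro i j
    have h2 := (hf.fderiv.differentiable (by simp) x).hasFDerivAt
    have h3 := (h2.clm_apply (hasFDerivAt_const (stdVec j) x)).fderiv
    rw [pd, show pd j f = fun y => fderiv ℝ f y (stdVec j) from rfl, h3]
    simp
  rw [h1, h1]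
  exact (hf.contDiffAt.isSymmSndFDerivAt (by
    simpa using (WithTop.coe_le_coe.2 (le_top : (2 : ℕ∞) ≤ ⊤) :
      (2 : WithTop ℕ∞) ≤ ((⊤ : ℕ∞) : WithTop ℕ∞)))) _ _

theorem pd_mul {f g : Plane → ℝ} (hf : IsSmooth f) (hg : IsSmooth g) (i : Fin 2) (x : Plane) :
    pd i (fun x => f x * g x) x = f x * pd i g x + pd i f x * g x := by
  have := ((hf.differentiable (by simp) x).hasFDerivAt.mul
    (hg.differentiable (by simp) x).hasFDerivAt).fderiv
  rw [pd, show (fun x => f x * g x) = f * g from rfl, this]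
  simp [pd]
  ring

theorem pd_sub {f g : Plane → ℝ} (hf : IsSmooth f) (hg : IsSmooth g) (i : Fin 2) (x : Plane) :
    pd i (fun x => f x - g x) x = pd i f x - pd i g x := by
  have := ((hf.differentiable (by simp) x).hasFDerivAt.sub
    (hg.differentiable (by simp) x).hasFDerivAt).fderiv
  rw [pd, show (fun x => f x - g x) = f - g from rfl, this]
  simp [pd]

theorem jac_smooth {u v : Plane → ℝ} (hu : IsSmooth u) (hv : IsSmooth v) : IsSmooth (jac u v) :=
  ((hu.pd 0).mul (hv.pd 1)).sub ((hu.pd 1).mul (hv.pd 0))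

theorem jac_periodic {u v : Plane → ℝ} (hu : IsPeriodic u) (hv : IsPeriodic v) :
    IsPeriodic (jac u v) :=
  ((hu.pd 0).comp₂ (hv.pd 1) fun a b => a * b).comp₂
    ((hu.pd 1).comp₂ (hv.pd 0) fun a b => a * b) fun a b => a - b

theorem jac_sub_sub {u u' v v' : Plane → ℝ} (hu : IsSmooth u) (hu' : IsSmooth u')
    (hv : IsSmooth v) (hv' : IsSmooth v') (x : Plane) :
    jac u v x - jac u' v' x =
      jac (fun y => u y - u' y) v x + jac u' (fun y => v y - v' y) x := by
  simp only [jac, pd_sub hu hu', pd_sub hv hv']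
  ring

theorem jac_antisymm (u v : Plane → ℝ) (x : Plane) : jac u v x = -jac v u x := by
  simp only [jac]
  ring

/-- The null structure. Integrating by parts in `a` also produces second derivatives of `b`, but
these are the mixed ones, and they cancel by symmetry. Hence `a` loses its derivative while `b`
keeps only one. -/
theorem integral_mul_jac {φ a b : Plane → ℝ} (hφ : IsSmooth φ) (hc : HasCompactSupport φ)
    (ha : IsSmooth a) (hb : IsSmooth b) :
    ∫ x, φ x * jac a b x = -∫ x, a x * jac φ b x := by
  have int : ∀ f g : Plane → ℝ, IsSmooth f → HasCompactSupport f → IsSmooth g →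
      Integrable fun x => f x * g x := fun f g hf hfc hg =>
    Continuous.integrable_of_hasCompactSupport (hf.continuous.mul hg.continuous) hfc.mul_right
  have h0 := integral_mul_pd (hφ.mul (hb.pd 1)) (hc.mul_right (f' := pd 1 b)) ha 0
  have h1 := integral_mul_pd (hφ.mul (hb.pd 0)) (hc.mul_right (f' := pd 0 b)) ha 1
  have e0 : ∀ x, pd 0 (fun x => φ x * pd 1 b x) x * a x =
      φ x * (pd 0 (pd 1 b) x * a x) + pd 0 φ x * (pd 1 b x * a x) := fun x => by
    rw [pd_mul hφ (hb.pd 1)]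
    ring
  have e1 : ∀ x, pd 1 (fun x => φ x * pd 0 b x) x * a x =
      φ x * (pd 0 (pd 1 b) x * a x) + pd 1 φ x * (pd 0 b x * a x) := fun x => by
    rw [pd_mul hφ (hb.pd 0),
      pd_pd_comm hb 1 0]
    ring
  simp only [e0] at h0
  simp only [e1] at h1
  have i1 := int φ _ hφ hc (((hb.pd 1).pd 0).mul ha)
  have i2 := int _ _ (hφ.pd 0) (hasCompactSupport_pd hc 0) ((hb.pd 1).mul ha)
  have i3 := int _ _ (hφ.pd 1) (hasCompactSupport_pd hc 1) ((hb.pd 0).mul ha)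
  rw [integral_add i1 i2] at h0
  rw [integral_add i1 i3] at h1
  have e2 : ∀ x, φ x * jac a b x = φ x * pd 1 b x * pd 0 a x - φ x * pd 0 b x * pd 1 a x :=
    fun x => by simp only [jac]; ring
  have e3 : ∀ x, a x * jac φ b x = pd 0 φ x * (pd 1 b x * a x) - pd 1 φ x * (pd 0 b x * a x) :=
    fun x => by simp only [jac]; ring
  simp only [e2, e3]
  have j1 := int _ _ (hφ.mul (hb.pd 1)) (hc.mul_right (f' := pd 1 b)) (ha.pd 0)
  have j2 := int _ _ (hφ.mul (hb.pd 0)) (hc.mul_right (f' := pd 0 b)) (ha.pd 1)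
  rw [integral_sub (f := fun x => φ x * pd 1 b x * pd 0 a x) j1 j2, integral_sub i2 i3, h0, h1]
  ring

theorem volume_ball_le {lam : ℝ} (hl : 0 < lam) (x : Plane) :
    (volume : Measure Plane).real (Metric.ball x lam) ≤ 4 * lam ^ 2 := by
  rw [measureReal_def, EuclideanSpace.volume_ball_fin_two]
  rw [ENNReal.toReal_mul, ENNReal.toReal_pow, ENNReal.toReal_ofReal hl.le]
  rw [ENNReal.toReal_ofReal Real.pi_pos.le]
  nlinarith [Real.pi_le_four, sq_nonneg lam]

/-- An integral of a function which is supported in a ball. -/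
theorem abs_integral_le_of_ball {f : Plane → ℝ} {x : Plane} {lam B : ℝ} (hl : 0 < lam)
    (hB : 0 ≤ B) (h0 : ∀ y ∉ Metric.ball x lam, f y = 0) (hf : ∀ y ∈ Metric.ball x lam, |f y| ≤ B) :
    |∫ y, f y| ≤ 4 * lam ^ 2 * B := by
  rw [← setIntegral_eq_integral_of_forall_compl_eq_zero h0]
  refine (norm_setIntegral_le_of_norm_le_const (f := f) (C := B) measure_ball_lt_top
    fun y hy => hf y hy).trans ?_
  rw [mul_comm]
  exact mul_le_mul_of_nonneg_right (volume_ball_le hl x) hB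

theorem rescale_eq_zero {φ : Plane → ℝ} (hs : tsupport φ ⊆ Metric.ball 0 1) {lam : ℝ}
    (hl : 0 < lam) {x y : Plane} (hy : y ∉ Metric.ball x lam) : rescale φ lam x y = 0 := by
  rw [rescale, image_eq_zero_of_notMem_tsupport (f := φ), mul_zero]
  intro h
  have h1 := hs h
  rw [mem_ball_zero_iff, norm_smul, norm_inv, Real.norm_of_nonneg hl.le,
    inv_mul_lt_iff₀ hl, mul_one] at h1
  exact hy (mem_ball_iff_norm.2 h1)

theorem abs_rescale_le {φ : Plane → ℝ} (h : ∀ z, |φ z| ≤ 1) (lam : ℝ) (x y : Plane) :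
    |rescale φ lam x y| ≤ lam⁻¹ ^ 2 := by
  rw [rescale, abs_mul, abs_of_nonneg (sq_nonneg _)]
  exact mul_le_of_le_one_right (sq_nonneg _) (h _)

theorem pd_rescale {φ : Plane → ℝ} (hφ : IsSmooth φ) (lam : ℝ) (x y : Plane) (i : Fin 2) :
    pd i (rescale φ lam x) y = lam⁻¹ * rescale (pd i φ) lam x y := by
  have h1 := (hφ.differentiable (by simp) (lam⁻¹ • (y - x))).hasFDerivAt
  have h2 : HasFDerivAt (fun y : Plane => lam⁻¹ • (y - x))
      (lam⁻¹ • ContinuousLinearMap.id ℝ Plane) y := ((hasFDerivAt_id y).sub_const x).const_smul lam⁻¹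
  have h3 := ((h1.comp y h2).const_mul (lam⁻¹ ^ 2)).fderiv
  rw [pd, show rescale φ lam x = fun y => lam⁻¹ ^ 2 * (φ ∘ fun y => lam⁻¹ • (y - x)) y from rfl,
    h3]
  simp [rescale, pd]
  ring

/-- Pairing a Jacobian with a rescaled test function, in the factorised form. -/
theorem abs_integral_rescale_jac_le {φ : Plane → ℝ} (hφ : φ ∈ ballTests 1) {lam : ℝ} (hl : 0 < lam)
    (x : Plane) {a b : Plane → ℝ} (ha : IsSmooth a) (hb : IsSmooth b) {A B : ℝ}
    (hA : ∀ y, |a y| ≤ A) (hB : ∀ i y, |pd i b y| ≤ B) :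
    |∫ y, rescale φ lam x y * jac a b y| ≤ 8 * lam⁻¹ * A * B := by
  have hA0 : 0 ≤ A := (abs_nonneg _).trans (hA 0)
  have hB0 : 0 ≤ B := (abs_nonneg _).trans (hB 0 0)
  have hsm := ballTests_smooth hφ
  rw [integral_mul_jac (rescale_smooth hsm lam x)
    (rescale_compact (ballTests_compact hφ) hl.ne' x) ha hb, abs_neg]
  have hz : ∀ i, ∀ y ∉ Metric.ball x lam, pd i (rescale φ lam x) y = 0 := fun i y hy => by
    rw [pd_rescale hsm, rescale_eq_zero ((tsupport_pd_subset φ i).trans hφ.2.2.1) hl hy, mul_zero]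
  have hd : ∀ i y, |pd i (rescale φ lam x) y| ≤ lam⁻¹ ^ 3 := fun i y => by
    rw [pd_rescale hsm, abs_mul, abs_of_pos (inv_pos.2 hl), pow_succ' _ 2]
    exact mul_le_mul_of_nonneg_left
      (abs_rescale_le (abs_pd_le_one_of_mem_ballTests le_rfl hφ i) lam x y) (inv_pos.2 hl).le
  -- The gradient of the rescaled test function is of size `λ⁻³` on a ball of area at most `4λ²`,
  -- and the Jacobian has two terms: altogether `8 λ⁻¹`.
  refine (abs_integral_le_of_ball (x := x) (B := A * (2 * (lam⁻¹ ^ 3 * B))) hl (by positivity)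
    (fun y hy => ?_) fun y _ => ?_).trans (le_of_eq ?_)
  · simp only [jac, hz _ y hy]
    ring
  · rw [abs_mul]
    refine mul_le_mul (hA y) ?_ (abs_nonneg _) hA0
    refine (abs_sub _ _).trans ?_
    rw [abs_mul, abs_mul, two_mul]
    exact add_le_add (mul_le_mul (hd 0 y) (hB 1 y) (abs_nonneg _) (by positivity))
      (mul_le_mul (hd 1 y) (hB 0 y) (abs_nonneg _) (by positivity))
  · field_simp
    ring

/-- Mollification of a Hölder function: error and derivative bounds. -/
theorem HolderBound.avg_bounds {β A : ℝ} {u : Plane → ℝ} (h : HolderBound β u A) (hβ : 0 < β)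
    (hu : IsSmooth u) (hp : IsPeriodic u) {χ : Plane → ℝ} (hχ : IsSmooth χ)
    (hc : HasCompactSupport χ) (hs : tsupport χ ⊆ Metric.ball 0 1) {t : ℝ} (ht : t ∈ Ioc (0 : ℝ) 1) :
    (∫ z, χ z = 1 → ∀ x, |avg χ t u x - u x| ≤ (∫ z, |χ z|) * (A * t ^ β)) ∧
    ∀ i x, |pd i (avg χ t u) x| ≤ (∫ z, |pd i χ z|) * (A * t ^ (β - 1)) := by
  have hA := h.nonneg
  have osc : ∀ x, ∀ z ∈ Metric.ball (0 : Plane) 1, |u (x + t • z) - u x| ≤ A * t ^ β := by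
    intro x z hz
    have hz1 : ‖z‖ < 1 := by simpa using hz
    have h1 : ‖x + t • z - x‖ ≤ t := by
      rw [add_sub_cancel_left, norm_smul, Real.norm_of_nonneg ht.1.le]
      exact mul_le_of_le_one_right ht.1.le hz1.le
    refine (h _ _ (h1.trans ht.2)).trans ?_
    gcongr
  have hsub : ∀ (Ψ : Plane → ℝ), Continuous Ψ → HasCompactSupport Ψ → ∀ x,
      avg Ψ t (fun y => u y - u x) x = avg Ψ t u x - (∫ z, Ψ z) * u x := by
    intro Ψ hΨ hΨc x
    rw [avg, avg, ← integral_mul_const]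
    rw [← integral_sub (integrable_avg hΨ hΨc hu.continuous t x)
      ((hΨ.integrable_of_hasCompactSupport hΨc).mul_const _)]
    refine integral_congr_ae (Eventually.of_forall fun z => ?_)
    simp only [smul_eq_mul]
    ring
  constructor
  · intro h1 x
    have h2 := hsub χ hχ.continuous hc x
    rw [h1, one_mul] at h2
    rw [← h2]
    exact norm_avg_le (f := fun y => u y - u x) hχ.continuous hc fun z hz => osc x z (hs hz)
  · intro i x
    -- The kernel `∂ᵢχ` has integral zero, so `u x` may be subtracted. The oscillation `t^β` then
    -- compensates part of the factor `1/t`.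
    have h1 : t * pd i (avg χ t u) x = -avg (pd i χ) t (fun y => u y - u x) x := by
      have h0 : ∫ z, pd i χ z = 0 := by
        have := integral_mul_pd (f := fun _ => 1) hχ hc contDiff_const i
        simp only [mul_one] at this
        rw [← neg_eq_zero, ← this]
        simp [pd]
      rw [hsub _ (hχ.pd i).continuous (hasCompactSupport_pd hc i), h0, zero_mul, sub_zero,
        pd_avg hχ.continuous hc hu hp, mul_avg_pd hχ hc hu]
    have h2 := norm_avg_le (f := fun y => u y - u x) (t := t) (x := x) (M := A * t ^ β)
      (hχ.pd i).continuous (hasCompactSupport_pd hc i)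
      fun z hz => osc x z (hs (tsupport_pd_subset χ i hz))
    have h3 : |t * pd i (avg χ t u) x| ≤ (∫ z, |pd i χ z|) * (A * t ^ β) := by
      rw [h1, abs_neg]
      exact h2
    rw [abs_mul, abs_of_pos ht.1, mul_comm, ← le_div_iff₀ ht.1] at h3
    refine h3.trans (le_of_eq ?_)
    rw [Real.rpow_sub_one ht.1.ne']
    ring

theorem tendsto_avg {χ f : Plane → ℝ} (hχ : Continuous χ) (hc : HasCompactSupport χ)
    (h1 : ∫ z, χ z = 1) (hf : Continuous f) (hp : IsPeriodic f) (x : Plane) {t : ℕ → ℝ}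
    (ht : Tendsto t atTop (𝓝 0)) : Tendsto (fun n => avg χ (t n) f x) atTop (𝓝 (f x)) := by
  have h := ((continuous_avg_scale hχ hc hf hp x).tendsto 0).comp ht
  have e : avg χ 0 f x = f x := by
    simp only [avg, zero_smul, add_zero, smul_eq_mul, integral_mul_const, h1, one_mul]
  rwa [e] at h

/-- The Jacobian of two Hölder functions of exponent `β > 1/2` as a distribution. -/
theorem exists_abs_integral_jac_le {β : ℝ} (hβ : 1 / 2 < β) (hβ1 : β ≤ 1) : ∃ C : ℝ, 0 ≤ C ∧
    ∀ (u v : Plane → ℝ) (A B : ℝ), IsSmooth u → IsPeriodic u → IsSmooth v → IsPeriodic v →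
    HolderBound β u A → HolderBound β v B → ∀ φ ∈ ballTests 1, ∀ lam ∈ Ioc (0 : ℝ) 1, ∀ x,
    |∫ y, rescale φ lam x y * jac u v y| ≤ C * A * B * lam ^ (2 * β - 2) := by
  obtain ⟨χ, hχ, hc, hs, h1⟩ := exists_unit_bump
  have hβ0 : 0 < β := by linarith
  set D : ℝ := (∫ z, |χ z|) + (∫ z, |pd 0 χ z|) + ∫ z, |pd 1 χ z| with hD
  have n0 : 0 ≤ ∫ z, |χ z| := integral_nonneg fun _ => abs_nonneg _
  have n1 : ∀ i, 0 ≤ ∫ z, |pd i χ z| := fun i => integral_nonneg fun _ => abs_nonneg _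
  have hD0 : 0 ≤ D := by have := n1 0; have := n1 1; positivity
  have hDχ : ∫ z, |χ z| ≤ D := by have := n1 0; have := n1 1; linarith
  have hDi : ∀ i, ∫ z, |pd i χ z| ≤ D := fun i => by
    have := n1 0
    have := n1 1
    fin_cases i
    · simp only [Fin.zero_eta]; linarith
    · simp only [Fin.mk_one]; linarith
  -- `q` is the ratio of the geometric series over scales; `q < 1` is where `β > 1/2` is used.
  set q : ℝ := 2⁻¹ ^ (2 * β - 1) with hq
  have hq0 : 0 < q := by positivity
  have hq1 : q < 1 := Real.rpow_lt_one (by norm_num) (by norm_num) (by linarith)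
  -- `E` accounts for evaluating the gradient bound at `t (n + 1) = t n / 2` instead of `t n`.
  set E : ℝ := 2 ^ (1 - β) with hE
  have hE0 : 0 < E := by positivity
  refine ⟨8 * D ^ 2 + 32 * D ^ 2 * E * (1 - q)⁻¹, by
    have : 0 < 1 - q := by linarith
    positivity, ?_⟩
  intro u v A B hu hpu hv hpv hA hB φ hφ lam hl x
  have hA0 := hA.nonneg
  have hB0 := hB.nonneg
  set t : ℕ → ℝ := fun n => lam * 2⁻¹ ^ n with ht
  have htm : ∀ n, t n ∈ Ioc (0 : ℝ) 1 := fun n =>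
    ⟨by have := hl.1; positivity, mul_le_one₀ hl.2 (by positivity)
      (pow_le_one₀ (by norm_num) (by norm_num))⟩
  have ht0 : Tendsto t atTop (𝓝 0) := by
    have := (tendsto_pow_atTop_nhds_zero_of_lt_one (r := (2⁻¹ : ℝ)) (by norm_num)
      (by norm_num)).const_mul lam
    rwa [mul_zero] at this
  -- bounds for the mollified functions
  have bd : ∀ (f : Plane → ℝ) (F : ℝ), IsSmooth f → IsPeriodic f → HolderBound β f F →
      (∀ n y, |avg χ (t n) f y - f y| ≤ D * F * t n ^ β) ∧
      ∀ n i y, |pd i (avg χ (t n) f) y| ≤ D * F * t n ^ (β - 1) := by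
    intro f F hf hpf hF
    have hF0 := hF.nonneg
    refine ⟨fun n y => ?_, fun n i y => ?_⟩
    · refine ((hF.avg_bounds hβ0 hf hpf hχ hc hs (htm n)).1 h1 y).trans ?_
      rw [← mul_assoc]
      have := (htm n).1
      gcongr
    · refine ((hF.avg_bounds hβ0 hf hpf hχ hc hs (htm n)).2 i y).trans ?_
      rw [← mul_assoc]
      have := (htm n).1
      gcongr
      exact hDi i
  obtain ⟨bu, bu'⟩ := bd u A hu hpu hA
  obtain ⟨bv, bv'⟩ := bd v B hv hpv hB
  have sm : ∀ (f : Plane → ℝ), IsSmooth f → IsPeriodic f → ∀ n, IsSmooth (avg χ (t n) f) :=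
    fun f hf hpf n => IsSmooth.avg hχ.continuous hc hf hpf (t n)
  set I : ℕ → ℝ := fun n => ∫ y, rescale φ lam x y * jac (avg χ (t n) u) (avg χ (t n) v) y with hI
  set K : ℝ := A * B * lam ^ (2 * β - 2) with hK
  have hK0 : 0 ≤ K := by have := hl.1; positivity
  have hφs := ballTests_smooth hφ
  have intg : ∀ f g : Plane → ℝ, IsSmooth f → IsSmooth g →
      Integrable fun y => rescale φ lam x y * jac f g y := fun f g hf hg =>
    Continuous.integrable_of_hasCompactSupport
      ((rescale_smooth hφs lam x).continuous.mul (jac_smooth hf hg).continuous)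
      (rescale_compact (ballTests_compact hφ) hl.1.ne' x).mul_right
  -- the coarsest scale
  have base : |I 0| ≤ 8 * D ^ 2 * K := by
    have e : t 0 = lam := by simp [ht]
    -- At scale `λ` itself no cancellation is needed: both gradients are bounded pointwise by
    -- `λ^(β-1)`.
    refine (abs_integral_le_of_ball (x := x) (lam := lam)
      (B := lam⁻¹ ^ 2 * (2 * (D * A * lam ^ (β - 1) * (D * B * lam ^ (β - 1))))) hl.1
      (by have := hl.1; positivity)
      (fun y hy => by rw [rescale_eq_zero hφ.2.2.1 hl.1 hy, zero_mul]) fun y _ => ?_).trans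
      (le_of_eq ?_)
    · rw [abs_mul]
      refine mul_le_mul (abs_rescale_le (abs_le_one_of_mem_ballTests hφ) lam x y) ?_
        (abs_nonneg _) (by positivity)
      refine (abs_sub _ _).trans ?_
      have ho := (htm 0).1
      have p1 := bu' 0 0 y
      have p2 := bu' 0 1 y
      have p3 := bv' 0 0 y
      have p4 := bv' 0 1 y
      rw [abs_mul, abs_mul, two_mul]
      rw [e] at p1 p2 p3 p4 ⊢
      have hl0 := hl.1
      exact add_le_add (mul_le_mul p1 p4 (abs_nonneg _) (by positivity))
        (mul_le_mul p2 p3 (abs_nonneg _) (by positivity))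
    · rw [hK, show 2 * β - 2 = (β - 1) + (β - 1) by ring, Real.rpow_add hl.1]
      have := hl.1
      field_simp
      ring
  -- consecutive scales
  have scale : ∀ n, lam⁻¹ * (t n ^ β * t (n + 1) ^ (β - 1)) = E * q ^ n * lam ^ (2 * β - 2) := by
    intro n
    have e1 : t (n + 1) = t n * 2⁻¹ := by simp only [ht, pow_succ]; ring
    have hn := (htm n).1
    rw [e1, Real.mul_rpow hn.le (by norm_num), ← mul_assoc, ← mul_assoc, mul_assoc lam⁻¹,
      ← Real.rpow_add hn, ht, Real.mul_rpow hl.1.le (by positivity), hq, hE, Real.inv_rpow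
      (by norm_num) (β - 1), ← Real.rpow_neg (by norm_num), neg_sub, ← Real.rpow_natCast,
      ← Real.rpow_natCast, ← Real.rpow_mul (by norm_num), ← Real.rpow_mul (by norm_num),
      show β + (β - 1) = (2 * β - 2) + 1 by ring, Real.rpow_add_one hl.1.ne',
      show (n : ℝ) * (2 * β - 2 + 1) = (2 * β - 1) * n by ring]
    have := hl.1.ne'
    field_simp
  have step : ∀ n, |I (n + 1) - I n| ≤ 32 * D ^ 2 * E * K * q ^ n := by
    intro n
    have hn := (htm n).1
    have hn1 := (htm (n + 1)).1
    have hle : t (n + 1) ≤ t n := by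
      simp only [ht, pow_succ]
      nlinarith [show 0 < lam * 2⁻¹ ^ n from hn]
    have du : ∀ y, |avg χ (t (n + 1)) u y - avg χ (t n) u y| ≤ 2 * (D * A * t n ^ β) := by
      intro y
      have p1 := bu (n + 1) y
      have p2 := bu n y
      have p3 : D * A * t (n + 1) ^ β ≤ D * A * t n ^ β := by gcongr
      have : avg χ (t (n + 1)) u y - avg χ (t n) u y =
        (avg χ (t (n + 1)) u y - u y) - (avg χ (t n) u y - u y) := by ring
      rw [this]
      refine (abs_sub _ _).trans ?_
      linarith
    have dv : ∀ y, |avg χ (t (n + 1)) v y - avg χ (t n) v y| ≤ 2 * (D * B * t n ^ β) := by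
      intro y
      have p1 := bv (n + 1) y
      have p2 := bv n y
      have p3 : D * B * t (n + 1) ^ β ≤ D * B * t n ^ β := by gcongr
      have : avg χ (t (n + 1)) v y - avg χ (t n) v y =
        (avg χ (t (n + 1)) v y - v y) - (avg χ (t n) v y - v y) := by ring
      rw [this]
      refine (abs_sub _ _).trans ?_
      linarith
    -- Telescoping in `u` and `v`, with antisymmetry used to put the difference of two
    -- mollifications into the first slot each time. There it carries no derivative after
    -- `integral_mul_jac`, so its smallness `t_n^β` is available.
    have split : I (n + 1) - I n =
        (∫ y, rescale φ lam x y *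
          jac (fun y => avg χ (t (n + 1)) u y - avg χ (t n) u y) (avg χ (t (n + 1)) v) y) -
        ∫ y, rescale φ lam x y *
          jac (fun y => avg χ (t (n + 1)) v y - avg χ (t n) v y) (avg χ (t n) u) y := by
      simp only [hI]
      rw [← integral_sub (intg _ _ (sm u hu hpu _) (sm v hv hpv _))
        (intg _ _ (sm u hu hpu _) (sm v hv hpv _)),
        ← integral_sub (intg _ _ ((sm u hu hpu _).sub (sm u hu hpu _)) (sm v hv hpv _))
        (intg _ _ ((sm v hv hpv _).sub (sm v hv hpv _)) (sm u hu hpu _))]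
      refine integral_congr_ae (Eventually.of_forall fun y => ?_)
      simp only
      rw [← mul_sub, jac_sub_sub (sm u hu hpu _) (sm u hu hpu _) (sm v hv hpv _) (sm v hv hpv _),
        jac_antisymm (avg χ (t n) u)]
      ring
    have mono : t n ^ (β - 1) ≤ t (n + 1) ^ (β - 1) :=
      Real.rpow_le_rpow_of_nonpos hn1 hle (by linarith)
    have p1 := abs_integral_rescale_jac_le hφ hl.1 x ((sm u hu hpu (n + 1)).sub (sm u hu hpu n))
      (sm v hv hpv (n + 1)) du (bv' (n + 1))
    have p2 := abs_integral_rescale_jac_le hφ hl.1 x ((sm v hv hpv (n + 1)).sub (sm v hv hpv n))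
      (sm u hu hpu n) dv (fun i y => (bu' n i y).trans
        (mul_le_mul_of_nonneg_left mono (by positivity)))
    rw [split]
    refine (abs_sub _ _).trans ((add_le_add p1 p2).trans (le_of_eq ?_))
    linear_combination (32 * D ^ 2 * A * B) * scale n
  have total : ∀ n, |I n| ≤ 8 * D ^ 2 * K + 32 * D ^ 2 * E * K * ∑ k ∈ Finset.range n, q ^ k := by
    intro n
    induction n with
    | zero => simpa using base
    | succ n ih =>
      rw [Finset.sum_range_succ, mul_add, ← add_assoc]
      have : I (n + 1) = I n + (I (n + 1) - I n) := by ring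
      rw [this]
      exact (abs_add_le _ _).trans (add_le_add ih (step n))
  -- The bounds on the derivatives of `u` and `v` used here depend on these smooth functions, but
  -- serve only for dominated convergence and do not enter the constant.
  have lim : Tendsto I atTop (𝓝 (∫ y, rescale φ lam x y * jac u v y)) := by
    have hb : ∀ f : Plane → ℝ, IsSmooth f → IsPeriodic f → ∃ M, 0 ≤ M ∧
        ∀ n i y, |pd i (avg χ (t n) f) y| ≤ M := by
      intro f hf hpf
      obtain ⟨M0, h00, hM0⟩ := (hpf.pd 0).exists_bound (hf.pd 0).continuous
      obtain ⟨M1, h10, hM1⟩ := (hpf.pd 1).exists_bound (hf.pd 1).continuous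
      refine ⟨(∫ z, |χ z|) * (M0 + M1), by positivity, fun n i y => ?_⟩
      rw [pd_avg hχ.continuous hc hf hpf]
      refine norm_avg_le (f := pd i f) hχ.continuous hc fun z _ => ?_
      fin_cases i
      · exact (hM0 _).trans (by linarith)
      · exact (hM1 _).trans (by linarith)
    obtain ⟨Mu, hMu0, hMu⟩ := hb u hu hpu
    obtain ⟨Mv, hMv0, hMv⟩ := hb v hv hpv
    refine tendsto_integral_of_dominated_convergence
      (fun y => |rescale φ lam x y| * (Mu * Mv + Mu * Mv))
      (fun n => (intg _ _ (sm u hu hpu n) (sm v hv hpv n)).aestronglyMeasurable)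
      (((rescale_smooth hφs lam x).continuous.integrable_of_hasCompactSupport
        (rescale_compact (ballTests_compact hφ) hl.1.ne' x)).abs.mul_const _)
      (fun n => Eventually.of_forall fun y => ?_) (Eventually.of_forall fun y => ?_)
    · rw [norm_mul]
      refine mul_le_mul_of_nonneg_left ?_ (abs_nonneg _)
      refine (abs_sub _ _).trans ?_
      rw [abs_mul, abs_mul]
      exact add_le_add (mul_le_mul (hMu n 0 y) (hMv n 1 y) (abs_nonneg _) hMu0)
        (mul_le_mul (hMu n 1 y) (hMv n 0 y) (abs_nonneg _) hMu0)
    · refine Tendsto.const_mul _ ?_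
      have tp : ∀ f : Plane → ℝ, IsSmooth f → IsPeriodic f → ∀ i,
          Tendsto (fun n => pd i (avg χ (t n) f) y) atTop (𝓝 (pd i f y)) := by
        intro f hf hpf i
        simp only [pd_avg hχ.continuous hc hf hpf]
        exact tendsto_avg hχ.continuous hc h1 (hf.pd i).continuous (hpf.pd i) y ht0
      exact ((tp u hu hpu 0).mul (tp v hv hpv 1)).sub ((tp u hu hpu 1).mul (tp v hv hpv 0))
  refine le_of_tendsto lim.abs (Eventually.of_forall fun n => (total n).trans ?_)
  have hsum : ∑ k ∈ Finset.range n, q ^ k ≤ (1 - q)⁻¹ := by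
    rw [← tsum_geometric_of_lt_one hq0.le hq1]
    exact (summable_geometric_of_lt_one hq0.le hq1).sum_le_tsum _ fun k _ => by positivity
  calc 8 * D ^ 2 * K + 32 * D ^ 2 * E * K * ∑ k ∈ Finset.range n, q ^ k
      ≤ 8 * D ^ 2 * K + 32 * D ^ 2 * E * K * (1 - q)⁻¹ := by gcongr
    _ = _ := by rw [hK]; ring

end Jacobian

end TorusCR

namespace TorusCR

/-! ### Schauder estimates for the Poisson equation -/

noncomputable section Schauder

/-- The mean-zero solution `u` of `-Δu = w - mean w` for real `w`. -/
def potential (w : Plane → ℝ) (x : Plane) : ℝ := (convK (fun y => (w y : ℂ)) x).re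

theorem IsSmooth.ofReal {w : Plane → ℝ} (hw : IsSmooth w) : IsSmooth fun y => (w y : ℂ) :=
  Complex.ofRealCLM.contDiff.comp hw

theorem IsPeriodic.ofReal {w : Plane → ℝ} (hp : IsPeriodic w) : IsPeriodic fun y => (w y : ℂ) :=
  hp.comp fun r => (r : ℂ)

variable {w : Plane → ℝ}

theorem ofReal_potential (hp : IsPeriodic w) :
    (fun x => (potential w x : ℂ)) = convK fun y => (w y : ℂ) := by
  funext x
  refine Complex.ext (by simp [potential]) ?_
  rw [convK_ofReal_im hp, Complex.ofReal_im]

theorem potential_smooth (hw : IsSmooth w) (hp : IsPeriodic w) : IsSmooth (potential w) :=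
  Complex.reCLM.contDiff.comp (convK_smooth hw.ofReal hp.ofReal)

theorem potential_periodic (hp : IsPeriodic w) : IsPeriodic (potential w) :=
  (convK_periodic hp.ofReal).comp Complex.re

theorem pderiv_ofReal (hw : IsSmooth w) (i : Fin 2) :
    pderiv i (fun y => (w y : ℂ)) = fun y => (pd i w y : ℂ) := by
  funext x
  have h1 := Complex.ofRealCLM.hasFDerivAt.comp x (hw.differentiable (by simp) x).hasFDerivAt
  rw [pderiv, show (fun y => (w y : ℂ)) = Complex.ofRealCLM ∘ w from rfl, h1.fderiv]
  rfl

theorem pd_potential (hw : IsSmooth w) (hp : IsPeriodic w) (i : Fin 2) :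
    pd i (potential w) = potential (pd i w) := by
  have h1 := pderiv_ofReal (potential_smooth hw hp) i
  rw [ofReal_potential hp, pderiv_convK hw.ofReal hp.ofReal, pderiv_ofReal hw,
    ← ofReal_potential (hp.pd i)] at h1
  funext x
  exact_mod_cast (congrFun h1 x).symm

theorem laplacian_potential (hw : IsSmooth w) (hp : IsPeriodic w) :
    ∀ x, pd 0 (pd 0 (potential w)) x + pd 1 (pd 1 (potential w)) x =
      ((4 * (Real.pi : ℂ) ^ 2)⁻¹ * fcoef 0 fun y => (w y : ℂ)).re - w x := by
  have hs := potential_smooth hw hp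
  have h := laplacian_convK hw.ofReal hp.ofReal
  simp only [← ofReal_potential hp, pderiv_ofReal hs, pderiv_ofReal (hs.pd _)] at h
  intro x
  have := congrArg Complex.re (h x)
  simpa using this

/-- A derivative has mean zero on the torus, so the constant in `laplacian_potential` disappears. -/
theorem laplacian_potential_pd (hw : IsSmooth w) (hp : IsPeriodic w) (i : Fin 2) (x : Plane) :
    pd 0 (pd 0 (potential (pd i w))) x + pd 1 (pd 1 (potential (pd i w))) x = -pd i w x := by
  rw [laplacian_potential (hw.pd i) (hp.pd i), ← pderiv_ofReal hw,
    fcoef_pderiv 0 hw.ofReal hp.ofReal]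
  simp

theorem potential_sub {w' : Plane → ℝ} (hw : IsSmooth w) (hp : IsPeriodic w) (hw' : IsSmooth w')
    (hp' : IsPeriodic w') :
    potential (fun x => w x - w' x) = fun x => potential w x - potential w' x := by
  have h1 := convK_const_mul hp'.ofReal (-1)
  have h2 := convK_add hw.ofReal hp.ofReal (contDiff_const (c := (-1 : ℂ)).mul hw'.ofReal)
    (hp'.ofReal.comp fun z => -1 * z)
  have e : (fun x => ((w x - w' x : ℝ) : ℂ)) = fun x => (w x : ℂ) + -1 * (w' x : ℂ) := by
    funext x
    push_cast
    ring
  funext x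
  rw [potential, e, h2, h1]
  simp [potential, sub_eq_add_neg]

theorem setIntegral_mul_potential {H : Plane → ℝ} (hH : IsSmooth H) (hpH : IsPeriodic H)
    (hw : IsSmooth w) (hp : IsPeriodic w) (x : Plane) :
    ∫ y in cell, H y * potential w (x - y) = ∫ y in cell, w y * potential H (x - y) := by
  have h := setIntegral_mul_convK hH.ofReal hpH.ofReal hw.ofReal hp.ofReal x
  simp only [← ofReal_potential hp, ← ofReal_potential hpH, ← Complex.ofReal_mul,
    integral_complex_ofReal] at h
  exact_mod_cast h

/-- The smooth part of the potential is controlled by any weak norm of the density. -/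
theorem exists_abs_avg_potential_le {h : Plane → ℝ} (hh : IsSmooth h) (hc : HasCompactSupport h)
    (r : ℕ) : ∃ C : ℝ, 0 ≤ C ∧ ∀ (α A : ℝ) (w : Plane → ℝ), ⌊-α + 1⌋₊ = r → IsSmooth w →
    IsPeriodic w → HZBound α (funDist w) A → ∀ x, |avg h 1 (potential w) x| ≤ C * A := by
  obtain ⟨C, hC0, hC⟩ := exists_abs_setIntegral_mul_le r
  have hh' : IsSmooth fun y => h (-y) := hh.comp contDiff_neg
  have hc' : HasCompactSupport fun y => h (-y) := hc.comp_homeomorph (Homeomorph.neg Plane)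
  set H : Plane → ℝ := (periodize fun y => h (-y)).1 with hH
  have hHs : IsSmooth H := (periodize fun y => h (-y)).2.1
  have hHp : IsPeriodic H := (periodize fun y => h (-y)).2.2
  obtain ⟨M, hM0, hM⟩ := (potential_periodic hHp).exists_iteratedFDeriv_bound
    (potential_smooth hHs hHp) r
  refine ⟨C * M, by positivity, fun α A w hr hw hp hA x => ?_⟩
  -- Since `K` is a convolution operator it can be moved from `w` onto the periodized reflection `H`
  -- of `h`. The result pairs `w` with translates of one fixed smooth function, whose derivative
  -- bounds are independent of `w` and `x`.
  have e : avg h 1 (potential w) x = ∫ y in cell, w y * potential H (x - y) := by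
    rw [← setIntegral_mul_potential hHs hHp hw hp]
    have h1 := setIntegral_periodize_smul hh' hc' ((potential_periodic hp).comp_sub_left x)
      ((potential_smooth hw hp).continuous.comp (continuous_const.sub continuous_id))
    simp only [smul_eq_mul] at h1
    refine Eq.trans ?_ h1.symm
    rw [avg, ← integral_neg_eq_self]
    simp [sub_eq_add_neg]
  rw [e]
  refine (hC α A M w (fun y => potential H (x - y)) hr hw.continuous hp hA
    ((potential_smooth hHs hHp).comp (contDiff_const.sub contDiff_id))
    ((potential_periodic hHp).comp_sub_left x) fun k hk y => ?_).trans (le_of_eq (by ring))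
  have h2 : (fun y => potential H (x - y)) =
      (fun y => potential H (x + y)) ∘ (LinearIsometryEquiv.neg ℝ : Plane ≃ₗᵢ[ℝ] Plane) := by
    funext y
    simp [sub_eq_add_neg]
  rw [h2, LinearIsometryEquiv.norm_iteratedFDeriv_comp_right, iteratedFDeriv_comp_add_left]
  exact hM k hk _

/-- A radial kernel `χ` of positive mass with `z χ(z) = -∇Φ(z)`, `Φ` compactly supported. -/
theorem exists_radial_kernels : ∃ χ Φ : Plane → ℝ, IsSmooth χ ∧ HasCompactSupport χ ∧
    tsupport χ ⊆ Metric.ball 0 1 ∧ IsSmooth Φ ∧ HasCompactSupport Φ ∧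
    tsupport Φ ⊆ Metric.ball 0 1 ∧ 0 < ∫ z, χ z ∧ ∀ i z, pd i Φ z = -(z i * χ z) := by
  -- `s` decreases from `s 0 = 1` to `0` on `r ≥ 1/4`. With `Φ z = s (‖z‖²)` the chain rule gives
  -- `∇Φ = 2 s'(‖z‖²) z`, whence `χ = -2 s'(‖z‖²) ≥ 0`, and both are supported in the ball of radius
  -- `1/2`.
  set s : ℝ → ℝ := fun r => Real.smoothTransition (1 - 4 * r) with hs
  have hss : ContDiff ℝ ((⊤ : ℕ∞) : WithTop ℕ∞) s :=
    Real.smoothTransition.contDiff.comp (contDiff_const.sub (contDiff_const.mul contDiff_id))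
  have hs' : ContDiff ℝ ((⊤ : ℕ∞) : WithTop ℕ∞) (deriv s) :=
    (contDiff_infty_iff_deriv.1 hss).2
  set Φ : Plane → ℝ := fun z => s (‖z‖ ^ 2) with hΦ
  set χ : Plane → ℝ := fun z => -2 * deriv s (‖z‖ ^ 2) with hχ
  have hΦs : IsSmooth Φ := hss.comp (contDiff_norm_sq ℝ)
  have hχs : IsSmooth χ := contDiff_const.mul (hs'.comp (contDiff_norm_sq ℝ))
  have hpd : ∀ i z, pd i Φ z = -(z i * χ z) := by
    intro i z
    have h1 := ((hss.differentiable (by simp) (‖z‖ ^ 2)).hasDerivAt).comp_hasFDerivAt z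
      (hasStrictFDerivAt_norm_sq z).hasFDerivAt
    rw [pd, show Φ = s ∘ fun z : Plane => ‖z‖ ^ 2 from rfl, h1.fderiv]
    simp [hχ, stdVec, EuclideanSpace.inner_single_right]
    ring
  have hanti : Antitone s := fun a b hab =>
    Real.smoothTransition.monotone (by linarith)
  have hχ0 : ∀ z, 0 ≤ χ z := fun z => by
    have := hanti.deriv_nonpos (x := ‖z‖ ^ 2)
    simp only [hχ]
    linarith
  have hzero : ∀ r, 1 / 4 ≤ r → s r = 0 := fun r hr =>
    Real.smoothTransition.zero_of_nonpos (by linarith)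
  have hder : ∀ r, 1 / 4 < r → deriv s r = 0 := fun r hr => by
    have : s =ᶠ[𝓝 r] fun _ => 0 := by
      filter_upwards [lt_mem_nhds hr] with y hy using hzero y hy.le
    rw [this.deriv_eq]
    simp
  have hsub : Metric.closedBall (0 : Plane) (1 / 2) ⊆ Metric.ball 0 1 :=
    Metric.closedBall_subset_ball (by norm_num)
  have sq : ∀ z : Plane, z ∉ Metric.closedBall (0 : Plane) (1 / 2) → 1 / 4 < ‖z‖ ^ 2 := by
    intro z hz
    rw [mem_closedBall_zero_iff, not_le] at hz
    nlinarith
  have tΦ : tsupport Φ ⊆ Metric.closedBall 0 (1 / 2) :=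
    closure_minimal (fun z hz => by
      by_contra h
      exact hz (hzero _ (sq z h).le)) Metric.isClosed_closedBall
  have tχ : tsupport χ ⊆ Metric.closedBall 0 (1 / 2) :=
    closure_minimal (fun z hz => by
      by_contra h
      exact hz (by simp [hχ, hder _ (sq z h)])) Metric.isClosed_closedBall
  have cΦ : HasCompactSupport Φ := (isCompact_closedBall _ _).of_isClosed_subset
    (isClosed_tsupport _) tΦ
  have cχ : HasCompactSupport χ := (isCompact_closedBall _ _).of_isClosed_subset
    (isClosed_tsupport _) tχ
  refine ⟨χ, Φ, hχs, cχ, tχ.trans hsub, hΦs, cΦ, tΦ.trans hsub, ?_, hpd⟩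
  have hint := hχs.continuous.integrable_of_hasCompactSupport (μ := volume) cχ
  -- If `χ ≥ 0` had mass zero it would vanish identically, `Φ` would be constant, and `s 0 = 1`
  -- would equal `s 1 = 0`.
  refine lt_of_le_of_ne (integral_nonneg hχ0) fun h0 => ?_
  have h1 := (integral_eq_zero_iff_of_nonneg hχ0 hint).1 h0.symm
  have h2 : χ = 0 := hχs.continuous.ae_eq_iff_eq volume continuous_zero |>.1 h1
  have h3 : ∀ z, fderiv ℝ Φ z = 0 := fun z => by
    have : ∀ i, |pd i Φ z| ≤ 0 := fun i => by simp [hpd, h2]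
    have := norm_fderiv_le_pd this
    rw [mul_zero] at this
    exact norm_le_zero_iff.1 this
  have h4 := is_const_of_fderiv_eq_zero (𝕜 := ℝ) (hΦs.differentiable (by simp)) h3 0 (stdVec 0)
  simp only [hΦ, hs, norm_zero, norm_stdVec] at h4
  rw [Real.smoothTransition.one_of_one_le (by norm_num),
    Real.smoothTransition.zero_of_nonpos (by norm_num)] at h4
  exact one_ne_zero h4

/-- The multiscale representation of a smooth function through its Laplacian. -/
theorem avg_one_sub_eq {χ Φ : Plane → ℝ} (hχ : IsSmooth χ) (hχc : HasCompactSupport χ)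
    (hΦ : IsSmooth Φ) (hΦc : HasCompactSupport Φ) (h : ∀ i z, pd i Φ z = -(z i * χ z))
    {u : Plane → ℝ} (hu : IsSmooth u) (hp : IsPeriodic u) (x : Plane) :
    avg χ 1 u x - (∫ z, χ z) * u x =
      ∫ t in (0 : ℝ)..1, t * avg Φ t (fun y => pd 0 (pd 0 u) y + pd 1 (pd 1 u) y) x := by
  obtain ⟨M, hM0, hM⟩ := hp.fderiv.exists_bound hu.fderiv.continuous
  have hfc := hu.fderiv.continuous
  have huc := hu.continuous
  have hχc' := hχ.continuous
  have hL : Continuous fun y => pd 0 (pd 0 u) y + pd 1 (pd 1 u) y :=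
    ((hu.pd 0).pd 0).continuous.add ((hu.pd 1).pd 1).continuous
  have hLp : IsPeriodic fun y => pd 0 (pd 0 u) y + pd 1 (pd 1 u) y :=
    ((hp.pd 0).pd 0).comp₂ ((hp.pd 1).pd 1) fun a b => a + b
  -- `d/dt ∫ χ(z) u(x + t z) dz = ∫ χ(z) z · ∇u(x + t z) dz = -∫ ∇Φ · ∇u(x + t z) dz`, and one more
  -- integration by parts turns this into `t ∫ Φ(z) Δu(x + t z) dz`.
  have hd : ∀ t : ℝ, HasDerivAt (fun t => avg χ t u x)
      (t * avg Φ t (fun y => pd 0 (pd 0 u) y + pd 1 (pd 1 u) y) x) t := by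
    intro t
    have hb : Integrable fun z : Plane => |χ z| * (M * ‖z‖) :=
      Continuous.integrable_of_hasCompactSupport (by fun_prop) hχc.norm.mul_right
    have h1 := (hasDerivAt_integral_of_dominated_loc_of_deriv_le (μ := (volume : Measure Plane))
      (F := fun t z => χ z • u (x + t • z)) (F' := fun t z => χ z • fderiv ℝ u (x + t • z) z)
      (x₀ := t) (s := univ) (bound := fun z => |χ z| * (M * ‖z‖)) univ_mem
      (Eventually.of_forall fun s => (integrable_avg hχ.continuous hχc huc s x).aestronglyMeasurable)
      (integrable_avg hχ.continuous hχc huc t x)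
      (Continuous.aestronglyMeasurable (by fun_prop))
      (Eventually.of_forall fun z s _ => by
        rw [norm_smul, Real.norm_eq_abs]
        exact mul_le_mul_of_nonneg_left ((ContinuousLinearMap.le_opNorm _ _).trans
          (mul_le_mul_of_nonneg_right (hM _) (norm_nonneg _))) (abs_nonneg _))
      hb
      (Eventually.of_forall fun z s _ => by
        have h2 := (hu.differentiable (by simp) (x + s • z)).hasFDerivAt
        have h3 : HasDerivAt (fun s : ℝ => x + s • z) z s := by
          simpa using ((hasDerivAt_id s).smul_const z).const_add x
        exact (h2.comp_hasDerivAt s h3).const_smul (χ z))).2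
    convert! h1 using 1
    have e1 : ∀ z : Plane, χ z • fderiv ℝ u (x + t • z) z =
        -(pd 0 Φ z * pd 0 u (x + t • z)) - pd 1 Φ z * pd 1 u (x + t • z) := by
      intro z
      have : fderiv ℝ u (x + t • z) z =
          z 0 * pd 0 u (x + t • z) + z 1 * pd 1 u (x + t • z) := by
        conv_lhs => rw [plane_eq_sum z, map_add, map_smul, map_smul, ← plane_eq_sum z]
        rfl
      rw [this, h, h, smul_eq_mul]
      ring
    simp only [e1]
    have i : ∀ j, Integrable fun z => pd j Φ z * pd j u (x + t • z) := fun j =>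
      integrable_avg (hΦ.pd j).continuous (hasCompactSupport_pd hΦc j) (hu.pd j).continuous t x
    have e2 : ∀ j, ∫ z, pd j Φ z * pd j u (x + t • z) = -(t * avg Φ t (pd j (pd j u)) x) := by
      intro j
      rw [mul_avg_pd hΦ hΦc (hu.pd j), neg_neg]
      rfl
    rw [integral_sub (f := fun z => -(pd 0 Φ z * pd 0 u (x + t • z))) (i 0).neg (i 1),
      integral_neg, e2, e2, neg_neg, sub_neg_eq_add, ← mul_add]
    congr 1
    simp only [avg]
    rw [← integral_add (integrable_avg hΦ.continuous hΦc ((hu.pd 0).pd 0).continuous t x)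
      (integrable_avg hΦ.continuous hΦc ((hu.pd 1).pd 1).continuous t x)]
    simp only [smul_add]
  have hcont : Continuous fun t =>
      t * avg Φ t (fun y => pd 0 (pd 0 u) y + pd 1 (pd 1 u) y) x :=
    continuous_id.mul (continuous_avg_scale hΦ.continuous hΦc hL hLp x)
  rw [intervalIntegral.integral_eq_sub_of_hasDerivAt (fun t _ => hd t)
    (hcont.intervalIntegrable 0 1)]
  congr 1
  simp only [avg, zero_smul, add_zero, smul_eq_mul, integral_mul_const]

/-- Summing the scales: sup bound. -/
theorem abs_integral_scales_le {a : ℝ → ℝ} {γ B : ℝ} (hγ : 0 < γ)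
    (h : ∀ t ∈ Ioc (0 : ℝ) 1, |a t| ≤ B * t ^ (γ - 1)) : |∫ t in (0 : ℝ)..1, a t| ≤ B / γ := by
  have hi : IntervalIntegrable (fun t : ℝ => B * t ^ (γ - 1)) volume 0 1 :=
    (intervalIntegral.intervalIntegrable_rpow' (by linarith)).const_mul B
  have h1 := intervalIntegral.norm_integral_le_of_norm_le (f := a) (zero_le_one' ℝ)
    (Eventually.of_forall fun t ht => h t ht) hi
  refine h1.trans (le_of_eq ?_)
  rw [intervalIntegral.integral_const_mul, integral_rpow (Or.inl (by linarith))]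
  simp [hγ.ne']
  ring

/-- Summing the scales: Hölder bound. -/
theorem abs_integral_scales_le_rpow {a : ℝ → ℝ} {γ B d : ℝ} (hγ : 0 < γ) (hγ1 : γ < 1)
    (hB : 0 ≤ B) (hd : 0 ≤ d) (hd1 : d ≤ 1) (ha : Continuous a)
    (h : ∀ t ∈ Ioc (0 : ℝ) 1, |a t| ≤ B * t ^ (γ - 1))
    (h' : ∀ t ∈ Ioc (0 : ℝ) 1, |a t| ≤ B * t ^ (γ - 2) * d) :
    |∫ t in (0 : ℝ)..1, a t| ≤ B * (1 / γ + 1 / (1 - γ)) * d ^ γ := by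
  rcases hd.eq_or_lt with rfl | hd0
  · have : ∫ t in (0 : ℝ)..1, a t = 0 := by
      rw [intervalIntegral.integral_of_le zero_le_one]
      refine setIntegral_eq_zero_of_forall_eq_zero fun t ht => ?_
      have := h' t ht
      rw [mul_zero] at this
      exact abs_nonpos_iff.1 this
    rw [this, Real.zero_rpow hγ.ne']
    simp
  -- The scales are split at `t = d`, where the two bounds coincide: the size bound is integrated
  -- below, the Lipschitz bound above.
  rw [← intervalIntegral.integral_add_adjacent_intervals (ha.intervalIntegrable 0 d)
    (ha.intervalIntegrable d 1)]
  have i1 : IntervalIntegrable (fun t : ℝ => B * t ^ (γ - 1)) volume 0 d :=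
    (intervalIntegral.intervalIntegrable_rpow' (by linarith)).const_mul B
  have nz : (0 : ℝ) ∉ uIcc d 1 := by
    rw [uIcc_of_le hd1]
    exact fun h => absurd h.1 (not_le.2 hd0)
  have i2 : IntervalIntegrable (fun t : ℝ => B * t ^ (γ - 2) * d) volume d 1 :=
    ((intervalIntegral.intervalIntegrable_rpow (Or.inr nz)).const_mul B).mul_const d
  have b1 := intervalIntegral.norm_integral_le_of_norm_le (f := a) hd
    (Eventually.of_forall fun t ht => h t ⟨ht.1, ht.2.trans hd1⟩) i1
  have b2 := intervalIntegral.norm_integral_le_of_norm_le (f := a) hd1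
    (Eventually.of_forall fun t ht => h' t ⟨hd0.trans ht.1, ht.2⟩) i2
  rw [intervalIntegral.integral_const_mul, integral_rpow (Or.inl (by linarith)), sub_add_cancel,
    Real.zero_rpow hγ.ne', sub_zero] at b1
  rw [intervalIntegral.integral_mul_const, intervalIntegral.integral_const_mul,
    integral_rpow (Or.inr ⟨by linarith, nz⟩), Real.one_rpow,
    show γ - 2 + 1 = γ - 1 by ring] at b2
  have e : (1 - d ^ (γ - 1)) / (γ - 1) = (d ^ (γ - 1) - 1) / (1 - γ) := by
    rw [← neg_div_neg_eq]
    ring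
  rw [e] at b2
  have b3 : (d ^ (γ - 1) - 1) / (1 - γ) * d ≤ d ^ γ / (1 - γ) := by
    rw [div_mul_eq_mul_div]
    refine div_le_div_of_nonneg_right ?_ (by linarith)
    rw [sub_mul, one_mul, ← Real.rpow_add_one hd0.ne', sub_add_cancel]
    linarith
  refine (abs_add_le _ _).trans ((add_le_add b1 b2).trans ?_)
  calc B * (d ^ γ / γ) + B * ((d ^ (γ - 1) - 1) / (1 - γ)) * d
      = B * (d ^ γ / γ) + B * ((d ^ (γ - 1) - 1) / (1 - γ) * d) := by ring
    _ ≤ B * (d ^ γ / γ) + B * (d ^ γ / (1 - γ)) := by gcongr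
    _ = _ := by ring

end Schauder

end TorusCR

namespace TorusCR

/-! ### Hölder estimates for the potential and its gradient -/

noncomputable section HolderEstimates

/-- Derivative bounds and testing bounds for the averages of a function of weak regularity. -/
theorem exists_avg_bounds {Φ : Plane → ℝ} (hΦ : IsSmooth Φ) (hc : HasCompactSupport Φ)
    (hs : tsupport Φ ⊆ Metric.ball 0 1) (r : ℕ) : ∃ M : ℝ, 0 ≤ M ∧
    ∀ (α A : ℝ) (f : Plane → ℝ), ⌊-α + 1⌋₊ = r → IsSmooth f → IsPeriodic f →
    HZBound α (funDist f) A → ∀ t ∈ Ioc (0 : ℝ) 1,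
    (∀ x, |avg Φ t f x| ≤ M * A * t ^ α) ∧
    ∀ x y, |avg Φ t f x - avg Φ t f y| ≤ M * A * t ^ (α - 1) * ‖x - y‖ := by
  obtain ⟨M, hM0, hM⟩ := exists_iteratedFDeriv_bound hΦ hc r
  have hd : ∀ i : Fin 2, ∃ M, 0 ≤ M ∧ ∀ k ≤ r, ∀ x, ‖iteratedFDeriv ℝ k (pd i Φ) x‖ ≤ M :=
    fun i => exists_iteratedFDeriv_bound (hΦ.pd i) (hasCompactSupport_pd hc i) r
  choose N hN0 hN using hd
  have n0 := hN0 0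
  have n1 := hN0 1
  refine ⟨M + 2 * (N 0 + N 1), by positivity, ?_⟩
  rintro α A f rfl hf hp hA t ht
  have hA0 := hA.nonneg
  have ht0 := ht.1
  constructor
  · intro x
    refine (hA.abs_avg_le hf.continuous hp hΦ hc hs hM ht x).trans ?_
    gcongr
    linarith
  · intro x y
    have key : ∀ i z, |pd i (avg Φ t f) z| ≤ (N 0 + N 1) * A * t ^ (α - 1) := by
      intro i z
      have h1 := hA.abs_avg_le hf.continuous hp (hΦ.pd i) (hasCompactSupport_pd hc i)
        ((tsupport_pd_subset Φ i).trans hs) (hN i) ht z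
      have h2 := mul_avg_pd hΦ hc hf t i z
      have h3 : t * |pd i (avg Φ t f) z| ≤ N i * A * t ^ α := by
        rw [pd_avg hΦ.continuous hc hf hp, ← abs_of_pos ht0, ← abs_mul, abs_of_pos ht0, h2, abs_neg]
        exact h1
      rw [mul_comm, ← le_div_iff₀ ht0] at h3
      refine h3.trans ?_
      rw [Real.rpow_sub_one ht0.ne', ← mul_div_assoc]
      have : N i ≤ N 0 + N 1 := by
        fin_cases i
        · simp only [Fin.zero_eta]; linarith
        · simp only [Fin.mk_one]; linarith
      gcongr
    refine (abs_sub_le_of_pd (IsSmooth.avg hΦ.continuous hc hf hp t) key x y).trans ?_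
    rw [← mul_assoc, ← mul_assoc]
    gcongr
    linarith

theorem le_rpow_of_le_one {d γ : ℝ} (hd : 0 ≤ d) (hd1 : d ≤ 1) (hγ : 0 < γ) (hγ1 : γ < 1) :
    d ≤ d ^ γ := by
  conv_lhs => rw [← Real.rpow_one d]
  rcases hd.eq_or_lt with rfl | h
  · rw [Real.zero_rpow hγ.ne', Real.rpow_one]
  · exact Real.rpow_le_rpow_of_exponent_ge h hd1 hγ1.le

/-- Schauder estimate: the potential gains two derivatives. -/
theorem exists_holderBound_potential {γ : ℝ} (hγ : 0 < γ) (hγ1 : γ < 1) : ∃ C : ℝ, 0 ≤ C ∧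
    ∀ (w : Plane → ℝ) (A : ℝ), IsSmooth w → IsPeriodic w → HZBound (γ - 2) (funDist w) A →
    HolderBound γ (potential w) (C * A) := by
  obtain ⟨χ, Φ, hχ, hχc, hχs, hΦ, hΦc, hΦs, hpos, hrel⟩ := exists_radial_kernels
  set r := ⌊-(γ - 2) + 1⌋₊ with hr
  obtain ⟨M, hM0, hM⟩ := exists_avg_bounds hΦ hΦc hΦs r
  have hfar : ∀ i : Fin 2, ∃ C : ℝ, 0 ≤ C ∧ ∀ (α A : ℝ) (w : Plane → ℝ), ⌊-α + 1⌋₊ = r →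
      IsSmooth w → IsPeriodic w → HZBound α (funDist w) A →
      ∀ x, |avg (pd i χ) 1 (potential w) x| ≤ C * A := fun i =>
    exists_abs_avg_potential_le (hχ.pd i) (hasCompactSupport_pd hχc i) r
  choose F hF0 hF using hfar
  set c := ∫ z, χ z with hcdef
  have f0 := hF0 0
  have f1 := hF0 1
  have hγ' : 0 < 1 - γ := by linarith
  refine ⟨c⁻¹ * (2 * (F 0 + F 1) + 2 * M * (1 / γ + 1 / (1 - γ))), by positivity, ?_⟩
  intro w A hw hp hA x y hxy
  have hA0 := hA.nonneg
  set u := potential w with hu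
  have hus : IsSmooth u := potential_smooth hw hp
  have hup : IsPeriodic u := potential_periodic hp
  set d := ‖x - y‖ with hd
  have hd0 : 0 ≤ d := norm_nonneg _
  set L := fun z => pd 0 (pd 0 u) z + pd 1 (pd 1 u) z with hL
  have hLc : Continuous L := ((hus.pd 0).pd 0).continuous.add ((hus.pd 1).pd 1).continuous
  have hLp : IsPeriodic L := ((hup.pd 0).pd 0).comp₂ ((hup.pd 1).pd 1) fun a b => a + b
  set a : ℝ → ℝ := fun t => t * avg Φ t L x - t * avg Φ t L y with ha
  have hcx := continuous_avg_scale hΦ.continuous hΦc hLc hLp x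
  have hcy := continuous_avg_scale hΦ.continuous hΦc hLc hLp y
  have hac : Continuous a := (continuous_id.mul hcx).sub (continuous_id.mul hcy)
  -- The Laplacian of the potential is a constant minus `w`; the constant drops out of the
  -- difference between two points.
  have haw : ∀ t, a t = -(t * (avg Φ t w x - avg Φ t w y)) := by
    intro t
    have h1 : ∀ z, avg Φ t L z =
        (∫ z, Φ z * ((4 * (Real.pi : ℂ) ^ 2)⁻¹ * fcoef 0 fun y => (w y : ℂ)).re) - avg Φ t w z := by
      intro z
      rw [avg, avg, ← integral_sub ((hΦ.continuous.integrable_of_hasCompactSupport hΦc).mul_const _)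
        (integrable_avg hΦ.continuous hΦc hw.continuous t z)]
      refine integral_congr_ae (Eventually.of_forall fun s => ?_)
      simp only [hL, hu, laplacian_potential hw hp, smul_eq_mul]
      ring
    simp only [ha, h1]
    ring
  have b1 : ∀ t ∈ Ioc (0 : ℝ) 1, |a t| ≤ 2 * M * A * t ^ (γ - 1) := by
    intro t ht
    obtain ⟨h1, -⟩ := hM _ A w hr.symm hw hp hA t ht
    rw [haw, abs_neg, abs_mul, abs_of_pos ht.1]
    calc t * |avg Φ t w x - avg Φ t w y|
        ≤ t * (M * A * t ^ (γ - 2) + M * A * t ^ (γ - 2)) := by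
          have := ht.1
          gcongr
          exact (abs_sub _ _).trans (add_le_add (h1 x) (h1 y))
      _ = 2 * M * A * (t ^ (γ - 2) * t) := by ring
      _ = _ := by rw [← Real.rpow_add_one ht.1.ne', show γ - 2 + 1 = γ - 1 by ring]
  have b2 : ∀ t ∈ Ioc (0 : ℝ) 1, |a t| ≤ 2 * M * A * t ^ (γ - 2) * d := by
    intro t ht
    obtain ⟨-, h1⟩ := hM _ A w hr.symm hw hp hA t ht
    have ht0 := ht.1
    rw [haw, abs_neg, abs_mul, abs_of_pos ht.1]
    calc t * |avg Φ t w x - avg Φ t w y|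
        ≤ t * (M * A * t ^ (γ - 2 - 1) * d) := by gcongr; exact h1 x y
      _ = M * A * (t ^ (γ - 2 - 1) * t) * d := by ring
      _ = M * A * t ^ (γ - 2) * d := by rw [← Real.rpow_add_one ht.1.ne', sub_add_cancel]
      _ ≤ 2 * M * A * t ^ (γ - 2) * d := by
        have : 0 ≤ M * A * t ^ (γ - 2) * d := by positivity
        linarith
  have near := abs_integral_scales_le_rpow hγ hγ1 (by positivity) hd0 hxy hac b1 b2
  -- The average at scale one is smooth with derivatives controlled by the weak norm of `w`, hence
  -- Lipschitz; `d ≤ d^γ` for `d ≤ 1` turns this into a Hölder bound.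
  have far : |avg χ 1 u x - avg χ 1 u y| ≤ 2 * ((F 0 + F 1) * A) * d := by
    refine abs_sub_le_of_pd (IsSmooth.avg hχ.continuous hχc hus hup 1) (fun i z => ?_) x y
    have h1 := mul_avg_pd hχ hχc hus 1 i z
    rw [one_mul] at h1
    rw [pd_avg hχ.continuous hχc hus hup, h1, abs_neg]
    refine (hF i _ A w hr.symm hw hp hA z).trans ?_
    gcongr
    fin_cases i
    · simp only [Fin.zero_eta]; linarith
    · simp only [Fin.mk_one]; linarith
  have ex := avg_one_sub_eq hχ hχc hΦ hΦc hrel hus hup x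
  have ey := avg_one_sub_eq hχ hχc hΦ hΦc hrel hus hup y
  have e : ∫ t in (0 : ℝ)..1, a t = (∫ t in (0 : ℝ)..1, t * avg Φ t L x) -
      ∫ t in (0 : ℝ)..1, t * avg Φ t L y :=
    intervalIntegral.integral_sub ((continuous_id.mul hcx).intervalIntegrable 0 1)
      ((continuous_id.mul hcy).intervalIntegrable 0 1)
  rw [← ex, ← ey] at e
  have e2 : c * (u x - u y) = (avg χ 1 u x - avg χ 1 u y) - ∫ t in (0 : ℝ)..1, a t := by
    rw [e]
    ring
  have fin : c * |u x - u y| ≤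
      (2 * (F 0 + F 1) + 2 * M * (1 / γ + 1 / (1 - γ))) * A * d ^ γ := by
    rw [← abs_of_pos hpos, ← abs_mul, e2]
    refine (abs_sub _ _).trans ((add_le_add far near).trans ?_)
    have := le_rpow_of_le_one hd0 hxy hγ hγ1
    calc 2 * ((F 0 + F 1) * A) * d + 2 * M * A * (1 / γ + 1 / (1 - γ)) * d ^ γ
        ≤ 2 * ((F 0 + F 1) * A) * d ^ γ + 2 * M * A * (1 / γ + 1 / (1 - γ)) * d ^ γ := by gcongr
      _ = _ := by ring
  rw [mul_comm, ← le_div_iff₀ hpos] at fin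
  refine fin.trans (le_of_eq ?_)
  field_simp

/-- Schauder estimate for first derivatives of the potential. -/
theorem exists_holderBound_pd_potential {γ : ℝ} (hγ : 0 < γ) (hγ1 : γ < 1) : ∃ C : ℝ, 0 ≤ C ∧
    ∀ (w : Plane → ℝ) (A : ℝ), IsSmooth w → IsPeriodic w → HZBound (γ - 1) (funDist w) A →
    ∀ i, (∀ x, |pd i (potential w) x| ≤ C * A) ∧ HolderBound γ (pd i (potential w)) (C * A) := by
  obtain ⟨χ, Φ, hχ, hχc, hχs, hΦ, hΦc, hΦs, hpos, hrel⟩ := exists_radial_kernels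
  set r := ⌊-(γ - 1) + 1⌋₊ with hr
  set c := ∫ z, χ z with hcdef
  have hγ' : 0 < 1 - γ := by linarith
  have key : ∀ i : Fin 2, ∃ C : ℝ, 0 ≤ C ∧ ∀ (w : Plane → ℝ) (A : ℝ), IsSmooth w → IsPeriodic w →
      HZBound (γ - 1) (funDist w) A →
      (∀ x, |pd i (potential w) x| ≤ C * A) ∧ HolderBound γ (pd i (potential w)) (C * A) := by
    intro i
    obtain ⟨M, hM0, hM⟩ := exists_avg_bounds (hΦ.pd i) (hasCompactSupport_pd hΦc i)
      ((tsupport_pd_subset Φ i).trans hΦs) r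
    obtain ⟨G, hG0, hG⟩ := exists_abs_avg_potential_le (hχ.pd i) (hasCompactSupport_pd hχc i) r
    have hfar : ∀ j : Fin 2, ∃ C : ℝ, 0 ≤ C ∧ ∀ (α A : ℝ) (w : Plane → ℝ), ⌊-α + 1⌋₊ = r →
        IsSmooth w → IsPeriodic w → HZBound α (funDist w) A →
        ∀ x, |avg (pd j (pd i χ)) 1 (potential w) x| ≤ C * A := fun j =>
      exists_abs_avg_potential_le ((hχ.pd i).pd j)
        (hasCompactSupport_pd (hasCompactSupport_pd hχc i) j) r
    choose F hF0 hF using hfar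
    have f0 := hF0 0
    have f1 := hF0 1
    refine ⟨c⁻¹ * (G + 2 * (F 0 + F 1) + 2 * M * (1 / γ + 1 / (1 - γ))), by positivity, ?_⟩
    intro w A hw hp hA
    have hA0 := hA.nonneg
    set u := potential w with hu
    have hus : IsSmooth u := potential_smooth hw hp
    have hup : IsPeriodic u := potential_periodic hp
    have hzu : pd i u = potential (pd i w) := pd_potential hw hp i
    -- The representation formula is applied to `∂ᵢu`, whose Laplacian is `-∂ᵢw`. The weight `t` is
    -- used up in moving `∂ᵢ` onto the kernel, which leaves averages of `w` of size `t^(γ-1)`,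
    -- integrable at zero.
    have hrep : ∀ x, c * pd i u x = -avg (pd i χ) 1 u x -
        ∫ t in (0 : ℝ)..1, avg (pd i Φ) t w x := by
      intro x
      have h1 := avg_one_sub_eq hχ hχc hΦ hΦc hrel (hus.pd i) (hup.pd i) x
      have h2 := mul_avg_pd hχ hχc hus 1 i x
      rw [one_mul] at h2
      have h3 : ∀ t, t * avg Φ t (fun y => pd 0 (pd 0 (pd i u)) y + pd 1 (pd 1 (pd i u)) y) x =
          avg (pd i Φ) t w x := by
        intro t
        have h4 : (fun y => pd 0 (pd 0 (pd i u)) y + pd 1 (pd 1 (pd i u)) y) =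
            fun y => -pd i w y := by
          funext y
          rw [hzu, laplacian_potential_pd hw hp]
        have h5 := mul_avg_pd hΦ hΦc hw t i x
        rw [h4, ← neg_neg (avg (pd i Φ) t w x), ← h5]
        simp only [avg, smul_neg, integral_neg, mul_neg]
      simp only [h3, h2] at h1
      linarith
    have hcont : ∀ x, Continuous fun t => avg (pd i Φ) t w x := fun x =>
      continuous_avg_scale (hΦ.pd i).continuous (hasCompactSupport_pd hΦc i) hw.continuous hp x
    constructor
    · intro x
      have b1 : |∫ t in (0 : ℝ)..1, avg (pd i Φ) t w x| ≤ M * A / γ :=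
        abs_integral_scales_le hγ fun t ht =>
          (hM _ A w hr.symm hw hp hA t ht).1 x
      have b2 := hG _ A w hr.symm hw hp hA x
      have fin : c * |pd i u x| ≤ G * A + M * A / γ := by
        rw [← abs_of_pos hpos, ← abs_mul, hrep]
        refine (abs_sub _ _).trans ?_
        rw [abs_neg]
        exact add_le_add b2 b1
      rw [mul_comm, ← le_div_iff₀ hpos] at fin
      refine fin.trans ?_
      rw [div_eq_inv_mul, mul_assoc]
      gcongr
      have p1 : 0 ≤ (F 0 + F 1) * A := by positivity
      have p2 : 0 ≤ M * (1 / (1 - γ)) * A := by positivity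
      have p3 : 0 ≤ M * (1 / γ) * A := by positivity
      have p4 : M * A / γ = M * (1 / γ) * A := by ring
      nlinarith
    · intro x y hxy
      set d := ‖x - y‖ with hd
      have hd0 : 0 ≤ d := norm_nonneg _
      set a : ℝ → ℝ := fun t => avg (pd i Φ) t w x - avg (pd i Φ) t w y with ha
      have hac : Continuous a := (hcont x).sub (hcont y)
      have b1 : ∀ t ∈ Ioc (0 : ℝ) 1, |a t| ≤ 2 * M * A * t ^ (γ - 1) := by
        intro t ht
        obtain ⟨h1, -⟩ := hM _ A w hr.symm hw hp hA t ht
        refine (abs_sub _ _).trans ((add_le_add (h1 x) (h1 y)).trans (le_of_eq ?_))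
        ring
      have b2 : ∀ t ∈ Ioc (0 : ℝ) 1, |a t| ≤ 2 * M * A * t ^ (γ - 2) * d := by
        intro t ht
        obtain ⟨-, h1⟩ := hM _ A w hr.symm hw hp hA t ht
        have ht0 := ht.1
        refine (h1 x y).trans ?_
        rw [show γ - 1 - 1 = γ - 2 by ring]
        have : 0 ≤ M * A * t ^ (γ - 2) * d := by positivity
        linarith
      have near := abs_integral_scales_le_rpow hγ hγ1 (by positivity) hd0 hxy hac b1 b2
      have far : |avg (pd i χ) 1 u x - avg (pd i χ) 1 u y| ≤ 2 * ((F 0 + F 1) * A) * d := by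
        refine abs_sub_le_of_pd (IsSmooth.avg (hχ.pd i).continuous (hasCompactSupport_pd hχc i)
          hus hup 1) (fun j z => ?_) x y
        have h1 := mul_avg_pd (hχ.pd i) (hasCompactSupport_pd hχc i) hus 1 j z
        rw [one_mul] at h1
        rw [pd_avg (hχ.pd i).continuous (hasCompactSupport_pd hχc i) hus hup, h1, abs_neg]
        refine (hF j _ A w hr.symm hw hp hA z).trans ?_
        gcongr
        fin_cases j
        · simp only [Fin.zero_eta]; linarith
        · simp only [Fin.mk_one]; linarith
      have e : ∫ t in (0 : ℝ)..1, a t = (∫ t in (0 : ℝ)..1, avg (pd i Φ) t w x) -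
          ∫ t in (0 : ℝ)..1, avg (pd i Φ) t w y :=
        intervalIntegral.integral_sub ((hcont x).intervalIntegrable 0 1)
          ((hcont y).intervalIntegrable 0 1)
      have e2 : c * (pd i u x - pd i u y) =
          -(avg (pd i χ) 1 u x - avg (pd i χ) 1 u y) - ∫ t in (0 : ℝ)..1, a t := by
        rw [mul_sub, hrep, hrep, e]
        ring
      have fin : c * |pd i u x - pd i u y| ≤
          (G + 2 * (F 0 + F 1) + 2 * M * (1 / γ + 1 / (1 - γ))) * A * d ^ γ := by
        rw [← abs_of_pos hpos, ← abs_mul, e2]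
        refine (abs_sub _ _).trans ?_
        rw [abs_neg]
        refine (add_le_add far near).trans ?_
        have h1 := le_rpow_of_le_one hd0 hxy hγ hγ1
        have h2 : 0 ≤ G * A * d ^ γ := by positivity
        calc 2 * ((F 0 + F 1) * A) * d + 2 * M * A * (1 / γ + 1 / (1 - γ)) * d ^ γ
            ≤ 2 * ((F 0 + F 1) * A) * d ^ γ + 2 * M * A * (1 / γ + 1 / (1 - γ)) * d ^ γ := by
              gcongr
          _ ≤ G * A * d ^ γ + (2 * ((F 0 + F 1) * A) * d ^ γ +
              2 * M * A * (1 / γ + 1 / (1 - γ)) * d ^ γ) := by linarith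
          _ = _ := by ring
      rw [mul_comm, ← le_div_iff₀ hpos] at fin
      refine fin.trans (le_of_eq ?_)
      field_simp
  choose C hC0 hC using key
  have c0 := hC0 0
  have c1 := hC0 1
  refine ⟨C 0 + C 1, by positivity, fun w A hw hp hA i => ?_⟩
  have hA0 := hA.nonneg
  have hle : C i * A ≤ (C 0 + C 1) * A := by
    gcongr
    fin_cases i
    · simp only [Fin.zero_eta]; linarith
    · simp only [Fin.mk_one]; linarith
  obtain ⟨h1, h2⟩ := hC i w A hw hp hA
  exact ⟨fun x => (h1 x).trans hle, fun x y hxy => (h2 x y hxy).trans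
    (mul_le_mul_of_nonneg_right hle (by positivity))⟩

theorem integral_abs_ballTests_le {r : ℕ} {φ : Plane → ℝ} (hφ : φ ∈ ballTests r) :
    ∫ z, |φ z| ≤ 4 := by
  have := abs_integral_le_of_ball (f := fun z => |φ z|) (x := 0) (lam := 1) (B := 1) one_pos
    zero_le_one (fun y hy => by
      rw [image_eq_zero_of_notMem_tsupport fun h => hy (hφ.2.2.1 h), abs_zero])
    (fun y _ => by rw [abs_abs]; exact abs_le_one_of_mem_ballTests hφ y)
  refine (le_abs_self _).trans (this.trans (by norm_num))

/-- Bounded Hölder functions have finite Hölder–Zygmund norm. -/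
theorem hzReal_le_of_holderBound {γ B : ℝ} (hγ : 0 < γ) {z : Plane → ℝ}
    (hz : IsSmooth z) (hp : IsPeriodic z) (h0 : ∀ x, |z x| ≤ B) (h : HolderBound γ z B) :
    hzReal γ (funDist z) ≤ ENNReal.ofReal (8 * B) := by
  have hB0 := h.nonneg
  rw [hzReal, if_pos hγ.le, show 8 * B = 4 * B + 4 * B by ring,
    ENNReal.ofReal_add (by positivity) (by positivity)]
  refine add_le_add ?_ ?_
  · refine iSup_le fun x => iSup₂_le fun φ hφ => ENNReal.ofReal_le_ofReal ?_
    rw [funDist_rescale hφ.1 hφ.2.1 one_pos x hz.continuous hp]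
    refine (norm_avg_le (f := z) hφ.1.continuous hφ.2.1 fun y _ => h0 _).trans ?_
    gcongr
    exact integral_abs_ballTests_le hφ
  · refine iSup_le fun x => iSup₂_le fun lam hl => iSup₂_le fun φ hφ =>
      ENNReal.ofReal_le_ofReal ?_
    obtain ⟨hφ, hφ0⟩ := hφ
    have hl0 := hl.1
    rw [div_le_iff₀ (Real.rpow_pos_of_pos hl.1 _),
      funDist_rescale hφ.1 hφ.2.1 hl.1 x hz.continuous hp]
    -- Only the moment of degree zero is needed: it allows `z x` to be subtracted, after which the
    -- Hölder bound supplies `λ^γ`.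
    have hm : ∫ y, φ y = 0 := by simpa using hφ0 0 (by simpa using hγ.le)
    have e : avg φ lam z x = avg φ lam (fun y => z y - z x) x := by
      simp only [avg, smul_eq_mul, mul_sub]
      rw [integral_sub (f := fun y => φ y * z (x + lam • y))
        (integrable_avg hφ.1.continuous hφ.2.1 hz.continuous lam x) ((hφ.1.continuous.integrable_of_hasCompactSupport hφ.2.1).mul_const _),
        integral_mul_const, hm]
      ring
    rw [e, mul_assoc]
    refine (norm_avg_le (f := fun y => z y - z x) (M := B * lam ^ γ) hφ.1.continuous hφ.2.1
      fun y hy => ?_).trans ?_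
    · have hy1 : ‖y‖ < 1 := by simpa using hφ.2.2.1 hy
      have h1 : ‖x + lam • y - x‖ ≤ lam := by
        rw [add_sub_cancel_left, norm_smul, Real.norm_of_nonneg hl.1.le]
        exact mul_le_of_le_one_right hl.1.le hy1.le
      refine (h _ _ (h1.trans hl.2)).trans ?_
      gcongr
    · gcongr
      exact integral_abs_ballTests_le hφ

end HolderEstimates

end TorusCR

namespace TorusCR

/-! ### Linearity and semicontinuity of the Hölder–Zygmund norms -/

noncomputable section FunctionalNorms

theorem HZBound.add {α A B : ℝ} {f g : TestSpace → ℝ} (hf : HZBound α f A) (hg : HZBound α g B) :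
    HZBound α (fun φ => f φ + g φ) (A + B) := fun x lam hl φ hφ => by
  rw [add_mul]
  exact (abs_add_le _ _).trans (add_le_add (hf x lam hl φ hφ) (hg x lam hl φ hφ))

theorem HZBound.neg {α A : ℝ} {f : TestSpace → ℝ} (hf : HZBound α f A) :
    HZBound α (fun φ => -f φ) A := fun x lam hl φ hφ => by
  rw [abs_neg]
  exact hf x lam hl φ hφ

/-- The bound is a family of closed conditions, one for each test function, so weak convergence
suffices to pass to the limit. -/
theorem HZBound.of_tendsto {ι : Type*} {l : Filter ι} [l.NeBot] {α B : ℝ} {b : ι → ℝ}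
    {F : ι → TestSpace → ℝ} {G : TestSpace → ℝ} (hF : ∀ φ, Tendsto (fun i => F i φ) l (𝓝 (G φ)))
    (hb : Tendsto b l (𝓝 B)) (h : ∀ᶠ i in l, HZBound α (F i) (b i)) : HZBound α G B :=
  fun x lam hl φ hφ => le_of_tendsto_of_tendsto (hF _).abs (hb.mul_const _)
    (h.mono fun _ hi => hi x lam hl φ hφ)

/-- Lower semicontinuity of the Hölder–Zygmund norms. -/
theorem hzReal_le_of_tendsto {ι : Type*} {l : Filter ι} [l.NeBot] {α : ℝ} {b : ι → ℝ≥0∞}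
    {B : ℝ≥0∞} {F : ι → TestSpace → ℝ} {G : TestSpace → ℝ}
    (hF : ∀ φ, Tendsto (fun i => F i φ) l (𝓝 (G φ))) (hb : Tendsto b l (𝓝 B))
    (h : ∀ᶠ i in l, hzReal α (F i) ≤ b i) : hzReal α G ≤ B := by
  have key : ∀ F : TestSpace → ℝ, hzReal α F =
      if 0 ≤ α then (⨆ (x : Plane) (φ ∈ ballTests 0),
        ENNReal.ofReal |F (periodize (rescale φ 1 x))|) +
      ⨆ (x : Plane) (lam ∈ Ioc (0 : ℝ) 1) (φ ∈ ballTests 0 ∩ annihilating α),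
        ENNReal.ofReal (|F (periodize (rescale φ lam x))| / lam ^ α)
      else ⨆ (x : Plane) (lam ∈ Ioc (0 : ℝ) 1) (φ ∈ ballTests ⌊-α + 1⌋₊),
        ENNReal.ofReal (|F (periodize (rescale φ lam x))| / lam ^ α) := fun _ => rfl
  simp only [key] at h ⊢
  have hlim : ∀ (φ : TestSpace) (c : ℝ), Tendsto (fun i => ENNReal.ofReal (|F i φ| / c)) l
      (𝓝 (ENNReal.ofReal (|G φ| / c))) := fun φ c =>
    ENNReal.tendsto_ofReal ((hF φ).abs.div_const c)
  have hlim' : ∀ (φ : TestSpace), Tendsto (fun i => ENNReal.ofReal |F i φ|) l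
      (𝓝 (ENNReal.ofReal |G φ|)) := fun φ => ENNReal.tendsto_ofReal (hF φ).abs
  split_ifs at h ⊢ with hα
  · have h0 : (fun _ => 0 : Plane → ℝ) ∈ ballTests 0 ∩ annihilating α :=
      ⟨zero_mem_ballTests 0, fun k _ => by simp⟩
    -- A norm of nonnegative order is a sum of two suprema. It is bounded through pairs of
    -- independently chosen test functions, for which the limit can be taken; this requires nonempty
    -- index sets, provided by the zero function and the scale one.
    refine ENNReal.iSup_add_iSup_le fun x y =>
      ENNReal.biSup_add_biSup_le (s := ballTests 0) ⟨_, h0.1⟩ (t := Ioc (0 : ℝ) 1)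
      ⟨1, one_pos, le_rfl⟩ fun φ hφ lam hl => ?_
    rw [ENNReal.add_biSup (s := ballTests 0 ∩ annihilating α) ⟨_, h0⟩]
    refine iSup₂_le fun ψ hψ => le_of_tendsto_of_tendsto
      ((hlim' (periodize (rescale φ 1 x))).add (hlim (periodize (rescale ψ lam y)) (lam ^ α))) hb
      (h.mono fun i hi => le_trans (add_le_add ?_ ?_) hi)
    · exact le_iSup_of_le x (le_iSup₂_of_le φ hφ le_rfl)
    · exact le_iSup_of_le y (le_iSup₂_of_le lam hl (le_iSup₂_of_le ψ hψ le_rfl))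
  · refine iSup_le fun x => iSup₂_le fun lam hl => iSup₂_le fun φ hφ =>
      le_of_tendsto_of_tendsto (hlim _ _) hb (h.mono fun i hi => le_trans ?_ hi)
    exact le_iSup_of_le x (le_iSup₂_of_le lam hl (le_iSup₂_of_le φ hφ le_rfl))

theorem hzReal_neg (α : ℝ) (f : TestSpace → ℝ) : hzReal α (fun φ => -f φ) = hzReal α f := by
  simp only [hzReal, abs_neg]

theorem hzReal_zero (α : ℝ) : hzReal α (fun _ => 0) = 0 := by
  simp [hzReal]

theorem le_l2norm {ι : Type*} [Fintype ι] (a : ι → ℝ≥0∞) (i : ι) : a i ≤ l2norm a := by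
  rw [l2norm, one_div, ENNReal.le_rpow_inv_iff (by norm_num)]
  rw [show (2 : ℝ) = ((2 : ℕ) : ℝ) by norm_num, ENNReal.rpow_natCast]
  exact Finset.single_le_sum (f := fun i => a i ^ 2) (fun _ _ => zero_le) (Finset.mem_univ i)

theorem l2norm_le_sum {ι : Type*} [Fintype ι] (a : ι → ℝ≥0∞) : l2norm a ≤ ∑ i, a i := by
  rw [l2norm, one_div, ENNReal.rpow_inv_le_iff (by norm_num)]
  rw [show (2 : ℝ) = ((2 : ℕ) : ℝ) by norm_num, ENNReal.rpow_natCast, sq, Finset.sum_mul]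
  refine Finset.sum_le_sum fun i _ => ?_
  rw [sq]
  gcongr
  exact Finset.single_le_sum (f := a) (fun _ _ => zero_le) (Finset.mem_univ i)

theorem hzNorm_le {α : ℝ} {f : TestSpace → ℂ} {A B : ℝ≥0∞} (hA : hzReal α (fun φ => (f φ).re) ≤ A)
    (hB : hzReal α (fun φ => (f φ).im) ≤ B) : hzNorm α f ≤ A + B := by
  refine (l2norm_le_sum _).trans ?_
  simpa using add_le_add hA hB

theorem hzNorm_sub_comm (α : ℝ) (f g : TestSpace → ℂ) :
    hzNorm α (fun φ => f φ - g φ) = hzNorm α (fun φ => g φ - f φ) := by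
  rw [hzNorm, hzNorm, ← hzReal_neg α (fun φ => (f φ - g φ).re),
    ← hzReal_neg α (fun φ => (f φ - g φ).im)]
  simp

theorem integrableOn_test_smul {F : Type*} [NormedAddCommGroup F] [NormedSpace ℝ F]
    {f : Plane → F} (hf : Continuous f) (φ : TestSpace) :
    IntegrableOn (fun x => (φ : Plane → ℝ) x • f x) cell :=
  integrableOn_cell (φ.2.1.continuous.smul hf)

theorem funDist_sub {F : Type*} [NormedAddCommGroup F] [NormedSpace ℝ F]
    {f g : Plane → F} (hf : Continuous f) (hg : Continuous g) (φ : TestSpace) :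
    funDist (fun x => f x - g x) φ = funDist f φ - funDist g φ := by
  simp only [funDist, smul_sub]
  exact integral_sub (integrableOn_test_smul hf φ) (integrableOn_test_smul hg φ)

theorem funDist_add {F : Type*} [NormedAddCommGroup F] [NormedSpace ℝ F]
    {f g : Plane → F} (hf : Continuous f) (hg : Continuous g) (φ : TestSpace) :
    funDist (fun x => f x + g x) φ = funDist f φ + funDist g φ := by
  simp only [funDist, smul_add]
  exact integral_add (integrableOn_test_smul hf φ) (integrableOn_test_smul hg φ)

theorem funDist_const_mul (c : ℝ) (f : Plane → ℝ) (φ : TestSpace) :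
    funDist (fun x => c * f x) φ = c * funDist f φ := by
  simp only [funDist, smul_eq_mul, ← integral_const_mul]
  congr 1 with x
  ring

theorem re_funDist {f : Plane → ℂ} (hf : Continuous f) (φ : TestSpace) :
    (funDist f φ).re = funDist (fun x => (f x).re) φ := by
  have := integral_re (𝕜 := ℂ) (integrableOn_test_smul hf φ)
  simpa [funDist] using this.symm

theorem im_funDist {f : Plane → ℂ} (hf : Continuous f) (φ : TestSpace) :
    (funDist f φ).im = funDist (fun x => (f x).im) φ := by
  have := integral_im (𝕜 := ℂ) (integrableOn_test_smul hf φ)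
  simpa [funDist] using this.symm

/-- Bounded functions have finite Hölder–Zygmund norms of negative order. -/
theorem HZBound.of_bounded {α M : ℝ} (hα : α ≤ 0) {f : Plane → ℝ} (hf : Continuous f)
    (hp : IsPeriodic f) (hM : ∀ x, |f x| ≤ M) : HZBound α (funDist f) (4 * M) := by
  intro x lam hl φ hφ
  have hM0 : 0 ≤ M := (abs_nonneg _).trans (hM 0)
  rw [funDist_rescale hφ.1 hφ.2.1 hl.1 x hf hp]
  have h1 := norm_avg_le (f := f) (t := lam) (x := x) hφ.1.continuous hφ.2.1
    (fun z _ => (hM (x + lam • z)))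
  have h2 : (∫ z, |φ z|) * M ≤ 4 * M :=
    mul_le_mul_of_nonneg_right (integral_abs_ballTests_le hφ) hM0
  exact h1.trans (h2.trans (le_mul_of_one_le_right (by positivity)
    (Real.one_le_rpow_of_pos_of_le_one_of_nonpos hl.1 hl.2 hα)))

end FunctionalNorms

/-! ### Bounds for the null form and its potential -/

noncomputable section Products

/-- The null form of two potentials. -/
theorem exists_hzBound_jac {κ : ℝ} (h0 : 0 < κ) (h1 : κ < 1 / 2) : ∃ C : ℝ, 0 ≤ C ∧
    ∀ (f g : Plane → ℝ) (A B : ℝ), IsSmooth f → IsPeriodic f → IsSmooth g → IsPeriodic g →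
    HZBound (-1 - κ / 4) (funDist f) A → HZBound (-1 - κ / 4) (funDist g) B →
    HZBound (-κ) (funDist (jac (potential f) (potential g))) (C * A * B) := by
  -- The exponent is forced by `-1 - κ/4 = γ - 2`. The Jacobian then has order `2γ - 2 = -κ/2`,
  -- which is weakened to `-κ` at the end using `λ ≤ 1`.
  obtain ⟨C₁, hC₁, hP⟩ := exists_holderBound_potential (γ := 1 - κ / 4) (by linarith) (by linarith)
  obtain ⟨C₂, hC₂, hJ⟩ := exists_abs_integral_jac_le (β := 1 - κ / 4) (by linarith) (by linarith)
  refine ⟨C₂ * C₁ * C₁, by positivity, fun f g A B hf hfp hg hgp hA hB x lam hl φ hφ => ?_⟩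
  have e : -1 - κ / 4 = 1 - κ / 4 - 2 := by ring
  rw [e] at hA hB
  -- Test functions of order `-κ` have only first derivatives bounded, which is precisely what the
  -- Jacobian estimate uses.
  have hfl : ⌊- -κ + 1⌋₊ = 1 := by
    rw [neg_neg, Nat.floor_eq_iff (by linarith)]
    constructor <;> norm_num <;> linarith
  rw [hfl] at hφ
  have hs := potential_smooth hf hfp
  have hs' := potential_smooth hg hgp
  have := hJ _ _ _ _ hs (potential_periodic hfp) hs' (potential_periodic hgp)
    (hP f A hf hfp hA) (hP g B hg hgp hB) φ hφ lam hl x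
  rw [funDist_rescale hφ.1 hφ.2.1 hl.1 x (jac_smooth hs hs').continuous
    (jac_periodic (potential_periodic hfp) (potential_periodic hgp)), ← integral_rescale_smul _ hl.1]
  simp only [smul_eq_mul]
  have hA0 := hA.nonneg
  have hB0 := hB.nonneg
  calc _ ≤ _ := this
    _ = C₂ * C₁ * C₁ * A * B * lam ^ (2 * (1 - κ / 4) - 2) := by ring
    _ ≤ _ := by
      refine mul_le_mul_of_nonneg_left ?_ (by positivity)
      exact Real.rpow_le_rpow_of_exponent_ge hl.1 hl.2 (by linarith)

/-- Bilinearity: the first argument is changed while the second is `g`, then the second while the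
first is `f'`. Only norms of `f'` and `g` are therefore needed besides those of the differences. -/
theorem exists_hzBound_jac_sub {κ : ℝ} (h0 : 0 < κ) (h1 : κ < 1 / 2) : ∃ C : ℝ, 0 ≤ C ∧
    ∀ (f f' g g' : Plane → ℝ) (A B D E : ℝ), IsSmooth f → IsPeriodic f → IsSmooth f' →
    IsPeriodic f' → IsSmooth g → IsPeriodic g → IsSmooth g' → IsPeriodic g' →
    HZBound (-1 - κ / 4) (funDist f') A → HZBound (-1 - κ / 4) (funDist g) B →
    HZBound (-1 - κ / 4) (funDist fun x => f x - f' x) D →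
    HZBound (-1 - κ / 4) (funDist fun x => g x - g' x) E →
    HZBound (-κ) (funDist fun x => jac (potential f) (potential g) x -
      jac (potential f') (potential g') x) (C * (D * B + E * A)) := by
  obtain ⟨C, hC, h⟩ := exists_hzBound_jac h0 h1
  refine ⟨C, hC, fun f f' g g' A B D E hf hfp hf' hfp' hg hgp hg' hgp' hA hB hD hE => ?_⟩
  have hpf := potential_smooth hf hfp
  have hpf' := potential_smooth hf' hfp'
  have hpg := potential_smooth hg hgp
  have hpg' := potential_smooth hg' hgp'
  have hfs : IsSmooth fun x => f x - f' x := hf.sub hf'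
  have hgs : IsSmooth fun x => g x - g' x := hg.sub hg'
  have hfps : IsPeriodic fun x => f x - f' x := hfp.comp₂ hfp' (fun a b => a - b)
  have hgps : IsPeriodic fun x => g x - g' x := hgp.comp₂ hgp' (fun a b => a - b)
  have e : (fun x => jac (potential f) (potential g) x - jac (potential f') (potential g') x) =
      fun x => jac (potential fun x => f x - f' x) (potential g) x +
        jac (potential f') (potential fun x => g x - g' x) x := by
    funext x
    rw [jac_sub_sub hpf hpf' hpg hpg', potential_sub hf hfp hf' hfp', potential_sub hg hgp hg' hgp']
  have k1 := h _ _ _ _ hfs hfps hg hgp hD hB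
  have k2 := h _ _ _ _ hf' hfp' hgs hgps hA hE
  have k := k1.add k2
  rw [e]
  have e2 : (funDist fun x => jac (potential fun x => f x - f' x) (potential g) x +
        jac (potential f') (potential fun x => g x - g' x) x) = fun φ =>
      funDist (jac (potential fun x => f x - f' x) (potential g)) φ +
        funDist (jac (potential f') (potential fun x => g x - g' x)) φ := by
    funext φ
    exact funDist_add (jac_smooth (potential_smooth hfs hfps) hpg).continuous
      (jac_smooth hpf' (potential_smooth hgs hgps)).continuous φ
  rw [e2]
  exact k.mono (le_of_eq (by ring))

/-- The uniform bound serves to construct `ζ` as a limit, the norm bound to estimate it. -/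
theorem exists_pd_potential_bounds {κ : ℝ} (h0 : 0 < κ) (h1 : κ < 1 / 2) : ∃ C : ℝ, 0 ≤ C ∧
    ∀ (h : Plane → ℝ) (A : ℝ), IsSmooth h → IsPeriodic h → HZBound (-κ) (funDist h) A → ∀ i,
    (∀ x, |pd i (potential h) x| ≤ C * A) ∧
    hzReal (1 - κ) (funDist (pd i (potential h))) ≤ ENNReal.ofReal (C * A) := by
  obtain ⟨C, hC, H⟩ := exists_holderBound_pd_potential (γ := 1 - κ) (by linarith) (by linarith)
  refine ⟨8 * C, by positivity, fun h A hs hp hA i => ?_⟩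
  have hA0 := hA.nonneg
  obtain ⟨k1, k2⟩ := H h A hs hp (by rwa [show 1 - κ - 1 = -κ by ring]) i
  refine ⟨fun x => (k1 x).trans ?_, ?_⟩
  · nlinarith [mul_nonneg hC hA0]
  · have := hzReal_le_of_holderBound (by linarith) ((potential_smooth hs hp).pd i)
      ((potential_periodic hp).pd i) k1 k2
    rwa [mul_assoc]

end Products

/-! ### The regularized objects in terms of potentials -/

noncomputable section RegularizedObjects

theorem convG_ofReal {w : Plane → ℝ} (hw : IsSmooth w) (hp : IsPeriodic w) (x : Plane) :
    convG (fun y => (w y : ℂ)) x =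
      pd 0 (potential w) x - Complex.I * pd 1 (potential w) x := by
  rw [convG_eq hw.ofReal hp.ofReal, ← ofReal_potential hp,
    pderiv_ofReal (potential_smooth hw hp), pderiv_ofReal (potential_smooth hw hp)]

variable {ρ : Plane → ℝ} {ε : ℝ} {w : Fin 3 → TorusDist ℝ}

/-- With `ξ = 2i(∂₁u - i∂₂u)` one has `ξ_a conj ξ_b = 4 (∇u_a · ∇u_b + i J(u_a, u_b))`. The cross
product subtracts the conjugate, so the scalar product of gradients cancels and `8i J` remains. -/
theorem thetaEps_eq (h : ∀ k, IsSmooth (mollify ρ ε (w k)) ∧ IsPeriodic (mollify ρ ε (w k)))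
    (j : Fin 3) (x : Plane) :
    thetaEps ρ ε w j x = ((8 * jac (potential (mollify ρ ε (w (j + 1))))
      (potential (mollify ρ ε (w (j + 2)))) x : ℝ) : ℂ) * Complex.I := by
  have hx : ∀ k, xiEps ρ ε w k x = 2 * Complex.I * (pd 0 (potential (mollify ρ ε (w k))) x -
      Complex.I * pd 1 (potential (mollify ρ ε (w k))) x) := fun k => by
    rw [xiEps, convG_ofReal (h k).1 (h k).2]
  have hc : thetaEps ρ ε w j x = xiEps ρ ε w (j + 1) x * conj (xiEps ρ ε w (j + 2) x) -
      xiEps ρ ε w (j + 2) x * conj (xiEps ρ ε w (j + 1) x) := by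
    fin_cases j <;> simp [thetaEps, cross_apply]
  rw [hc, hx, hx]
  apply Complex.ext <;> simp [jac] <;> ring

theorem convG_mul_I {h : Plane → ℝ} (hs : IsSmooth h) (hp : IsPeriodic h) (x : Plane) :
    convG (fun y => (h y : ℂ) * Complex.I) x =
      pd 1 (potential h) x + Complex.I * pd 0 (potential h) x := by
  have e : convK (fun y => (h y : ℂ) * Complex.I) = fun x => Complex.I * convK (fun y => (h y : ℂ)) x := by
    simp only [mul_comm _ Complex.I]
    exact convK_const_mul hp.ofReal _
  have hd := (convK_smooth hs.ofReal hp.ofReal).differentiable (by simp)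
  rw [convG_eq (hs.ofReal.mul contDiff_const) (hp.ofReal.comp fun z => z * Complex.I), e]
  have k : ∀ i, pderiv i (fun x => Complex.I * convK (fun y => (h y : ℂ)) x) x =
      Complex.I * pd i (potential h) x := fun i => by
    have := pderiv_ofReal (potential_smooth hs hp) i
    rw [ofReal_potential hp] at this
    have h2 := congrFun this x
    simp only [pderiv] at h2 ⊢
    rw [fderiv_const_mul (hd x), _root_.smul_apply, h2, smul_eq_mul]
  rw [k, k]
  linear_combination (-pd 1 (potential h) x : ℂ) * Complex.I_mul_I

theorem greenK_comp_neg (g : Plane → ℂ) : greenK (fun x => g (-x)) = greenK g := by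
  rw [greenK, greenK, ← (Equiv.neg (Fin 2 → ℤ)).tsum_eq]
  congr 1
  refine tsum_congr fun k => ?_
  have : ∫ y in cell, character (-k) y * g (-y) = ∫ y in cell, character k y * g y := by
    rw [← setIntegral_cell_neg fun y => character k y * g y]
    refine setIntegral_congr_fun measurableSet_cell fun y _ => ?_
    simp only [character, Pi.neg_apply, PiLp.neg_apply]
    push_cast
    simp
  simp [this]

/-- This makes explicit the two real test functions required by `IsConvG`. -/
theorem greenG_translate {φ : Plane → ℝ} (hs : IsSmooth φ) (hp : IsPeriodic φ) (y : Plane) :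
    greenG (fun x => (φ (x + y) : ℂ)) =
      ((-potential (pd 0 φ) y : ℝ) : ℂ) + Complex.I * (potential (pd 1 φ) y : ℝ) := by
  have k : ∀ i, greenK (pderiv i fun x => (φ (x + y) : ℂ)) = potential (pd i φ) y := fun i => by
    rw [show (potential (pd i φ) y : ℂ) = convK (fun z => (pd i φ z : ℂ)) y from
      congrFun (ofReal_potential (hp.pd i)) y, convK, ← greenK_comp_neg]
    congr 1
    funext x
    rw [pderiv, fderiv_comp_add_right (f := fun z => (φ z : ℂ)), ← sub_eq_neg_add]
    exact congrFun (pderiv_ofReal hs i) (y - x)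
  rw [greenG, k, k]
  push_cast
  ring

theorem potential_comp_neg (w : Plane → ℝ) (x : Plane) :
    potential (fun y => w (-y)) x = potential w (-x) := by
  rw [potential, potential, convK, convK, ← greenK_comp_neg]
  congr 3 with y
  congr 2
  abel

theorem setIntegral_mul_potential_comm {f g : Plane → ℝ} (hf : IsSmooth f) (hfp : IsPeriodic f)
    (hg : IsSmooth g) (hgp : IsPeriodic g) :
    ∫ y in cell, f y * potential g y = ∫ y in cell, g y * potential f y := by
  have hn : IsPeriodic fun y => f (-y) := fun n x => by
    show f (-(x + latticeVec n)) = f (-x)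
    rw [neg_add, ← latticeVec_neg, hfp]
  have h := setIntegral_mul_potential (H := fun y => f (-y)) (hf.comp contDiff_neg) hn hg hgp 0
  simp only [zero_sub, potential_comp_neg, neg_neg] at h
  rw [← h, ← setIntegral_cell_neg]

theorem setIntegral_mul_pd {φ f : Plane → ℝ} (hφ : IsSmooth φ) (hφp : IsPeriodic φ)
    (hf : IsSmooth f) (hfp : IsPeriodic f) (i : Fin 2) :
    ∫ x in cell, φ x * pd i f x = -∫ x in cell, pd i φ x * f x := by
  have h := setIntegral_cell_fderiv (P := fun x => φ x * f x) (hφp.comp₂ hfp fun a b => a * b)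
    (hφ.mul hf) (stdVec i)
  have e : ∀ x, fderiv ℝ (fun x => φ x * f x) x (stdVec i) =
      φ x * pd i f x + pd i φ x * f x := fun x => pd_mul hφ hf i x
  simp only [e] at h
  rw [integral_add (f := fun x => φ x * pd i f x) (g := fun x => pd i φ x * f x)
    (integrableOn_cell (hφ.continuous.mul (hf.pd i).continuous))
    (integrableOn_cell ((hφ.pd i).continuous.mul hf.continuous))] at h
  linarith

/-- Duality for the derivatives of the potential. -/
theorem funDist_pd_potential {h : Plane → ℝ} (hs : IsSmooth h) (hp : IsPeriodic h)
    {φ : TestSpace} {χ : TestSpace} {i : Fin 2}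
    (hχ : (χ : Plane → ℝ) = potential (pd i (φ : Plane → ℝ))) :
    funDist (pd i (potential h)) φ = -funDist h χ := by
  have hφs := φ.2.1
  have hφp := φ.2.2
  simp only [funDist, hχ, smul_eq_mul]
  rw [setIntegral_mul_pd hφs hφp (potential_smooth hs hp) (potential_periodic hp)]
  rw [setIntegral_mul_potential_comm (hφs.pd i) (hφp.pd i) hs hp]
  simp only [mul_comm]

end RegularizedObjects

end TorusCR

namespace TorusCR

/-! ### Mollification of distributions approximated by smooth functions -/

noncomputable section Mollification

/-- The reflected profile, so that `mollify` tests with its translates and rescalings. -/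
def reflect (ρ : Plane → ℝ) (z : Plane) : ℝ := ρ (-z)

section

variable {ρ : Plane → ℝ} (hρ : IsMollifier ρ)
include hρ

theorem IsMollifier.reflect_smooth : IsSmooth (reflect ρ) := hρ.smooth.comp contDiff_neg

theorem IsMollifier.reflect_compact : HasCompactSupport (reflect ρ) := by
  have : HasCompactSupport ρ := HasCompactSupport.of_support_subset_isCompact
    (isCompact_closedBall (0 : Plane) 1) ((subset_tsupport ρ).trans hρ.supp)
  exact this.comp_homeomorph (Homeomorph.neg Plane)

theorem IsMollifier.integral_abs_reflect : ∫ z, |reflect ρ z| = 1 := by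
  simp only [reflect, abs_of_nonneg (hρ.nonneg _)]
  rw [integral_neg_eq_self ρ volume, hρ.integral_eq]

theorem IsMollifier.integral_reflect : ∫ z, reflect ρ z = 1 := by
  simp only [reflect]
  rw [integral_neg_eq_self ρ volume, hρ.integral_eq]

theorem IsMollifier.norm_le_of_mem_tsupport {z : Plane} (hz : z ∈ tsupport (reflect ρ)) :
    ‖z‖ ≤ 1 := by
  have h : tsupport (reflect ρ) ⊆ Metric.closedBall 0 1 := by
    refine closure_minimal (fun z hz => ?_) Metric.isClosed_closedBall
    have := hρ.supp (subset_tsupport ρ (show -z ∈ Function.support ρ from hz))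
    simpa using this
  simpa using h hz

end

theorem mollify_eq (ρ : Plane → ℝ) (ε : ℝ) (w : TorusDist ℝ) (x : Plane) :
    mollify ρ ε w x = w (periodize (rescale (reflect ρ) ε x)) := by
  rw [mollify]
  congr 2
  funext y
  rw [rescale, reflect, ← smul_neg, neg_sub]

/-- Averages against a probability density do not increase the weak norms. -/
theorem HZBound.avg {α A ε : ℝ} {f ρ : Plane → ℝ} (hρ : IsMollifier ρ) (hf : IsSmooth f)
    (hp : IsPeriodic f) (h : HZBound α (funDist f) A) :
    HZBound α (funDist (avg (reflect ρ) ε f)) A := by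
  intro x lam hl φ hφ
  have hr := hρ.reflect_smooth
  have hrc := hρ.reflect_compact
  rw [funDist_rescale hφ.1 hφ.2.1 hl.1 x (hf.avg hr.continuous hrc hp ε).continuous
    (hp.avg _ _)]
  -- The two averages commute by Fubini, so testing the mollified function is a `ρ`-average of tests
  -- of `f` at shifted base points, each obeying the same bound.
  have e : TorusCR.avg φ lam (TorusCR.avg (reflect ρ) ε f) x =
      TorusCR.avg (reflect ρ) ε (TorusCR.avg φ lam f) x := by
    simp only [TorusCR.avg, ← integral_smul]
    rw [integral_integral_swap_of_hasCompactSupport]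
    · refine integral_congr_ae (ae_of_all _ fun z => integral_congr_ae (ae_of_all _ fun y => ?_))
      simp only [smul_eq_mul, add_right_comm x]
      ring
    · have := hφ.1.continuous
      have := hr.continuous
      have := hf.continuous
      simp only [Function.uncurry_def]
      fun_prop
    · refine HasCompactSupport.of_support_subset_isCompact (hφ.2.1.prod hrc) ?_
      rintro ⟨y, z⟩ hyz
      simp only [Function.mem_support, Function.uncurry_apply_pair, smul_eq_mul, ne_eq,
        mul_eq_zero, not_or] at hyz
      exact ⟨subset_tsupport _ hyz.1, subset_tsupport _ hyz.2.1⟩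
  rw [e]
  refine (norm_avg_le (f := TorusCR.avg φ lam f) hr.continuous hrc fun z _ => ?_).trans
    (le_of_eq (by rw [hρ.integral_abs_reflect, one_mul]))
  have := h (x + ε • z) lam hl φ hφ
  rwa [funDist_rescale hφ.1 hφ.2.1 hl.1 _ hf.continuous hp] at this

theorem avg_sub {Φ f g : Plane → ℝ} (hΦ : Continuous Φ) (hc : HasCompactSupport Φ)
    (hf : Continuous f) (hg : Continuous g) (t : ℝ) (x : Plane) :
    avg Φ t (fun y => f y - g y) x = avg Φ t f x - avg Φ t g x := by
  simp only [avg, smul_sub]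
  exact integral_sub (integrable_avg hΦ hc hf t x) (integrable_avg hΦ hc hg t x)

/-- A sequence of smooth functions converging to a distribution, both weakly and in all the norms of
order slightly less than `-1`. -/
structure Approximates (g : ℕ → Plane → ℝ) (w : TorusDist ℝ) : Prop where
  smooth : ∀ n, IsSmooth (g n)
  periodic : ∀ n, IsPeriodic (g n)
  tendsto : ∀ φ, Tendsto (fun n => funDist (g n) φ) atTop (𝓝 (w φ))
  norm : ∀ κ : ℝ, 0 < κ → κ < 1 / 2 → ∀ δ : ℝ, 0 < δ →
    ∀ᶠ n in atTop, HZBound (-1 - κ / 4) (fun φ => funDist (g n) φ - w φ) δ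

theorem HZBound.sub {α A B : ℝ} {f g : TestSpace → ℝ} (hf : HZBound α f A) (hg : HZBound α g B) :
    HZBound α (fun φ => f φ - g φ) (A + B) := by
  simpa only [sub_eq_add_neg] using hf.add hg.neg

theorem HZBound.of_forall_pos {α A : ℝ} {f : TestSpace → ℝ} (h : ∀ δ > 0, HZBound α f (A + δ)) :
    HZBound α f A := by
  refine HZBound.of_tendsto (l := 𝓝[>] (0 : ℝ)) (F := fun _ => f) (b := fun δ => A + δ)
    (fun φ => tendsto_const_nhds) ?_ (eventually_mem_nhdsWithin.mono fun δ hδ => h δ hδ)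
  have : Tendsto (fun δ : ℝ => A + δ) (𝓝 0) (𝓝 (A + 0)) := (continuous_const.add continuous_id).tendsto 0
  simpa using this.mono_left nhdsWithin_le_nhds

/-- For every admissible `κ` the noise norms test against functions with two bounded derivatives. -/
theorem floor_rough {κ : ℝ} (h0 : 0 < κ) (h1 : κ < 1 / 2) : ⌊-(-1 - κ / 4) + 1⌋₊ = 2 := by
  rw [Nat.floor_eq_iff (by linarith)]
  constructor <;> norm_num <;> linarith

theorem Approximates.sub_bound {g : ℕ → Plane → ℝ} {w : TorusDist ℝ} (h : Approximates g w)
    {α δ η : ℝ} {n m : ℕ} (hn : HZBound α (fun φ => funDist (g n) φ - w φ) δ)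
    (hm : HZBound α (fun φ => funDist (g m) φ - w φ) η) :
    HZBound α (funDist fun x => g n x - g m x) (δ + η) := by
  have e : (funDist fun x => g n x - g m x) = fun φ =>
      (funDist (g n) φ - w φ) - (funDist (g m) φ - w φ) := by
    funext φ
    rw [funDist_sub (h.smooth n).continuous (h.smooth m).continuous]
    ring
  rw [e]
  exact hn.sub hm

/-- Convergence of the pairings, uniformly over sets of test functions with bounded derivatives. -/
theorem Approximates.eventually_abs_sub_le {g : ℕ → Plane → ℝ} {w : TorusDist ℝ}
    (h : Approximates g w) (M : ℝ) {δ : ℝ} (hδ : 0 < δ) : ∀ᶠ n in atTop, ∀ φ : TestSpace,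
    (∀ k ≤ 2, ∀ x, ‖iteratedFDeriv ℝ k (φ : Plane → ℝ) x‖ ≤ M) → |funDist (g n) φ - w φ| ≤ δ := by
  obtain ⟨C, hC, hA⟩ := exists_abs_setIntegral_mul_le 2
  have hpos : 0 < C * |M| + 1 := by positivity
  -- Any `κ` would do. The approximations `g n` and `g m` each contribute half of the error, and `w`
  -- is reached from `g m` by letting `m → ∞`.
  have h2 := h.norm (1 / 4) (by norm_num) (by norm_num) (δ / 2 / (C * |M| + 1)) (by positivity)
  filter_upwards [h2] with n hn φ hφ
  refine le_of_tendsto ((tendsto_const_nhds (x := funDist (g n) φ)).sub (h.tendsto φ)).abs ?_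
  filter_upwards [h2] with m hm
  have hb := h.sub_bound hn hm
  have := hA _ _ M _ (φ : Plane → ℝ) (floor_rough (by norm_num) (by norm_num))
    ((h.smooth n).sub (h.smooth m)).continuous
    ((h.periodic n).comp₂ (h.periodic m) fun a b => a - b) hb φ.2.1 φ.2.2 hφ
  rw [← funDist_sub (h.smooth n).continuous (h.smooth m).continuous]
  have hM : M ≤ |M| := le_abs_self M
  calc _ = |∫ x in cell, (g n x - g m x) * (φ : Plane → ℝ) x| := by
        simp only [funDist, smul_eq_mul, mul_comm]
    _ ≤ _ := this
    _ = (C * M) * (δ / (C * |M| + 1)) := by ring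
    _ ≤ (C * |M| + 1) * (δ / (C * |M| + 1)) := by
        refine mul_le_mul_of_nonneg_right ?_ (by positivity)
        nlinarith [mul_le_mul_of_nonneg_left hM hC]
    _ = δ := by field_simp

theorem periodize_rescale_apply {φ : Plane → ℝ} (hs : IsSmooth φ) (hc : HasCompactSupport φ) {lam : ℝ}
    (hl : lam ≠ 0) (x y : Plane) : (periodize (rescale φ lam x) : Plane → ℝ) y =
      (periodize (rescale φ lam 0) : Plane → ℝ) (y - x) := by
  rw [periodize_apply (rescale_smooth hs lam x) (rescale_compact hc hl x),
    periodize_apply (rescale_smooth hs lam 0) (rescale_compact hc hl 0)]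
  refine finsum_congr fun n => ?_
  simp only [rescale, sub_zero]
  congr 3
  abel

/-- At fixed `ε` the mollification tests `w` with the translates of a single smooth function. These
share their derivative bounds, so the convergence is uniform in `x`. -/
theorem Approximates.eventually_avg_sub_mollify {g : ℕ → Plane → ℝ} {w : TorusDist ℝ}
    (h : Approximates g w) {ρ : Plane → ℝ} (hρ : IsMollifier ρ) {ε : ℝ} (hε : 0 < ε) {δ : ℝ}
    (hδ : 0 < δ) : ∀ᶠ n in atTop, ∀ x,
    |avg (reflect ρ) ε (g n) x - mollify ρ ε w x| ≤ δ := by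
  have hr := hρ.reflect_smooth
  have hrc := hρ.reflect_compact
  obtain ⟨M, -, hM⟩ := IsPeriodic.exists_iteratedFDeriv_bound
    (periodize (rescale (reflect ρ) ε 0)).2.2 (periodize (rescale (reflect ρ) ε 0)).2.1 2
  filter_upwards [h.eventually_abs_sub_le M hδ] with n hn x
  rw [mollify_eq, ← funDist_rescale hr hrc hε x (h.smooth n).continuous (h.periodic n)]
  refine hn _ fun k hk y => ?_
  have e : (periodize (rescale (reflect ρ) ε x) : Plane → ℝ) = fun y =>
      (periodize (rescale (reflect ρ) ε 0) : Plane → ℝ) (y - x) :=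
    funext fun y => periodize_rescale_apply hr hrc hε.ne' x y
  rw [e, iteratedFDeriv_comp_sub]
  exact hM k hk _

theorem abs_funDist_le {F : Type*} [NormedAddCommGroup F] [NormedSpace ℝ F] {f : Plane → F}
    {δ M : ℝ} (hδ : ∀ x, ‖f x‖ ≤ δ) {φ : TestSpace} (hM : ∀ x, ‖(φ : Plane → ℝ) x‖ ≤ M) :
    ‖funDist f φ‖ ≤ M * δ * (2 * Real.pi) ^ 2 := by
  have := norm_setIntegral_le_of_norm_le_const (μ := volume) (s := cell)
    (f := fun x => (φ : Plane → ℝ) x • f x) (C := M * δ) volume_cell_lt_top fun x _ => by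
      rw [norm_smul]
      exact mul_le_mul (hM x) (hδ x) (norm_nonneg _) ((norm_nonneg _).trans (hM x))
  rwa [volume_cell] at this

theorem tendsto_funDist_of_uniform {ι : Type*} {l : Filter ι} {F : ι → Plane → ℝ} {f : Plane → ℝ}
    (hF : ∀ i, Continuous (F i)) (hf : Continuous f)
    (h : ∀ δ : ℝ, 0 < δ → ∀ᶠ i in l, ∀ x, |F i x - f x| ≤ δ) (φ : TestSpace) :
    Tendsto (fun i => funDist (F i) φ) l (𝓝 (funDist f φ)) := by
  obtain ⟨M, hM0, hM⟩ := φ.2.2.exists_bound φ.2.1.continuous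
  rw [Metric.tendsto_nhds]
  intro δ hδ
  have hpos : 0 < M * (2 * Real.pi) ^ 2 + 1 := by positivity
  filter_upwards [h (δ / (M * (2 * Real.pi) ^ 2 + 1)) (by positivity)] with i hi
  rw [dist_eq_norm, ← funDist_sub (hF i) hf]
  refine (abs_funDist_le hi hM).trans_lt ?_
  rw [mul_div_assoc', div_mul_eq_mul_div, div_lt_iff₀ hpos]
  nlinarith

section

variable {g : ℕ → Plane → ℝ} {w : TorusDist ℝ} (h : Approximates g w) {ρ : Plane → ℝ}
  (hρ : IsMollifier ρ) {κ : ℝ} (h0 : 0 < κ) (h1 : κ < 1 / 2)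
include h hρ h0 h1

/-- `HZBound.avg` concerns smooth functions, so it is applied to the approximations, whose averages
converge uniformly to the mollification; the extra `δ` is removed at the end. -/
theorem Approximates.hzBound_mollify {ε : ℝ} (hε : 0 < ε) (hm : Continuous (mollify ρ ε w))
    {A : ℝ} (hA : HZBound (-1 - κ / 4) w A) :
    HZBound (-1 - κ / 4) (funDist (mollify ρ ε w)) A := by
  refine HZBound.of_forall_pos fun δ hδ => ?_
  refine HZBound.of_tendsto (l := atTop) (F := fun n => funDist (avg (reflect ρ) ε (g n)))
    (tendsto_funDist_of_uniform (fun n => ((h.smooth n).avg hρ.reflect_smooth.continuous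
      hρ.reflect_compact (h.periodic n) ε).continuous) hm fun δ hδ =>
      h.eventually_avg_sub_mollify hρ hε hδ) tendsto_const_nhds ?_
  filter_upwards [h.norm κ h0 h1 δ hδ] with n hn
  refine HZBound.avg hρ (h.smooth n) (h.periodic n) ?_
  simpa using hA.add hn

/-- The mollifications converge in norm. -/
theorem Approximates.eventually_hzBound_mollify_sub
    (hm : ∀ ε > 0, Continuous (mollify ρ ε w)) {δ : ℝ} (hδ : 0 < δ) :
    ∀ᶠ ε in 𝓝[>] (0 : ℝ),
      HZBound (-1 - κ / 4) (fun φ => funDist (mollify ρ ε w) φ - w φ) δ := by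
  have hr := hρ.reflect_smooth
  have hrc := hρ.reflect_compact
  -- Three-term splitting through one fixed `g n`: mollification changes the norm of `g n - w` by no
  -- more than a factor one, and `g n` itself is Lipschitz and is moved by `O(ε)`.
  obtain ⟨n, hn⟩ := (h.norm κ h0 h1 (δ / 4) (by positivity)).exists
  obtain ⟨B, hB0, hB⟩ : ∃ B : ℝ, 0 ≤ B ∧ ∀ i x, |pd i (g n) x| ≤ B := by
    obtain ⟨B₀, h₀, hB₀⟩ := ((h.periodic n).pd 0).exists_bound ((h.smooth n).pd 0).continuous
    obtain ⟨B₁, h₁, hB₁⟩ := ((h.periodic n).pd 1).exists_bound ((h.smooth n).pd 1).continuous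
    refine ⟨max B₀ B₁, le_max_of_le_left h₀, fun i x => ?_⟩
    fin_cases i
    · exact (hB₀ x).trans (le_max_left _ _)
    · exact (hB₁ x).trans (le_max_right _ _)
  -- The Lipschitz term `4 * (2 * B * ε)` is to be at most `δ / 4`; `B + 1` avoids a vanishing
  -- denominator.
  have hsmall : ∀ᶠ ε in 𝓝[>] (0 : ℝ), ε < δ / (32 * (B + 1)) :=
    (eventually_lt_nhds (by positivity)).filter_mono nhdsWithin_le_nhds
  filter_upwards [hsmall, eventually_mem_nhdsWithin] with ε hε hε0
  have hε0 : 0 < ε := hε0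
  have ha : ∀ m, Continuous (avg (reflect ρ) ε (g m)) := fun m =>
    ((h.smooth m).avg hr.continuous hrc (h.periodic m) ε).continuous
  have k1 : HZBound (-1 - κ / 4) (fun φ => funDist (mollify ρ ε w) φ -
      funDist (avg (reflect ρ) ε (g n)) φ) (δ / 4 + δ / 4) := by
    refine HZBound.of_tendsto (l := atTop) (F := fun m φ => funDist (avg (reflect ρ) ε (g m)) φ -
      funDist (avg (reflect ρ) ε (g n)) φ) (fun φ => ?_) tendsto_const_nhds ?_
    · exact (tendsto_funDist_of_uniform ha (hm ε hε0) (fun δ hδ =>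
        h.eventually_avg_sub_mollify hρ hε0 hδ) φ).sub_const _
    · filter_upwards [h.norm κ h0 h1 (δ / 4) (by positivity)] with m hm
      have e : (fun φ => funDist (avg (reflect ρ) ε (g m)) φ -
          funDist (avg (reflect ρ) ε (g n)) φ) =
          funDist (avg (reflect ρ) ε fun x => g m x - g n x) := by
        funext φ
        rw [← funDist_sub (ha m) (ha n)]
        congr 1
        funext x
        exact (avg_sub hr.continuous hrc (h.smooth m).continuous (h.smooth n).continuous ε x).symm
      rw [e]
      exact HZBound.avg hρ ((h.smooth m).sub (h.smooth n))
        ((h.periodic m).comp₂ (h.periodic n) fun a b => a - b) (h.sub_bound hm hn)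
  have k2 : HZBound (-1 - κ / 4) (fun φ => funDist (avg (reflect ρ) ε (g n)) φ -
      funDist (g n) φ) (4 * (2 * B * ε)) := by
    have e : (fun φ => funDist (avg (reflect ρ) ε (g n)) φ - funDist (g n) φ) =
        funDist fun x => avg (reflect ρ) ε (g n) x - g n x :=
      funext fun φ => (funDist_sub (ha n) (h.smooth n).continuous φ).symm
    rw [e]
    refine HZBound.of_bounded (by linarith) ((ha n).sub (h.smooth n).continuous)
      (((h.periodic n).avg _ _).comp₂ (h.periodic n) fun a b => a - b) fun x => ?_
    have e2 : avg (reflect ρ) ε (g n) x - g n x =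
        avg (reflect ρ) ε (fun y => g n y - g n x) x := by
      rw [avg_sub hr.continuous hrc (h.smooth n).continuous continuous_const]
      simp [avg, integral_mul_const, hρ.integral_reflect]
    rw [e2]
    refine (norm_avg_le (f := fun y => g n y - g n x) (M := 2 * B * ε) hr.continuous hrc
      fun z hz => ?_).trans (le_of_eq (by rw [hρ.integral_abs_reflect, one_mul]))
    refine (abs_sub_le_of_pd (h.smooth n) hB _ _).trans ?_
    rw [add_sub_cancel_left, norm_smul, Real.norm_of_nonneg hε0.le]
    exact mul_le_mul_of_nonneg_left (mul_le_of_le_one_right hε0.le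
      (hρ.norm_le_of_mem_tsupport hz)) (by positivity)
  have k := (k1.add k2).add hn
  rw [lt_div_iff₀ (by positivity)] at hε
  refine HZBound.mono (A := δ / 4 + δ / 4 + 4 * (2 * B * ε) + δ / 4) ?_ (by nlinarith)
  convert k using 2 with φ
  ring

end

/-- Mollifications of a distribution given by a Fourier series are smooth. -/
theorem mollify_smooth_of_series {w : TorusDist ℝ} {c : (Fin 2 → ℤ) → ℂ} (hc : PolyGrowth c)
    (hw : ∀ φ : TestSpace,
      HasSum (fun k => ∫ y in cell, (φ : Plane → ℝ) y * (c k * character k y).re) (w φ))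
    {ρ : Plane → ℝ} (hρ : IsMollifier ρ) {ε : ℝ} (hε : 0 < ε) :
    IsSmooth (mollify ρ ε w) ∧ IsPeriodic (mollify ρ ε w) := by
  have hr := hρ.reflect_smooth
  have hrc := hρ.reflect_compact
  set S := periodize (rescale (reflect ρ) ε 0) with hS
  -- The coefficients of the mollification are those of `w` times those of one fixed smooth kernel:
  -- polynomial growth against rapid decay.
  have hd := (rapidDecay_fcoef (IsSmooth.ofReal S.2.1) (IsPeriodic.ofReal S.2.2)).mul_poly hc
  have hre : mollify ρ ε w = fun x =>
      (synth (fun k => c k * fcoef k fun y => ((S : Plane → ℝ) y : ℂ)) x).re := by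
    funext x
    rw [mollify_eq]
    refine (hw _).unique ?_
    convert Complex.hasSum_re (hd.hasSum x) using 2 with k
    have hper : IsPeriodic fun y => c k * character k y :=
      (isPeriodic_character k).comp fun z => c k * z
    have hcont : Continuous fun y => c k * character k y :=
      continuous_const.mul (isSmooth_character k).continuous
    have e1 := re_funDist hcont (periodize (rescale (reflect ρ) ε x))
    have e2 : fcoef k (fun y => ((S : Plane → ℝ) y : ℂ)) = funDist (character k) S := by
      simp only [fcoef, funDist, Complex.real_smul, mul_comm]
    have e3 : funDist (fun y => c k * character k y) (periodize (rescale (reflect ρ) ε x)) =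
        c k * fcoef k (fun y => ((S : Plane → ℝ) y : ℂ)) * character k x := by
      rw [e2, funDist_rescale hr hrc hε x hcont hper, hS, funDist_rescale hr hrc hε 0
        (isSmooth_character k).continuous (isPeriodic_character k), avg, avg,
        ← integral_const_mul, ← integral_mul_const]
      congr 1 with z
      rw [character_add, zero_add, Complex.real_smul, Complex.real_smul]
      ring
    rw [← e3, e1]
    simp only [funDist, smul_eq_mul]
  rw [hre]
  exact ⟨Complex.reCLM.contDiff.comp hd.isSmooth_synth, (isPeriodic_synth _).comp Complex.re⟩

end Mollification

end TorusCR

namespace TorusCR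

/-! ### Removal of the regularization -/

noncomputable section Limits

theorem funDist_test_add {F : Type*} [NormedAddCommGroup F] [NormedSpace ℝ F] {f : Plane → F}
    (hf : Continuous f) (φ ψ : TestSpace) : funDist f (φ + ψ) = funDist f φ + funDist f ψ := by
  simp only [funDist, Submodule.coe_add, Pi.add_apply, add_smul]
  exact integral_add (integrableOn_test_smul hf φ) (integrableOn_test_smul hf ψ)

theorem funDist_test_smul {F : Type*} [NormedAddCommGroup F] [NormedSpace ℝ F] (f : Plane → F)
    (c : ℝ) (φ : TestSpace) : funDist f (c • φ) = c • funDist f φ := by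
  simp only [funDist, Submodule.coe_smul, Pi.smul_apply, smul_eq_mul, mul_smul]
  exact integral_smul c _

/-- A Cauchy family of functions has a limit in the space of distributions. -/
theorem exists_torusDist_tendsto {J : ℝ → Plane → ℂ} (hJ : ∀ ε > 0, Continuous (J ε))
    (hp : ∀ ε > 0, IsPeriodic (J ε)) (N : ℕ)
    (h : ∀ δ : ℝ, 0 < δ → ∃ ε₀ > 0, ∀ ε ∈ Ioo 0 ε₀, ∀ ε' ∈ Ioo 0 ε₀, ∀ (φ : TestSpace) (M : ℝ),
      (∀ k ≤ N, ∀ x, ‖iteratedFDeriv ℝ k (φ : Plane → ℝ) x‖ ≤ M) →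
      ‖funDist (J ε) φ - funDist (J ε') φ‖ ≤ δ * M) :
    ∃ Θ : TorusDist ℂ, ∀ φ, Tendsto (fun ε => funDist (J ε) φ) (𝓝[>] (0 : ℝ)) (𝓝 (Θ φ)) := by
  have hlim : ∀ φ, ∃ z, Tendsto (fun ε => funDist (J ε) φ) (𝓝[>] (0 : ℝ)) (𝓝 z) := by
    intro φ
    obtain ⟨M, hM0, hM⟩ := φ.2.2.exists_iteratedFDeriv_bound φ.2.1 N
    refine cauchy_map_iff_exists_tendsto.1 (Metric.cauchy_iff.2 ⟨inferInstance, fun δ hδ => ?_⟩)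
    obtain ⟨ε₀, hε₀, hc⟩ := h (δ / 2 / (M + 1)) (by positivity)
    refine ⟨_, image_mem_map (Ioo_mem_nhdsGT hε₀), ?_⟩
    rintro _ ⟨ε, hε, rfl⟩ _ ⟨ε', hε', rfl⟩
    rw [dist_eq_norm]
    refine (hc ε hε ε' hε' φ M hM).trans_lt ?_
    rw [div_mul_eq_mul_div, div_lt_iff₀ (by positivity)]
    nlinarith
  choose Θ hΘ using hlim
  have hpos : ∀ᶠ ε in 𝓝[>] (0 : ℝ), 0 < ε := eventually_mem_nhdsWithin
  refine ⟨⟨⟨⟨Θ, fun φ ψ => ?_⟩, fun c φ => ?_⟩, ?_⟩, hΘ⟩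
  · refine tendsto_nhds_unique ((hΘ (φ + ψ)).congr' ?_) ((hΘ φ).add (hΘ ψ))
    filter_upwards [hpos] with ε hε using funDist_test_add (hJ ε hε) φ ψ
  · exact tendsto_nhds_unique ((hΘ (c • φ)).congr fun ε => funDist_test_smul _ c φ)
      ((hΘ φ).const_smul c)
  -- Continuity of the limit: it lies within distance `M` of the fixed continuous function `J (ε₀ /
  -- 2)`, whose pairing is bounded by its supremum.
  · obtain ⟨ε₀, hε₀, hc⟩ := h 1 one_pos
    obtain ⟨B, hB0, hB⟩ := (hp (ε₀ / 2) (by positivity)).exists_bound (hJ _ (by positivity))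
    refine ⟨N, B * (2 * Real.pi) ^ 2 + 1, fun φ M hM => ?_⟩
    refine le_of_tendsto (hΘ φ).norm ?_
    filter_upwards [Ioo_mem_nhdsGT hε₀] with ε hε
    have h1 := hc ε hε (ε₀ / 2) ⟨by positivity, by linarith⟩ φ M hM
    have h2 := abs_funDist_le hB (φ := φ) (M := M) fun x => by
      simpa using hM 0 (Nat.zero_le _) x
    have h3 := norm_sub_norm_le (funDist (J ε) φ) (funDist (J (ε₀ / 2)) φ)
    linarith

theorem hzReal_const_mul (α c : ℝ) (f : TestSpace → ℝ) :
    hzReal α (fun φ => c * f φ) = ENNReal.ofReal |c| * hzReal α f := by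
  simp only [hzReal, abs_mul, mul_div_assoc, ENNReal.ofReal_mul (abs_nonneg c), ENNReal.mul_iSup,
    mul_add, mul_ite]

theorem HZBound.const_mul {α A : ℝ} {f : TestSpace → ℝ} (c : ℝ) (h : HZBound α f A) :
    HZBound α (fun φ => c * f φ) (|c| * A) := fun x lam hl φ hφ => by
  rw [abs_mul, mul_assoc]
  exact mul_le_mul_of_nonneg_left (h x lam hl φ hφ) (abs_nonneg c)

theorem Approximates.exists_hzBound {g : ℕ → Plane → ℝ} {w : TorusDist ℝ} (h : Approximates g w)
    {κ : ℝ} (h0 : 0 < κ) (h1 : κ < 1 / 2) : ∃ A, HZBound (-1 - κ / 4) w A := by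
  obtain ⟨n, hn⟩ := (h.norm κ h0 h1 1 one_pos).exists
  obtain ⟨M, -, hM⟩ := (h.periodic n).exists_bound (h.smooth n).continuous
  have := (HZBound.of_bounded (α := -1 - κ / 4) (by linarith) (h.smooth n).continuous
    (h.periodic n) hM).sub hn
  exact ⟨_, by simpa using this⟩

/-- A functional of finite norm has its norm as the optimal bound. -/
theorem HZBound.toReal {α A : ℝ} (hα : α < 0) {f : TestSpace → ℝ} (h : HZBound α f A) :
    HZBound α f (hzReal α f).toReal ∧ hzReal α f = ENNReal.ofReal (hzReal α f).toReal ∧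
      (hzReal α f).toReal ≤ A := by
  have h1 := (hzReal_le_iff hα h.nonneg).2 h
  have h2 : hzReal α f ≠ ⊤ := ne_top_of_le_ne_top ENNReal.ofReal_ne_top h1
  have h3 := (ENNReal.ofReal_toReal h2).symm
  exact ⟨(hzReal_le_iff hα ENNReal.toReal_nonneg).1 h3.le, h3, ENNReal.toReal_le_of_le_ofReal h.nonneg h1⟩

/-- The distributions to which the deterministic theory applies. -/
structure Admissible (ρ : Plane → ℝ) (w : Fin 3 → TorusDist ℝ) : Prop where
  mollifier : IsMollifier ρ
  approx : ∀ j, ∃ g, Approximates g (w j)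
  smooth : ∀ j, ∀ ε > 0, IsSmooth (mollify ρ ε (w j)) ∧ IsPeriodic (mollify ρ ε (w j))

/-- The real function `h` with `θ^ε_j = i h`. -/
def nullForm (ρ : Plane → ℝ) (ε : ℝ) (w : Fin 3 → TorusDist ℝ) (j : Fin 3) (x : Plane) : ℝ :=
  8 * jac (potential (mollify ρ ε (w (j + 1)))) (potential (mollify ρ ε (w (j + 2)))) x

variable {ρ : Plane → ℝ} {w : Fin 3 → TorusDist ℝ}

theorem Admissible.nullForm_smooth (H : Admissible ρ w) {ε : ℝ} (hε : 0 < ε) (j : Fin 3) :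
    IsSmooth (nullForm ρ ε w j) :=
  contDiff_const.mul (jac_smooth (potential_smooth (H.smooth _ ε hε).1 (H.smooth _ ε hε).2)
    (potential_smooth (H.smooth _ ε hε).1 (H.smooth _ ε hε).2))

theorem Admissible.nullForm_periodic (H : Admissible ρ w) {ε : ℝ} (hε : 0 < ε) (j : Fin 3) :
    IsPeriodic (nullForm ρ ε w j) :=
  (jac_periodic (potential_periodic (H.smooth _ ε hε).2)
    (potential_periodic (H.smooth _ ε hε).2)).comp fun a => 8 * a

theorem Admissible.thetaEps_eq (H : Admissible ρ w) {ε : ℝ} (hε : 0 < ε) (j : Fin 3) :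
    thetaEps ρ ε w j = fun x => (nullForm ρ ε w j x : ℂ) * Complex.I :=
  funext fun x => TorusCR.thetaEps_eq (fun k => H.smooth k ε hε) j x

theorem Admissible.zetaEps_eq (H : Admissible ρ w) {ε : ℝ} (hε : 0 < ε) (j : Fin 3) :
    zetaEps ρ ε w j = fun x => ((2 * pd 1 (potential (nullForm ρ ε w j)) x : ℝ) : ℂ) +
      Complex.I * ((2 * pd 0 (potential (nullForm ρ ε w j)) x : ℝ) : ℂ) := by
  funext x
  rw [zetaEps, H.thetaEps_eq hε, convG_mul_I (H.nullForm_smooth hε j) (H.nullForm_periodic hε j)]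
  push_cast
  ring

theorem Admissible.thetaEps_smooth (H : Admissible ρ w) {ε : ℝ} (hε : 0 < ε) (j : Fin 3) :
    IsSmooth (thetaEps ρ ε w j) := by
  rw [H.thetaEps_eq hε]
  exact (H.nullForm_smooth hε j).ofReal.mul contDiff_const

theorem Admissible.thetaEps_periodic (H : Admissible ρ w) {ε : ℝ} (hε : 0 < ε) (j : Fin 3) :
    IsPeriodic (thetaEps ρ ε w j) := by
  rw [H.thetaEps_eq hε]
  exact (H.nullForm_periodic hε j).comp fun a => (a : ℂ) * Complex.I

theorem Admissible.pd_potential_smooth (H : Admissible ρ w) {ε : ℝ} (hε : 0 < ε) (j : Fin 3)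
    (i : Fin 2) : IsSmooth (pd i (potential (nullForm ρ ε w j))) :=
  (potential_smooth (H.nullForm_smooth hε j) (H.nullForm_periodic hε j)).pd i

theorem Admissible.pd_potential_periodic (H : Admissible ρ w) {ε : ℝ} (hε : 0 < ε) (j : Fin 3)
    (i : Fin 2) : IsPeriodic (pd i (potential (nullForm ρ ε w j))) :=
  (potential_periodic (H.nullForm_periodic hε j)).pd i

theorem Admissible.zetaEps_smooth (H : Admissible ρ w) {ε : ℝ} (hε : 0 < ε) (j : Fin 3) :
    IsSmooth (zetaEps ρ ε w j) := by
  rw [H.zetaEps_eq hε]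
  have h := fun i => IsSmooth.ofReal (contDiff_const.mul (H.pd_potential_smooth hε j i) :
    IsSmooth fun x => (2 : ℝ) * pd i (potential (nullForm ρ ε w j)) x)
  exact (h 1).add (contDiff_const.mul (h 0))

theorem Admissible.zetaEps_periodic (H : Admissible ρ w) {ε : ℝ} (hε : 0 < ε) (j : Fin 3) :
    IsPeriodic (zetaEps ρ ε w j) := by
  rw [H.zetaEps_eq hε]
  exact (H.pd_potential_periodic hε j 1).comp₂ (H.pd_potential_periodic hε j 0)
    fun a b => ((2 * a : ℝ) : ℂ) + Complex.I * ((2 * b : ℝ) : ℂ)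

theorem Admissible.re_funDist_thetaEps (H : Admissible ρ w) {ε : ℝ} (hε : 0 < ε) (j : Fin 3)
    (φ : TestSpace) : (funDist (thetaEps ρ ε w j) φ).re = 0 := by
  rw [re_funDist (H.thetaEps_smooth hε j).continuous, H.thetaEps_eq hε]
  simp [funDist]

theorem Admissible.im_funDist_thetaEps (H : Admissible ρ w) {ε : ℝ} (hε : 0 < ε) (j : Fin 3)
    (φ : TestSpace) : (funDist (thetaEps ρ ε w j) φ).im = funDist (nullForm ρ ε w j) φ := by
  rw [im_funDist (H.thetaEps_smooth hε j).continuous, H.thetaEps_eq hε]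
  simp [funDist]

theorem Admissible.re_funDist_zetaEps (H : Admissible ρ w) {ε : ℝ} (hε : 0 < ε) (j : Fin 3)
    (φ : TestSpace) : (funDist (zetaEps ρ ε w j) φ).re =
      2 * funDist (pd 1 (potential (nullForm ρ ε w j))) φ := by
  rw [re_funDist (H.zetaEps_smooth hε j).continuous, H.zetaEps_eq hε, ← funDist_const_mul]
  simp

theorem Admissible.im_funDist_zetaEps (H : Admissible ρ w) {ε : ℝ} (hε : 0 < ε) (j : Fin 3)
    (φ : TestSpace) : (funDist (zetaEps ρ ε w j) φ).im =
      2 * funDist (pd 0 (potential (nullForm ρ ε w j))) φ := by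
  rw [im_funDist (H.zetaEps_smooth hε j).continuous, H.zetaEps_eq hε, ← funDist_const_mul]
  simp

/-- The norm of the noise. -/
def noiseNorm (κ : ℝ) (w : TorusDist ℝ) : ℝ := (hzReal (-1 - κ / 4) w).toReal

/-- The distance between the noise and its mollification. -/
def mollifyDist (ρ : Plane → ℝ) (κ ε : ℝ) (w : TorusDist ℝ) : ℝ :=
  (hzReal (-1 - κ / 4) fun φ => funDist (mollify ρ ε w) φ - w φ).toReal

section

variable {κ : ℝ} (h0 : 0 < κ) (h1 : κ < 1 / 2)
include h0 h1

theorem Admissible.hzBound_noise (H : Admissible ρ w) (j : Fin 3) :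
    HZBound (-1 - κ / 4) (w j) (noiseNorm κ (w j)) ∧
      hzReal (-1 - κ / 4) (w j) = ENNReal.ofReal (noiseNorm κ (w j)) := by
  obtain ⟨g, hg⟩ := H.approx j
  obtain ⟨A, hA⟩ := hg.exists_hzBound h0 h1
  obtain ⟨k1, k2, -⟩ := hA.toReal (by linarith)
  exact ⟨k1, k2⟩

theorem Admissible.hzBound_mollify (H : Admissible ρ w) (j : Fin 3) {ε : ℝ} (hε : 0 < ε) :
    HZBound (-1 - κ / 4) (funDist (mollify ρ ε (w j))) (noiseNorm κ (w j)) := by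
  obtain ⟨g, hg⟩ := H.approx j
  exact hg.hzBound_mollify H.mollifier h0 h1 hε (H.smooth j ε hε).1.continuous
    (H.hzBound_noise h0 h1 j).1

theorem Admissible.hzBound_mollifyDist (H : Admissible ρ w) (j : Fin 3) {ε : ℝ} (hε : 0 < ε) :
    HZBound (-1 - κ / 4) (fun φ => funDist (mollify ρ ε (w j)) φ - w j φ)
      (mollifyDist ρ κ ε (w j)) ∧
    hzReal (-1 - κ / 4) (fun φ => funDist (mollify ρ ε (w j)) φ - w j φ) =
      ENNReal.ofReal (mollifyDist ρ κ ε (w j)) := by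
  obtain ⟨k1, k2, -⟩ := ((H.hzBound_mollify h0 h1 j hε).sub (H.hzBound_noise h0 h1 j).1).toReal
    (by linarith)
  exact ⟨k1, k2⟩

theorem Admissible.tendsto_mollifyDist (H : Admissible ρ w) (j : Fin 3) :
    Tendsto (fun ε => mollifyDist ρ κ ε (w j)) (𝓝[>] 0) (𝓝 0) := by
  obtain ⟨g, hg⟩ := H.approx j
  rw [Metric.tendsto_nhds]
  intro δ hδ
  filter_upwards [hg.eventually_hzBound_mollify_sub H.mollifier h0 h1
    (fun ε hε => (H.smooth j ε hε).1.continuous) (half_pos hδ)] with ε hε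
  have : mollifyDist ρ κ ε (w j) ≤ δ / 2 := (hε.toReal (by linarith)).2.2
  rw [Real.dist_0_eq_abs, abs_of_nonneg (show 0 ≤ mollifyDist ρ κ ε (w j) from
    ENNReal.toReal_nonneg)]
  linarith

end

/-- The bound for the difference of two regularizations. -/
def pairBound (κ : ℝ) (w : Fin 3 → TorusDist ℝ) (d : Fin 3 → ℝ) (j : Fin 3) : ℝ :=
  d (j + 1) * noiseNorm κ (w (j + 2)) + d (j + 2) * noiseNorm κ (w (j + 1))

/-- Uniformity in `ε` holds because mollification does not increase the noise norms, and the
differences between two regularizations are compared through the unregularized noise. Hence the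
constant depends on neither `ρ` nor `w`. -/
theorem exists_nullForm_bounds {κ : ℝ} (h0 : 0 < κ) (h1 : κ < 1 / 2) : ∃ C : ℝ, 0 ≤ C ∧
    ∀ (ρ : Plane → ℝ) (w : Fin 3 → TorusDist ℝ), Admissible ρ w → ∀ j, ∀ ε > 0,
    HZBound (-κ) (funDist (nullForm ρ ε w j))
      (C * (noiseNorm κ (w (j + 1)) * noiseNorm κ (w (j + 2)))) ∧
    ∀ ε' > 0, HZBound (-κ) (funDist fun x => nullForm ρ ε w j x - nullForm ρ ε' w j x)
      (C * pairBound κ w (fun k => mollifyDist ρ κ ε (w k) + mollifyDist ρ κ ε' (w k)) j) := by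
  obtain ⟨C₁, hC₁, k1⟩ := exists_hzBound_jac h0 h1
  obtain ⟨C₂, hC₂, k2⟩ := exists_hzBound_jac_sub h0 h1
  refine ⟨8 * max C₁ C₂, by positivity, fun ρ w H j ε hε => ?_⟩
  have hn : ∀ k, 0 ≤ noiseNorm κ (w k) := fun k => ENNReal.toReal_nonneg
  have hd : ∀ ε k, 0 ≤ mollifyDist ρ κ ε (w k) := fun ε k => ENNReal.toReal_nonneg
  constructor
  · have := (k1 _ _ _ _ (H.smooth (j + 1) ε hε).1 (H.smooth (j + 1) ε hε).2
      (H.smooth (j + 2) ε hε).1 (H.smooth (j + 2) ε hε).2 (H.hzBound_mollify h0 h1 (j + 1) hε)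
      (H.hzBound_mollify h0 h1 (j + 2) hε)).const_mul 8
    have e : funDist (nullForm ρ ε w j) = fun φ => 8 * funDist
      (jac (potential (mollify ρ ε (w (j + 1)))) (potential (mollify ρ ε (w (j + 2))))) φ :=
      funext fun φ => funDist_const_mul _ _ φ
    rw [e]
    refine this.mono ?_
    rw [abs_of_pos (by norm_num : (0 : ℝ) < 8), mul_assoc C₁, mul_assoc 8 (max C₁ C₂)]
    refine mul_le_mul_of_nonneg_left (mul_le_mul_of_nonneg_right (le_max_left _ _) ?_) (by norm_num)
    exact mul_nonneg (hn _) (hn _)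
  · intro ε' hε'
    have hD : ∀ k, HZBound (-1 - κ / 4)
        (funDist fun x => mollify ρ ε (w k) x - mollify ρ ε' (w k) x)
        (mollifyDist ρ κ ε (w k) + mollifyDist ρ κ ε' (w k)) := fun k => by
      convert (H.hzBound_mollifyDist h0 h1 k hε).1.sub (H.hzBound_mollifyDist h0 h1 k hε').1 using 2
        with φ
      rw [funDist_sub (H.smooth k ε hε).1.continuous (H.smooth k ε' hε').1.continuous]
      ring
    have := (k2 _ _ _ _ _ _ _ _ (H.smooth (j + 1) ε hε).1 (H.smooth (j + 1) ε hε).2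
      (H.smooth (j + 1) ε' hε').1 (H.smooth (j + 1) ε' hε').2
      (H.smooth (j + 2) ε hε).1 (H.smooth (j + 2) ε hε).2
      (H.smooth (j + 2) ε' hε').1 (H.smooth (j + 2) ε' hε').2
      (H.hzBound_mollify h0 h1 (j + 1) hε') (H.hzBound_mollify h0 h1 (j + 2) hε)
      (hD (j + 1)) (hD (j + 2))).const_mul 8
    have e : (funDist fun x => nullForm ρ ε w j x - nullForm ρ ε' w j x) = fun φ => 8 * funDist
      (fun x => jac (potential (mollify ρ ε (w (j + 1)))) (potential (mollify ρ ε (w (j + 2)))) x -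
        jac (potential (mollify ρ ε' (w (j + 1)))) (potential (mollify ρ ε' (w (j + 2)))) x) φ := by
      funext φ
      rw [← funDist_const_mul]
      simp only [nullForm, mul_sub]
    rw [e]
    refine this.mono ?_
    rw [abs_of_pos (by norm_num : (0 : ℝ) < 8), mul_assoc 8, pairBound]
    refine mul_le_mul_of_nonneg_left (mul_le_mul_of_nonneg_right (le_max_right _ _) ?_)
      (by norm_num)
    have := hn (j + 1)
    have := hn (j + 2)
    have := hd ε (j + 1)
    have := hd ε (j + 2)
    have := hd ε' (j + 1)
    have := hd ε' (j + 2)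
    positivity

/-- Used in two ways: with `d = 0` for the Cauchy property, and with `d` the distance at a fixed `ε`
to let the second regularization parameter tend to zero. -/
theorem Admissible.tendsto_pairBound (H : Admissible ρ w) {κ : ℝ} (h0 : 0 < κ) (h1 : κ < 1 / 2)
    (d : Fin 3 → ℝ) (C : ℝ) (j : Fin 3) : Tendsto (fun ε =>
      C * pairBound κ w (fun k => d k + mollifyDist ρ κ ε (w k)) j) (𝓝[>] 0)
      (𝓝 (C * pairBound κ w d j)) := by
  have h := fun k => (H.tendsto_mollifyDist h0 h1 k).const_add (d k)
  simp only [add_zero] at h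
  exact (((h _).mul_const _).add ((h _).mul_const _)).const_mul _

/-- The regularized null forms are Cauchy. -/
theorem Admissible.exists_pairBound_le (H : Admissible ρ w) {κ : ℝ} (h0 : 0 < κ) (h1 : κ < 1 / 2)
    (C : ℝ) (j : Fin 3) {δ : ℝ} (hδ : 0 < δ) : ∃ ε₀ > 0, ∀ ε ∈ Ioo 0 ε₀, ∀ ε' ∈ Ioo 0 ε₀,
    C * pairBound κ w (fun k => mollifyDist ρ κ ε (w k) + mollifyDist ρ κ ε' (w k)) j ≤ δ := by
  have h := H.tendsto_pairBound h0 h1 (fun _ => 0) C j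
  have h' := (h.eventually_le_const (u := δ / 2) (by simpa [pairBound] using half_pos hδ))
  obtain ⟨ε₀, hε₀, hs⟩ := mem_nhdsGT_iff_exists_Ioo_subset.1 h'
  refine ⟨ε₀, hε₀, fun ε hε ε' hε' => ?_⟩
  have k1 : C * pairBound κ w (fun k => 0 + mollifyDist ρ κ ε (w k)) j ≤ δ / 2 := hs hε
  have k2 : C * pairBound κ w (fun k => 0 + mollifyDist ρ κ ε' (w k)) j ≤ δ / 2 := hs hε'
  simp only [pairBound] at k1 k2 ⊢
  linarith

theorem Admissible.pd_potential_sub (H : Admissible ρ w) {ε ε' : ℝ} (hε : 0 < ε) (hε' : 0 < ε')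
    (j : Fin 3) (i : Fin 2) :
    pd i (potential fun x => nullForm ρ ε w j x - nullForm ρ ε' w j x) = fun x =>
      pd i (potential (nullForm ρ ε w j)) x - pd i (potential (nullForm ρ ε' w j)) x := by
  funext x
  rw [potential_sub (H.nullForm_smooth hε j) (H.nullForm_periodic hε j)
    (H.nullForm_smooth hε' j) (H.nullForm_periodic hε' j), pd_sub
    (potential_smooth (H.nullForm_smooth hε j) (H.nullForm_periodic hε j))
    (potential_smooth (H.nullForm_smooth hε' j) (H.nullForm_periodic hε' j))]

/-- The exponent `κ = 1/4` is an arbitrary admissible choice, made once because the limit must not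
depend on `κ`. The weak norm controls pairings by one derivative of the test function, so the limit
has order one. -/
theorem Admissible.exists_theta (H : Admissible ρ w) (j : Fin 3) : ∃ θ : TorusDist ℂ,
    ∀ φ, Tendsto (fun ε => funDist (thetaEps ρ ε w j) φ) (𝓝[>] (0 : ℝ)) (𝓝 (θ φ)) := by
  have hκ : (0 : ℝ) < 1 / 4 := by norm_num
  have hκ' : (1 / 4 : ℝ) < 1 / 2 := by norm_num
  obtain ⟨C, hC, hb⟩ := exists_nullForm_bounds hκ hκ'
  obtain ⟨C', hC', hA⟩ := exists_abs_setIntegral_mul_le 1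
  refine exists_torusDist_tendsto (fun ε hε => (H.thetaEps_smooth hε j).continuous)
    (fun ε hε => H.thetaEps_periodic hε j) 1 fun δ hδ => ?_
  obtain ⟨ε₀, hε₀, hε⟩ := H.exists_pairBound_le hκ hκ' (C' * C) j hδ
  refine ⟨ε₀, hε₀, fun ε he ε' he' φ M hM => ?_⟩
  have hM0 : 0 ≤ M := (norm_nonneg _).trans (hM 0 (Nat.zero_le _) 0)
  have hcs := (H.nullForm_smooth he.1 j).continuous
  have hcs' := (H.nullForm_smooth he'.1 j).continuous
  have k := hA (-(1 / 4)) _ M _ (φ : Plane → ℝ) (by norm_num) (hcs.sub hcs')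
    ((H.nullForm_periodic he.1 j).comp₂ (H.nullForm_periodic he'.1 j) fun a b => a - b)
    ((hb ρ w H j ε he.1).2 ε' he'.1) φ.2.1 φ.2.2 hM
  have e : funDist (thetaEps ρ ε w j) φ - funDist (thetaEps ρ ε' w j) φ =
      ((∫ x in cell, (nullForm ρ ε w j x - nullForm ρ ε' w j x) * (φ : Plane → ℝ) x : ℝ) : ℂ) *
        Complex.I := by
    have e' : ∫ x in cell, (nullForm ρ ε w j x - nullForm ρ ε' w j x) * (φ : Plane → ℝ) x =
        funDist (nullForm ρ ε w j) φ - funDist (nullForm ρ ε' w j) φ := by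
      rw [← funDist_sub hcs hcs']
      simp only [funDist, smul_eq_mul, mul_comm]
    rw [e']
    apply Complex.ext <;>
    simp [H.re_funDist_thetaEps he.1, H.re_funDist_thetaEps he'.1, H.im_funDist_thetaEps he.1,
      H.im_funDist_thetaEps he'.1]
  rw [e, norm_mul, Complex.norm_I, mul_one, Complex.norm_real]
  refine k.trans (mul_le_mul_of_nonneg_right ?_ hM0)
  rw [← mul_assoc]
  exact hε ε he ε' he'

/-- Here the gradients of the potentials converge uniformly, so no derivative of the test function
is needed. -/
theorem Admissible.exists_zeta (H : Admissible ρ w) (j : Fin 3) : ∃ ζ : TorusDist ℂ,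
    ∀ φ, Tendsto (fun ε => funDist (zetaEps ρ ε w j) φ) (𝓝[>] (0 : ℝ)) (𝓝 (ζ φ)) := by
  have hκ : (0 : ℝ) < 1 / 4 := by norm_num
  have hκ' : (1 / 4 : ℝ) < 1 / 2 := by norm_num
  obtain ⟨C, hC, hb⟩ := exists_nullForm_bounds hκ hκ'
  obtain ⟨C', hC', hA⟩ := exists_pd_potential_bounds hκ hκ'
  refine exists_torusDist_tendsto (fun ε hε => (H.zetaEps_smooth hε j).continuous)
    (fun ε hε => H.zetaEps_periodic hε j) 0 fun δ hδ => ?_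
  obtain ⟨ε₀, hε₀, hε⟩ := H.exists_pairBound_le hκ hκ' (4 * (2 * Real.pi) ^ 2 * C' * C) j hδ
  refine ⟨ε₀, hε₀, fun ε he ε' he' φ M hM => ?_⟩
  have hM0 : 0 ≤ M := (norm_nonneg _).trans (hM 0 le_rfl 0)
  have k := fun i => (hA _ _ ((H.nullForm_smooth he.1 j).sub (H.nullForm_smooth he'.1 j))
    ((H.nullForm_periodic he.1 j).comp₂ (H.nullForm_periodic he'.1 j) fun a b => a - b)
    ((hb ρ w H j ε he.1).2 ε' he'.1) i).1
  rw [← funDist_sub (H.zetaEps_smooth he.1 j).continuous (H.zetaEps_smooth he'.1 j).continuous]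
  set B := C' * (C * pairBound (1 / 4) w (fun k => mollifyDist ρ (1 / 4) ε (w k) +
    mollifyDist ρ (1 / 4) ε' (w k)) j) with hB
  have hsup : ∀ x, ‖zetaEps ρ ε w j x - zetaEps ρ ε' w j x‖ ≤ 4 * B := by
    intro x
    have e : zetaEps ρ ε w j x - zetaEps ρ ε' w j x =
        ((2 * pd 1 (potential fun x => nullForm ρ ε w j x - nullForm ρ ε' w j x) x : ℝ) : ℂ) +
        Complex.I * ((2 * pd 0 (potential fun x =>
          nullForm ρ ε w j x - nullForm ρ ε' w j x) x : ℝ) : ℂ) := by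
      rw [H.pd_potential_sub he.1 he'.1, H.pd_potential_sub he.1 he'.1, H.zetaEps_eq he.1,
        H.zetaEps_eq he'.1]
      push_cast
      ring
    rw [e]
    refine (norm_add_le _ _).trans ?_
    rw [norm_mul, Complex.norm_I, one_mul, Complex.norm_real, Complex.norm_real, norm_mul, norm_mul,
      Real.norm_of_nonneg zero_le_two, Real.norm_eq_abs, Real.norm_eq_abs]
    have := k 0 x
    have := k 1 x
    linarith
  have k2 := abs_funDist_le hsup (φ := φ) (M := M) fun x => by simpa using hM 0 le_rfl x
  refine k2.trans ?_
  calc _ = (4 * (2 * Real.pi) ^ 2 * B) * M := by ring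
    _ ≤ δ * M := by
      refine mul_le_mul_of_nonneg_right ?_ hM0
      have := hε ε he ε' he'
      rw [hB]
      linarith

/-- Half of a distribution. -/
def TorusDist.half (f : TorusDist ℂ) : TorusDist ℂ where
  toLin := (1 / 2 : ℝ) • f.toLin
  cont := by
    obtain ⟨N, C, h⟩ := f.cont
    refine ⟨N, 1 / 2 * C, fun φ M hM => ?_⟩
    have := h φ M hM
    rw [LinearMap.smul_apply, norm_smul, mul_assoc]
    norm_num
    linarith

/-- By duality, testing `ζ^ε` with `φ` is testing `θ^ε` with functions that do not depend on `ε`, so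
the relation survives weak limits. The half removes the factor in `ζ = 2 G * θ`. -/
theorem Admissible.isConvG (H : Admissible ρ w) {j : Fin 3} {θ ζ : TorusDist ℂ}
    (hθ : ∀ φ, Tendsto (fun ε => funDist (thetaEps ρ ε w j) φ) (𝓝[>] (0 : ℝ)) (𝓝 (θ φ)))
    (hζ : ∀ φ, Tendsto (fun ε => funDist (zetaEps ρ ε w j) φ) (𝓝[>] (0 : ℝ)) (𝓝 (ζ φ))) :
    IsConvG θ ζ.half := by
  intro φ
  have hs := fun i => potential_smooth (φ.2.1.pd i) (φ.2.2.pd i)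
  have hp := fun i => potential_periodic (φ.2.2.pd i)
  let χ : Fin 2 → TestSpace := fun i => ⟨_, hs i, hp i⟩
  refine ⟨-χ 0, χ 1, fun y => ?_, ?_⟩
  · rw [greenG_translate φ.2.1 φ.2.2]
    rfl
  · have hlim := ((hζ φ).const_smul (1 / 2 : ℝ))
    refine tendsto_nhds_unique hlim (((hθ (-χ 0)).add ((hθ (χ 1)).const_mul Complex.I)).congr' ?_)
    filter_upwards [eventually_mem_nhdsWithin] with ε hε
    have hε : 0 < ε := hε
    have hns := H.nullForm_smooth hε j
    have hnp := H.nullForm_periodic hε j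
    have d : ∀ i, funDist (pd i (potential (nullForm ρ ε w j))) φ =
        -funDist (nullForm ρ ε w j) (χ i) := fun i => funDist_pd_potential hns hnp rfl
    have hneg : funDist (nullForm ρ ε w j) (-χ 0) = -funDist (nullForm ρ ε w j) (χ 0) := by
      have := funDist_test_smul (nullForm ρ ε w j) (-1) (χ 0)
      rw [neg_one_smul ℝ (χ 0)] at this
      simpa using this
    apply Complex.ext
    · simp [H.re_funDist_thetaEps hε, H.im_funDist_thetaEps hε, H.re_funDist_zetaEps hε, d]
    · simp [H.re_funDist_thetaEps hε, H.im_funDist_thetaEps hε, H.im_funDist_zetaEps hε, d, hneg]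

end Limits

end TorusCR

namespace TorusCR

/-! ### Estimates for the limits and membership in the little spaces -/

noncomputable section Estimates

theorem Approximates.memLittleHZ {g : ℕ → Plane → ℝ} {w : TorusDist ℝ} (h : Approximates g w)
    {κ : ℝ} (h0 : 0 < κ) (h1 : κ < 1 / 2) : MemLittleHZ (-1 - κ / 4) w.toComplex := by
  have hα : -1 - κ / 4 < 0 := by linarith
  have hre : ∀ φ, w.toComplex φ = (w φ : ℂ) := fun _ => rfl
  constructor
  · obtain ⟨A, hA⟩ := h.exists_hzBound h0 h1
    refine (hzNorm_le (A := ENNReal.ofReal A) (B := 0) ?_ ?_).trans_lt (by simp)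
    · simpa only [hre, Complex.ofReal_re] using (hzReal_le_iff hα hA.nonneg).2 hA
    · simp only [hre, Complex.ofReal_im, hzReal_zero, le_refl]
  · intro δ hδ
    obtain ⟨r, hr, hrδ⟩ := ENNReal.lt_iff_exists_nnreal_btwn.1 hδ
    obtain ⟨n, hn⟩ := (h.norm κ h0 h1 r (by simpa using hr)).exists
    have hc := (h.smooth n).ofReal.continuous
    refine ⟨fun x => (g n x : ℂ), (h.smooth n).ofReal, (h.periodic n).ofReal, ?_⟩
    refine (hzNorm_le (A := r) (B := 0) ?_ ?_).trans_lt (by simpa using hrδ)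
    · have := (hzReal_le_iff hα r.2).2 hn.neg
      simp only [neg_sub] at this
      simpa only [hre, Complex.sub_re, re_funDist hc, Complex.ofReal_re, NNReal.val_eq_coe,
        ENNReal.ofReal_coe_nnreal] using this
    · have e : ∀ φ, funDist (fun _ => (0 : ℝ)) φ = 0 := fun φ => by simp [funDist]
      simp only [hre, Complex.sub_im, im_funDist hc, Complex.ofReal_im, e, sub_zero, hzReal_zero,
        le_refl]

variable {ρ : Plane → ℝ} {w : Fin 3 → TorusDist ℝ}

theorem hzNorm_le_of_re_eq_zero {α : ℝ} {f : TestSpace → ℂ} {A : ℝ≥0∞} (h : ∀ φ, (f φ).re = 0)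
    (hA : hzReal α (fun φ => (f φ).im) ≤ A) : hzNorm α f ≤ A := by
  refine (hzNorm_le (A := 0) ?_ hA).trans (zero_add A).le
  simp only [h, hzReal_zero, le_refl]

theorem pairBound_nonneg {κ : ℝ} {d : Fin 3 → ℝ} (hd : ∀ k, 0 ≤ d k) (j : Fin 3) :
    0 ≤ pairBound κ w d j :=
  add_nonneg (mul_nonneg (hd _) ENNReal.toReal_nonneg) (mul_nonneg (hd _) ENNReal.toReal_nonneg)

section

variable {κ : ℝ} (h0 : 0 < κ) (h1 : κ < 1 / 2)
include h0 h1

/-- All regularizations are purely imaginary, so a single real norm matters. The uniform bound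
passes to `θ` by lower semicontinuity, and the distance to `θ` comes from the two-parameter bound as
the second parameter tends to zero. -/
theorem exists_theta_bounds : ∃ C : ℝ, 0 ≤ C ∧
    ∀ (ρ : Plane → ℝ) (w : Fin 3 → TorusDist ℝ), Admissible ρ w → ∀ j, ∀ θ : TorusDist ℂ,
    (∀ φ, Tendsto (fun ε => funDist (thetaEps ρ ε w j) φ) (𝓝[>] (0 : ℝ)) (𝓝 (θ φ))) →
    hzNorm (-κ) θ ≤
      ENNReal.ofReal (C * (noiseNorm κ (w (j + 1)) * noiseNorm κ (w (j + 2)))) ∧ ∀ ε > 0,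
    hzNorm (-κ) (funDist (thetaEps ρ ε w j)) ≤
      ENNReal.ofReal (C * (noiseNorm κ (w (j + 1)) * noiseNorm κ (w (j + 2)))) ∧
    hzNorm (-κ) (fun φ => funDist (thetaEps ρ ε w j) φ - θ φ) ≤
      ENNReal.ofReal (C * pairBound κ w (fun k => mollifyDist ρ κ ε (w k)) j) := by
  obtain ⟨C, hC, hb⟩ := exists_nullForm_bounds h0 h1
  have hκ : -κ < 0 := by linarith
  refine ⟨C, hC, fun ρ w H j θ hθ => ?_⟩
  have hpos : ∀ᶠ ε in 𝓝[>] (0 : ℝ), 0 < ε := eventually_mem_nhdsWithin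
  have hre : ∀ φ, (θ φ).re = 0 := fun φ =>
    tendsto_nhds_unique ((Complex.continuous_re.tendsto _).comp (hθ φ)) (tendsto_const_nhds.congr'
      (hpos.mono fun ε hε => (H.re_funDist_thetaEps hε j φ).symm))
  have him : ∀ φ, Tendsto (fun ε => funDist (nullForm ρ ε w j) φ) (𝓝[>] (0 : ℝ)) (𝓝 (θ φ).im) :=
    fun φ => ((Complex.continuous_im.tendsto _).comp (hθ φ)).congr'
      (hpos.mono fun ε hε => H.im_funDist_thetaEps hε j φ)
  have hb1 : ∀ ε > 0, hzReal (-κ) (funDist (nullForm ρ ε w j)) ≤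
      ENNReal.ofReal (C * (noiseNorm κ (w (j + 1)) * noiseNorm κ (w (j + 2)))) := fun ε hε =>
    (hzReal_le_iff hκ (hb ρ w H j ε hε).1.nonneg).2 (hb ρ w H j ε hε).1
  refine ⟨hzNorm_le_of_re_eq_zero hre (hzReal_le_of_tendsto him tendsto_const_nhds
    (hpos.mono hb1)), fun ε hε => ⟨hzNorm_le_of_re_eq_zero (H.re_funDist_thetaEps hε j) ?_,
    hzNorm_le_of_re_eq_zero (fun φ => ?_) ?_⟩⟩
  · simpa only [H.im_funDist_thetaEps hε] using hb1 ε hε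
  · rw [Complex.sub_re, hre, H.re_funDist_thetaEps hε, sub_zero]
  · simp only [Complex.sub_im, H.im_funDist_thetaEps hε]
    refine hzReal_le_of_tendsto (l := 𝓝[>] (0 : ℝ)) (fun φ => (him φ).const_sub _)
      (ENNReal.tendsto_ofReal (H.tendsto_pairBound h0 h1 _ C j)) (hpos.mono fun ε' hε' => ?_)
    have k := (hb ρ w H j ε hε).2 ε' hε'
    have := (hzReal_le_iff hκ k.nonneg).2 k
    rwa [show (funDist fun x => nullForm ρ ε w j x - nullForm ρ ε' w j x) = fun φ =>
      funDist (nullForm ρ ε w j) φ - funDist (nullForm ρ ε' w j) φ from funext fun φ =>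
        funDist_sub (H.nullForm_smooth hε j).continuous (H.nullForm_smooth hε' j).continuous φ]
      at this

/-- As for `θ`, after the Schauder estimate. The real and the imaginary part each contribute `2 *
(C₂ * C₁)`, and the two are added. -/
theorem exists_zeta_bounds : ∃ C : ℝ, 0 ≤ C ∧
    ∀ (ρ : Plane → ℝ) (w : Fin 3 → TorusDist ℝ), Admissible ρ w → ∀ j, ∀ ζ : TorusDist ℂ,
    (∀ φ, Tendsto (fun ε => funDist (zetaEps ρ ε w j) φ) (𝓝[>] (0 : ℝ)) (𝓝 (ζ φ))) →
    hzNorm (1 - κ) ζ ≤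
      ENNReal.ofReal (C * (noiseNorm κ (w (j + 1)) * noiseNorm κ (w (j + 2)))) ∧ ∀ ε > 0,
    hzNorm (1 - κ) (funDist (zetaEps ρ ε w j)) ≤
      ENNReal.ofReal (C * (noiseNorm κ (w (j + 1)) * noiseNorm κ (w (j + 2)))) ∧
    hzNorm (1 - κ) (fun φ => funDist (zetaEps ρ ε w j) φ - ζ φ) ≤
      ENNReal.ofReal (C * pairBound κ w (fun k => mollifyDist ρ κ ε (w k)) j) := by
  obtain ⟨C₁, hC₁, hb⟩ := exists_nullForm_bounds h0 h1
  obtain ⟨C₂, hC₂, hp⟩ := exists_pd_potential_bounds h0 h1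
  refine ⟨4 * (C₂ * C₁), by positivity, fun ρ w H j ζ hζ => ?_⟩
  have hpos : ∀ᶠ ε in 𝓝[>] (0 : ℝ), 0 < ε := eventually_mem_nhdsWithin
  set N := noiseNorm κ (w (j + 1)) * noiseNorm κ (w (j + 2)) with hN
  have hN0 : 0 ≤ N := mul_nonneg ENNReal.toReal_nonneg ENNReal.toReal_nonneg
  have hre : ∀ φ, Tendsto (fun ε => 2 * funDist (pd 1 (potential (nullForm ρ ε w j))) φ)
      (𝓝[>] (0 : ℝ)) (𝓝 (ζ φ).re) :=
    fun φ => ((Complex.continuous_re.tendsto _).comp (hζ φ)).congr'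
      (hpos.mono fun ε hε => H.re_funDist_zetaEps hε j φ)
  have him : ∀ φ, Tendsto (fun ε => 2 * funDist (pd 0 (potential (nullForm ρ ε w j))) φ)
      (𝓝[>] (0 : ℝ)) (𝓝 (ζ φ).im) :=
    fun φ => ((Complex.continuous_im.tendsto _).comp (hζ φ)).congr'
      (hpos.mono fun ε hε => H.im_funDist_zetaEps hε j φ)
  have hb1 : ∀ i, ∀ ε > 0, hzReal (1 - κ)
      (fun φ => 2 * funDist (pd i (potential (nullForm ρ ε w j))) φ) ≤
      ENNReal.ofReal (2 * (C₂ * (C₁ * N))) := fun i ε hε => by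
    rw [hzReal_const_mul, abs_of_pos two_pos, ENNReal.ofReal_mul zero_le_two]
    gcongr
    exact (hp _ _ (H.nullForm_smooth hε j) (H.nullForm_periodic hε j) (hb ρ w H j ε hε).1 i).2
  have hb2 : ∀ i, ∀ ε > 0, ∀ ε' > 0, hzReal (1 - κ)
      (fun φ => 2 * funDist (pd i (potential (nullForm ρ ε w j))) φ -
        2 * funDist (pd i (potential (nullForm ρ ε' w j))) φ) ≤
      ENNReal.ofReal ((2 * (C₂ * C₁)) * pairBound κ w
        (fun k => mollifyDist ρ κ ε (w k) + mollifyDist ρ κ ε' (w k)) j) := fun i ε hε ε' hε' => by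
    have k := (hp _ _ ((H.nullForm_smooth hε j).sub (H.nullForm_smooth hε' j))
      ((H.nullForm_periodic hε j).comp₂ (H.nullForm_periodic hε' j) fun a b => a - b)
      ((hb ρ w H j ε hε).2 ε' hε') i).2
    rw [H.pd_potential_sub hε hε' j i] at k
    simp only [← mul_sub, ← funDist_sub (H.pd_potential_smooth hε j i).continuous
      (H.pd_potential_smooth hε' j i).continuous]
    rw [hzReal_const_mul, abs_of_pos two_pos, mul_assoc, ENNReal.ofReal_mul zero_le_two, mul_assoc]
    gcongr
  have h4 : ENNReal.ofReal (2 * (C₂ * (C₁ * N))) + ENNReal.ofReal (2 * (C₂ * (C₁ * N))) =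
      ENNReal.ofReal (4 * (C₂ * C₁) * N) := by
    rw [← ENNReal.ofReal_add (by positivity) (by positivity)]
    ring_nf
  refine ⟨?_, fun ε hε => ⟨?_, ?_⟩⟩
  · rw [← h4]
    exact hzNorm_le (hzReal_le_of_tendsto hre tendsto_const_nhds (hpos.mono (hb1 1)))
      (hzReal_le_of_tendsto him tendsto_const_nhds (hpos.mono (hb1 0)))
  · rw [← h4]
    refine hzNorm_le ?_ ?_
    · simpa only [H.re_funDist_zetaEps hε] using hb1 1 ε hε
    · simpa only [H.im_funDist_zetaEps hε] using hb1 0 ε hε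
  · have hP : 0 ≤ pairBound κ w (fun k => mollifyDist ρ κ ε (w k)) j :=
      pairBound_nonneg (fun k => ENNReal.toReal_nonneg) j
    set P := pairBound κ w (fun k => mollifyDist ρ κ ε (w k)) j with hPd
    have h5 : ENNReal.ofReal (2 * (C₂ * C₁) * P) + ENNReal.ofReal (2 * (C₂ * C₁) * P) =
        ENNReal.ofReal (4 * (C₂ * C₁) * P) := by
      rw [← ENNReal.ofReal_add (by positivity) (by positivity)]
      ring_nf
    rw [← h5]
    refine hzNorm_le ?_ ?_
    · simp only [Complex.sub_re, H.re_funDist_zetaEps hε]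
      exact hzReal_le_of_tendsto (l := 𝓝[>] (0 : ℝ)) (fun φ => (hre φ).const_sub _)
        (ENNReal.tendsto_ofReal (H.tendsto_pairBound h0 h1 _ _ j)) (hpos.mono (hb2 1 ε hε))
    · simp only [Complex.sub_im, H.im_funDist_zetaEps hε]
      exact hzReal_le_of_tendsto (l := 𝓝[>] (0 : ℝ)) (fun φ => (him φ).const_sub _)
        (ENNReal.tendsto_ofReal (H.tendsto_pairBound h0 h1 _ _ j)) (hpos.mono (hb2 0 ε hε))

theorem Admissible.exists_pairBound_lt (H : Admissible ρ w) (C : ℝ) (j : Fin 3) {δ : ℝ≥0∞}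
    (hδ : 0 < δ) : ∃ ε > 0,
    ENNReal.ofReal (C * pairBound κ w (fun k => mollifyDist ρ κ ε (w k)) j) < δ := by
  have h := ENNReal.tendsto_ofReal (H.tendsto_pairBound h0 h1 (fun _ => 0) C j)
  have e : ENNReal.ofReal (C * pairBound κ w (fun _ => 0) j) = 0 := by simp [pairBound]
  rw [e] at h
  simp only [zero_add] at h
  obtain ⟨ε, hε, hε'⟩ := ((h.eventually_lt_const hδ).and eventually_mem_nhdsWithin).exists
  exact ⟨ε, hε', hε⟩

end

theorem exists_constants {κ : ℝ} (h0 : 0 < κ) (h1 : κ < 1 / 2) : ∃ C : ℝ≥0,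
    ∀ (ρ : Plane → ℝ) (w : Fin 3 → TorusDist ℝ), Admissible ρ w → ∀ θ ζ : Fin 3 → TorusDist ℂ,
    (∀ j φ, Tendsto (fun ε => funDist (thetaEps ρ ε w j) φ) (𝓝[>] (0 : ℝ)) (𝓝 (θ j φ))) →
    (∀ j φ, Tendsto (fun ε => funDist (zetaEps ρ ε w j) φ) (𝓝[>] (0 : ℝ)) (𝓝 (ζ j φ))) →
      (∀ j, MemLittleHZ (-1 - κ / 4) (w j).toComplex) ∧
      MemE (-κ) θ ∧
      (∀ j, hzNorm (-κ) (θ j) ≤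
        C * hzReal (-1 - κ / 4) (w (j + 1)) * hzReal (-1 - κ / 4) (w (j + 2))) ∧
      (∀ ε : ℝ, 0 < ε → ∀ j, hzNorm (-κ) (funDist (thetaEps ρ ε w j)) ≤
        C * hzReal (-1 - κ / 4) (w (j + 1)) * hzReal (-1 - κ / 4) (w (j + 2))) ∧
      (∀ ε : ℝ, 0 < ε → ∀ j,
        hzNorm (-κ) (fun φ => funDist (thetaEps ρ ε w j) φ - θ j φ) ≤
          C * (hzReal (-1 - κ / 4) (fun φ =>
              funDist (mollify ρ ε (w (j + 1))) φ - w (j + 1) φ) *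
              hzReal (-1 - κ / 4) (w (j + 2)) +
            hzReal (-1 - κ / 4) (fun φ =>
              funDist (mollify ρ ε (w (j + 2))) φ - w (j + 2) φ) *
              hzReal (-1 - κ / 4) (w (j + 1)))) ∧
      MemE (1 - κ) ζ ∧
      l2norm (fun j => hzNorm (1 - κ) (ζ j)) ≤
        C * l2norm (fun j => hzReal (-1 - κ / 4) (w j)) ^ 2 ∧
      (∀ ε : ℝ, 0 < ε → l2norm (fun j => hzNorm (1 - κ) (funDist (zetaEps ρ ε w j))) ≤
        C * l2norm (fun j => hzReal (-1 - κ / 4) (w j)) ^ 2) ∧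
      (∀ ε : ℝ, 0 < ε → ∀ j,
        hzNorm (1 - κ) (fun φ => funDist (zetaEps ρ ε w j) φ - ζ j φ) ≤
          C * (hzReal (-1 - κ / 4) (fun φ =>
              funDist (mollify ρ ε (w (j + 1))) φ - w (j + 1) φ) *
              hzReal (-1 - κ / 4) (w (j + 2)) +
            hzReal (-1 - κ / 4) (fun φ =>
              funDist (mollify ρ ε (w (j + 2))) φ - w (j + 2) φ) *
              hzReal (-1 - κ / 4) (w (j + 1)))) := by
  obtain ⟨C₁, hC₁, hb₁⟩ := exists_theta_bounds h0 h1
  obtain ⟨C₂, hC₂, hb₂⟩ := exists_zeta_bounds h0 h1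
  -- One constant for all estimates: `C₁` serves `θ`, `C₂` the components of `ζ`, and `3` comes from
  -- bounding the Euclidean norm of `ζ` by the sum of three components.
  refine ⟨(C₁ + 3 * C₂).toNNReal, fun ρ w H θ ζ hθ hζ => ?_⟩
  have k₁ := fun j => hb₁ ρ w H j (θ j) (hθ j)
  have k₂ := fun j => hb₂ ρ w H j (ζ j) (hζ j)
  have hn : ∀ k, 0 ≤ noiseNorm κ (w k) := fun k => ENNReal.toReal_nonneg
  have hd : ∀ ε k, 0 ≤ mollifyDist ρ κ ε (w k) := fun ε k => ENNReal.toReal_nonneg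
  have e : ∀ k, hzReal (-1 - κ / 4) (w k) = ENNReal.ofReal (noiseNorm κ (w k)) := fun k =>
    (H.hzBound_noise h0 h1 k).2
  have conv : ∀ {c : ℝ}, 0 ≤ c → c ≤ C₁ + 3 * C₂ → ∀ j,
      ENNReal.ofReal (c * (noiseNorm κ (w (j + 1)) * noiseNorm κ (w (j + 2)))) ≤
      ((C₁ + 3 * C₂).toNNReal : ℝ≥0∞) * hzReal (-1 - κ / 4) (w (j + 1)) *
        hzReal (-1 - κ / 4) (w (j + 2)) := fun {c} hc hc' j => by
    rw [e, e, ENNReal.ofReal_mul hc, ENNReal.ofReal_mul (hn _), ← mul_assoc]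
    gcongr
    exact ENNReal.ofReal_le_ofReal hc'
  have conv' : ∀ {c : ℝ}, 0 ≤ c → c ≤ C₁ + 3 * C₂ → ∀ ε > 0, ∀ j,
      ENNReal.ofReal (c * pairBound κ w (fun k => mollifyDist ρ κ ε (w k)) j) ≤
      ((C₁ + 3 * C₂).toNNReal : ℝ≥0∞) * (hzReal (-1 - κ / 4) (fun φ =>
          funDist (mollify ρ ε (w (j + 1))) φ - w (j + 1) φ) * hzReal (-1 - κ / 4) (w (j + 2)) +
        hzReal (-1 - κ / 4) (fun φ => funDist (mollify ρ ε (w (j + 2))) φ - w (j + 2) φ) *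
          hzReal (-1 - κ / 4) (w (j + 1))) := fun {c} hc hc' ε hε j => by
    rw [e, e, (H.hzBound_mollifyDist h0 h1 _ hε).2, (H.hzBound_mollifyDist h0 h1 _ hε).2,
      ENNReal.ofReal_mul hc, pairBound, ENNReal.ofReal_add (mul_nonneg (hd _ _) (hn _))
      (mul_nonneg (hd _ _) (hn _)), ENNReal.ofReal_mul (hd _ _), ENNReal.ofReal_mul (hd _ _)]
    gcongr
    exact ENNReal.ofReal_le_ofReal hc'
  have conv2 : ∀ F : Fin 3 → ℝ≥0∞,
      (∀ j, F j ≤ ENNReal.ofReal (C₂ * (noiseNorm κ (w (j + 1)) * noiseNorm κ (w (j + 2))))) →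
      l2norm F ≤ ((C₁ + 3 * C₂).toNNReal : ℝ≥0∞) *
        l2norm (fun j => hzReal (-1 - κ / 4) (w j)) ^ 2 := fun F hF => by
    set L := l2norm (fun j => hzReal (-1 - κ / 4) (w j)) with hL
    have hle : ∀ k, ENNReal.ofReal (noiseNorm κ (w k)) ≤ L := fun k => by
      rw [← e]
      exact le_l2norm (fun j => hzReal (-1 - κ / 4) (w j)) k
    have hF' : ∀ j, F j ≤ ENNReal.ofReal C₂ * L ^ 2 := fun j => by
      refine (hF j).trans ?_
      rw [ENNReal.ofReal_mul hC₂, ENNReal.ofReal_mul (hn _), sq]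
      gcongr
      · exact hle _
      · exact hle _
    calc l2norm F ≤ ∑ j, F j := l2norm_le_sum F
      _ ≤ ∑ _j : Fin 3, ENNReal.ofReal C₂ * L ^ 2 := Finset.sum_le_sum fun j _ => hF' j
      _ = ENNReal.ofReal (3 * C₂) * L ^ 2 := by
        rw [Finset.sum_const, Finset.card_univ, Fintype.card_fin, nsmul_eq_mul,
          ENNReal.ofReal_mul (by norm_num), mul_assoc]
        norm_num
      _ ≤ _ := by
        gcongr
        exact ENNReal.ofReal_le_ofReal (by linarith)
  refine ⟨fun j => ?_, fun j => ⟨(k₁ j).1.trans_lt ENNReal.ofReal_lt_top, fun δ hδ => ?_⟩,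
    fun j => (k₁ j).1.trans (conv hC₁ (by linarith) j),
    fun ε hε j => ((k₁ j).2 ε hε).1.trans (conv hC₁ (by linarith) j),
    fun ε hε j => ((k₁ j).2 ε hε).2.trans (conv' hC₁ (by linarith) ε hε j),
    fun j => ⟨(k₂ j).1.trans_lt ENNReal.ofReal_lt_top, fun δ hδ => ?_⟩,
    conv2 _ fun j => (k₂ j).1, fun ε hε => conv2 _ fun j => ((k₂ j).2 ε hε).1,
    fun ε hε j => ((k₂ j).2 ε hε).2.trans (conv' hC₂ (by linarith) ε hε j)⟩
  · obtain ⟨g, hg⟩ := H.approx j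
    exact hg.memLittleHZ h0 h1
  · obtain ⟨ε, hε, h⟩ := H.exists_pairBound_lt h0 h1 C₁ j hδ
    refine ⟨_, H.thetaEps_smooth hε j, H.thetaEps_periodic hε j, ?_⟩
    rw [hzNorm_sub_comm]
    exact ((k₁ j).2 ε hε).2.trans_lt h
  · obtain ⟨ε, hε, h⟩ := H.exists_pairBound_lt h0 h1 C₂ j hδ
    refine ⟨_, H.zetaEps_smooth hε j, H.zetaEps_periodic hε j, ?_⟩
    rw [hzNorm_sub_comm]
    exact ((k₂ j).2 ε hε).2.trans_lt h

end Estimates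

end TorusCR

namespace TorusCR

/-! ### Dyadic blocks of Fourier series -/

noncomputable section DyadicBlocks

/-- Real trigonometric polynomials. -/
def trig (c : (Fin 2 → ℤ) → ℂ) (B : Finset (Fin 2 → ℤ)) (x : Plane) : ℝ :=
  ∑ k ∈ B, (c k * character k x).re

/-- The square of frequencies of size at most `2 ^ n`. -/
def box (n : ℕ) : Finset (Fin 2 → ℤ) := Finset.Icc (fun _ => -2 ^ n) (fun _ => 2 ^ n)

/-- The frequencies of size between `2 ^ n` and `2 ^ (n + 1)`. -/
def block (n : ℕ) : Finset (Fin 2 → ℤ) := box (n + 1) \ box n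

/-- The square of the Euclidean length of a frequency. -/
def freqSq (k : Fin 2 → ℤ) : ℝ := (k 0 : ℝ) ^ 2 + (k 1 : ℝ) ^ 2

theorem mem_box {n : ℕ} {k : Fin 2 → ℤ} : k ∈ box n ↔ ∀ i, |k i| ≤ 2 ^ n := by
  simp only [box, Finset.mem_Icc, Pi.le_def, abs_le]
  exact ⟨fun h i => ⟨h.1 i, h.2 i⟩, fun h => ⟨fun i => (h i).1, fun i => (h i).2⟩⟩

theorem monotone_box : Monotone box := fun m n h k hk => by
  rw [mem_box] at hk ⊢
  exact fun i => (hk i).trans (pow_le_pow_right₀ (by norm_num) h)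

theorem exists_mem_box (k : Fin 2 → ℤ) : ∃ n, k ∈ box n := by
  refine ⟨(k 0).natAbs + (k 1).natAbs, mem_box.2 fun i => ?_⟩
  have h : (k i).natAbs ≤ 2 ^ ((k 0).natAbs + (k 1).natAbs) := by
    refine le_trans ?_ (Nat.lt_two_pow_self (n := (k 0).natAbs + (k 1).natAbs)).le
    fin_cases i <;> simp
  rw [Int.abs_eq_natAbs]
  exact_mod_cast h

theorem ne_zero_of_mem_block {n : ℕ} {k : Fin 2 → ℤ} (h : k ∈ block n) : k ≠ 0 := by
  rintro rfl
  exact (Finset.mem_sdiff.1 h).2 (mem_box.2 fun i => by simp)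

theorem four_pow_le_freqSq {n : ℕ} {k : Fin 2 → ℤ} (h : k ∈ block n) : (4 : ℝ) ^ n ≤ freqSq k := by
  have h2 := (Finset.mem_sdiff.1 h).2
  rw [mem_box] at h2
  push Not at h2
  obtain ⟨i, hi⟩ := h2
  have h3 : (2 : ℝ) ^ n ≤ |(k i : ℝ)| := by exact_mod_cast hi.le
  have h4 : ((2 : ℝ) ^ n) ^ 2 ≤ (k i : ℝ) ^ 2 := by
    rw [← sq_abs (k i : ℝ)]
    gcongr
  rw [← pow_mul, mul_comm, pow_mul] at h4
  norm_num at h4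
  refine h4.trans ?_
  rw [freqSq]
  fin_cases i
  · simpa using sq_nonneg (k 1 : ℝ)
  · simpa using sq_nonneg (k 0 : ℝ)

theorem card_block_le (n : ℕ) : ((block n).card : ℝ) ≤ 25 * 4 ^ n := by
  have h1 : (block n).card ≤ (box (n + 1)).card := Finset.card_le_card Finset.sdiff_subset
  have h2 : (box (n + 1)).card = (2 * 2 ^ (n + 1) + 1) ^ 2 := by
    rw [box, Pi.card_Icc, Fin.prod_univ_two, Int.card_Icc, sq]
    have : ((2 : ℤ) ^ (n + 1) + 1 - -2 ^ (n + 1)).toNat = 2 * 2 ^ (n + 1) + 1 := by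
      rw [show (2 : ℤ) ^ (n + 1) + 1 - -2 ^ (n + 1) = ((2 * 2 ^ (n + 1) + 1 : ℕ) : ℤ) by
        push_cast; ring, Int.toNat_natCast]
    rw [this]
  have h3 : ((box (n + 1)).card : ℝ) ≤ 25 * 4 ^ n := by
    rw [h2]
    push_cast
    have : (1 : ℝ) ≤ 2 ^ n := one_le_pow₀ (by norm_num)
    rw [show (4 : ℝ) ^ n = (2 ^ n) ^ 2 by rw [← pow_mul, mul_comm, pow_mul]; norm_num, pow_succ 2 n]
    nlinarith
  exact le_trans (by exact_mod_cast h1) h3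

theorem trig_smooth (c : (Fin 2 → ℤ) → ℂ) (B : Finset (Fin 2 → ℤ)) : IsSmooth (trig c B) := by
  refine ContDiff.sum fun k _ => ?_
  exact Complex.reCLM.contDiff.comp (contDiff_const.mul (isSmooth_character k))

theorem trig_periodic (c : (Fin 2 → ℤ) → ℂ) (B : Finset (Fin 2 → ℤ)) : IsPeriodic (trig c B) :=
  fun n x => by simp only [trig, isPeriodic_character _ n x]

theorem trig_ofReal_mul (a : ℝ) (c : (Fin 2 → ℤ) → ℂ) (B : Finset (Fin 2 → ℤ)) (x : Plane) :
    trig (fun k => (a : ℂ) * c k) B x = a * trig c B x := by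
  simp only [trig, mul_assoc, Complex.re_ofReal_mul, Finset.mul_sum]

theorem pd_trig (c : (Fin 2 → ℤ) → ℂ) (B : Finset (Fin 2 → ℤ)) (i : Fin 2) :
    pd i (trig c B) = trig (fun k => Complex.I * (k i : ℂ) * c k) B := by
  funext x
  have h : HasFDerivAt (trig c B) (∑ k ∈ B, Complex.reCLM.comp (c k •
      ((Complex.I * character k x) • (Complex.ofRealCLM.comp (phase k))))) x :=
    HasFDerivAt.fun_sum fun k _ =>
      Complex.reCLM.hasFDerivAt.comp x ((hasFDerivAt_character k x).const_mul (c k))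
  rw [pd, h.fderiv, _root_.sum_apply, trig]
  refine Finset.sum_congr rfl fun k _ => ?_
  have : (Complex.reCLM.comp (c k • ((Complex.I * character k x) •
      (Complex.ofRealCLM.comp (phase k))))) (stdVec i) =
      (c k * (Complex.I * character k x * (phase k (stdVec i) : ℂ))).re := by
    simp
  rw [this, phase_stdVec]
  congr 1
  push_cast
  ring

/-- Division of the coefficients by the squared frequency inverts `-Δ` away from the zero frequency.
This allows two derivatives to be moved from a block onto the test function. -/
theorem laplacian_trig (c : (Fin 2 → ℤ) → ℂ) (B : Finset (Fin 2 → ℤ)) (hB : ∀ k ∈ B, k ≠ 0) (x : Plane) :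
    pd 0 (pd 0 (trig (fun k => ((freqSq k)⁻¹ : ℝ) * c k) B)) x +
      pd 1 (pd 1 (trig (fun k => ((freqSq k)⁻¹ : ℝ) * c k) B)) x = -trig c B x := by
  simp only [pd_trig, trig]
  rw [← Finset.sum_add_distrib, ← Finset.sum_neg_distrib]
  refine Finset.sum_congr rfl fun k hk => ?_
  rw [← Complex.add_re, ← Complex.neg_re]
  congr 1
  have hk0 : freqSq k ≠ 0 := by
    intro h
    have h0 : (k 0 : ℝ) = 0 := by
      have := sq_nonneg (k 1 : ℝ)
      have := sq_nonneg (k 0 : ℝ)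
      rw [freqSq] at h
      exact pow_eq_zero_iff two_ne_zero |>.1 (by linarith)
    have h1 : (k 1 : ℝ) = 0 := by
      rw [freqSq, h0] at h
      simpa using h
    refine hB k hk (funext fun i => ?_)
    fin_cases i
    · exact_mod_cast h0
    · exact_mod_cast h1
  have h1 : ((k 0 : ℂ) ^ 2 + (k 1 : ℂ) ^ 2) * ((freqSq k)⁻¹ : ℝ) = 1 := by
    rw [show ((k 0 : ℂ) ^ 2 + (k 1 : ℂ) ^ 2) = (freqSq k : ℝ) by rw [freqSq]; push_cast; rfl]
    rw [← Complex.ofReal_mul, mul_inv_cancel₀ hk0, Complex.ofReal_one]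
  linear_combination (c k * character k x * ((k 0 : ℂ) ^ 2 + (k 1 : ℂ) ^ 2) *
    ((freqSq k)⁻¹ : ℝ)) * Complex.I_sq - c k * character k x * h1

theorem abs_avg_le_ball {Φ f : Plane → ℝ} (hs : tsupport Φ ⊆ Metric.ball 0 1)
    {M : ℝ} (hM : ∀ z, |Φ z| ≤ M) (hf : Continuous f) {lam : ℝ} (hl : 0 < lam) (x : Plane) :
    |avg Φ lam f x| ≤ M * lam⁻¹ ^ 2 * ∫ y in Metric.ball x lam, |f y| := by
  rw [← integral_rescale_smul Φ hl x f, ← setIntegral_eq_integral_of_forall_compl_eq_zero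
    (s := Metric.ball x lam) (fun y hy => by rw [rescale_eq_zero hs hl hy, zero_smul]),
    ← integral_const_mul, ← Real.norm_eq_abs]
  have hi : IntegrableOn (fun y => |f y|) (Metric.ball x lam) :=
    (hf.abs.continuousOn.integrableOn_compact (isCompact_closedBall x lam)).mono_set
      Metric.ball_subset_closedBall
  refine norm_integral_le_of_norm_le (f := fun y => rescale Φ lam x y • f y) (hi.const_mul _)
    (ae_of_all _ fun y => ?_)
  rw [norm_smul, Real.norm_eq_abs, Real.norm_eq_abs, rescale, abs_mul, abs_of_nonneg (sq_nonneg _),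
    mul_comm M]
  gcongr
  exact hM _

/-- After translation the ball is centred at the origin, and its radius, at most one, is below `π`,
so it lies inside the cell. -/
theorem setIntegral_ball_le_cell {P : Plane → ℝ} (hP : Continuous P) (hp : IsPeriodic P)
    (h0 : ∀ y, 0 ≤ P y) {lam : ℝ} (hl1 : lam ≤ 1) (x : Plane) :
    ∫ y in Metric.ball x lam, P y ≤ ∫ y in cell, P y := by
  have e : ∫ y in Metric.ball x lam, P y = ∫ y in Metric.ball 0 lam, P (y + x) := by
    have h := (measurePreserving_add_right (volume : Measure Plane) x).setIntegral_preimage_emb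
      (MeasurableEquiv.addRight x).measurableEmbedding P (Metric.ball x lam)
    rw [← h]
    congr 2
    ext y
    simp [dist_eq_norm]
  rw [e, ← setIntegral_cell_add hp x]
  have hi : IntegrableOn (fun y => P (y + x)) cell :=
    integrableOn_cell (hP.comp (continuous_id.add continuous_const))
  refine setIntegral_mono_set hi (ae_of_all _ fun y => h0 _) (Eventually.of_forall fun y hy => ?_)
  intro i
  have h1 : ‖y‖ < lam := mem_ball_zero_iff.1 hy
  have h2 : |y i| ≤ ‖y‖ := by simpa using PiLp.norm_apply_le y i
  have := Real.pi_gt_three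
  exact ⟨by linarith [neg_abs_le (y i)], by linarith [le_abs_self (y i)]⟩

/-- Exponential integrability controls the mass of small balls up to a logarithm. -/
theorem setIntegral_ball_abs_le {f : Plane → ℝ} (hf : Continuous f) (hp : IsPeriodic f) {Q : ℝ}
    (hQ : ∫ y in cell, (Real.exp (f y) + Real.exp (-f y)) ≤ Q) {lam : ℝ} (hl : 0 < lam)
    (hl1 : lam ≤ 1) (x : Plane) {s : ℝ} (hs : 0 ≤ s) :
    ∫ y in Metric.ball x lam, |f y| ≤ 4 * lam ^ 2 * s + Real.exp (-s) * Q := by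
  have hec : Continuous fun y => Real.exp (f y) + Real.exp (-f y) := by fun_prop
  have hb : ∀ {g : Plane → ℝ}, Continuous g → IntegrableOn g (Metric.ball x lam) := fun hg =>
    (hg.continuousOn.integrableOn_compact (isCompact_closedBall x lam)).mono_set
      Metric.ball_subset_closedBall
  -- From `a + 1 ≤ e^a` at `a = |f| - s`; the free parameter `s` trades the area of the ball against
  -- the exponential integral.
  have hpt : ∀ y, |f y| ≤ s + Real.exp (-s) * (Real.exp (f y) + Real.exp (-f y)) := fun y => by
    have h1 := Real.add_one_le_exp (|f y| - s)
    have h2 : Real.exp (|f y| - s) = Real.exp (-s) * Real.exp |f y| := by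
      rw [← Real.exp_add]
      ring_nf
    have h3 : Real.exp |f y| ≤ Real.exp (f y) + Real.exp (-f y) := by
      rcases abs_cases (f y) with ⟨h, -⟩ | ⟨h, -⟩ <;> rw [h]
      · linarith [Real.exp_pos (-f y)]
      · linarith [Real.exp_pos (f y)]
    have h4 := mul_le_mul_of_nonneg_left h3 (Real.exp_pos (-s)).le
    linarith
  calc ∫ y in Metric.ball x lam, |f y|
      ≤ ∫ y in Metric.ball x lam, (s + Real.exp (-s) * (Real.exp (f y) + Real.exp (-f y))) :=
        integral_mono (hb hf.abs) (hb (by fun_prop)) hpt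
    _ = (volume : Measure Plane).real (Metric.ball x lam) * s + Real.exp (-s) *
        ∫ y in Metric.ball x lam, (Real.exp (f y) + Real.exp (-f y)) := by
        rw [integral_add (hb continuous_const) (hb (by fun_prop)), integral_const_mul,
          setIntegral_const, smul_eq_mul]
    _ ≤ _ := by
        gcongr
        · exact volume_ball_le hl x
        · exact (setIntegral_ball_le_cell hec (hp.comp fun a => Real.exp a + Real.exp (-a))
            (fun y => by positivity) hl1 x).trans hQ

theorem abs_pd_pd_le_one_of_mem_ballTests {φ : Plane → ℝ} (h : φ ∈ ballTests 2)
    (i : Fin 2) (x : Plane) : |pd i (pd i φ) x| ≤ 1 := by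
  have e : pd i (pd i φ) x = fderiv ℝ (fderiv ℝ φ) x (stdVec i) (stdVec i) := by
    have h2 := (h.1.fderiv.differentiable (by simp) x).hasFDerivAt
    have h3 := (h2.clm_apply (hasFDerivAt_const (stdVec i) x)).fderiv
    rw [pd, show pd i φ = fun y => fderiv ℝ φ y (stdVec i) from rfl, h3]
    simp
  rw [e]
  simpa [iteratedFDeriv_two_apply] using h.2.2.2 2 le_rfl (fun _ => i) x

theorem le_rpow_mul_rpow {c A B p : ℝ} (hc : 0 ≤ c) (hA : c ≤ A) (hB : c ≤ B) (hp : 0 ≤ p)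
    (hp1 : p ≤ 1) : c ≤ A ^ p * B ^ (1 - p) := by
  calc c = c ^ p * c ^ (1 - p) := by
        rw [← Real.rpow_add' hc (by norm_num), add_sub_cancel, Real.rpow_one]
    _ ≤ _ := by
        have : 0 ≤ 1 - p := by linarith
        have h2 : 0 ≤ A := hc.trans hA
        gcongr

/-- The bound for the dyadic blocks. -/
def blockBound (κ T : ℝ) (n : ℕ) : ℝ :=
  2 * (4 * n + 64 / κ + T) * ((2 : ℝ) ^ (-(κ / 8))) ^ n

theorem summable_blockBound {κ : ℝ} (h0 : 0 < κ) (T : ℝ) : Summable (blockBound κ T) := by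
  have hr : ‖(2 : ℝ) ^ (-(κ / 8))‖ < 1 := by
    rw [Real.norm_of_nonneg (by positivity)]
    exact Real.rpow_lt_one_of_one_lt_of_neg one_lt_two (by linarith)
  have h1 := (summable_pow_mul_geometric_of_norm_lt_one 1 hr).mul_left 8
  have h2 := (summable_geometric_of_norm_lt_one hr).mul_left (2 * (64 / κ + T))
  refine (h1.add h2).congr fun n => ?_
  rw [blockBound]
  ring

theorem blockBound_nonneg {κ T : ℝ} (h0 : 0 < κ) (hT : 0 ≤ T) (n : ℕ) : 0 ≤ blockBound κ T n := by
  rw [blockBound]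
  positivity

/-- `X` is either the block divided by `2ⁿ` or its inverse Laplacian multiplied by `2ⁿ`; for white
noise both have bounded variance. The first yields `2ⁿ` for the tested block, the second `2⁻ⁿ λ⁻²`,
both up to a logarithm `L`. Their geometric mean is `λ⁻¹`, and tilting it slightly gives decay in
`n` at the cost of a small power of `λ`. -/
theorem hzBound_block {c : (Fin 2 → ℤ) → ℂ} {n : ℕ} {T : ℝ} (hT : 0 < T)
    (hX : ∀ X ∈ ({trig (fun k => ((2 ^ n)⁻¹ : ℝ) * c k) (block n),
      trig (fun k => (2 ^ n * (freqSq k)⁻¹ : ℝ) * c k) (block n)} : Set (Plane → ℝ)),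
      ∫ y in cell, (Real.exp (X y) + Real.exp (-X y)) ≤ 2 ^ n * T)
    {κ : ℝ} (h0 : 0 < κ) (h1 : κ < 1 / 2) :
    HZBound (-1 - κ / 4) (funDist (trig c (block n))) (blockBound κ T n) := by
  intro x lam hl φ hφ
  rw [floor_rough h0 h1] at hφ
  have hl0 := hl.1
  have hβs := trig_smooth c (block n)
  have hβp := trig_periodic c (block n)
  rw [funDist_rescale hφ.1 hφ.2.1 hl.1 x hβs.continuous hβp]
  set q : ℝ := 2 ^ n with hq
  have hq0 : 0 < q := by positivity
  have hq1 : 1 ≤ q := one_le_pow₀ (by norm_num)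
  set σ := lam⁻¹ with hσ
  have hσ1 : 1 ≤ σ := (one_le_inv₀ hl.1).2 hl.2
  have hσ0 : 0 < σ := by positivity
  set L := 4 * (n + 2 * Real.log σ) + T with hL
  have hlogσ : 0 ≤ Real.log σ := Real.log_nonneg hσ1
  have hL0 : 0 < L := by positivity
  have hball : ∀ X : Plane → ℝ, Continuous X → IsPeriodic X →
      ∫ y in cell, (Real.exp (X y) + Real.exp (-X y)) ≤ q * T →
      ∫ y in Metric.ball x lam, |X y| ≤ lam ^ 2 * L := by
    intro X hXc hXp hXb
    -- With `s = log (2ⁿ λ⁻²)` the factor `e^(-s)` turns the exponential integral `2ⁿ T` into `λ²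
    -- T`, while `s` is only logarithmic.
    refine (setIntegral_ball_abs_le hXc hXp hXb hl.1 hl.2 x
      (s := Real.log (q * σ ^ 2)) (Real.log_nonneg ?_)).trans ?_
    · exact one_le_mul_of_one_le_of_one_le hq1 (one_le_pow₀ hσ1)
    · rw [Real.exp_neg, Real.exp_log (by positivity), Real.log_mul (by positivity) (by positivity),
        Real.log_pow, hq, Real.log_pow, hL]
      have e : (2 ^ n * σ ^ 2)⁻¹ * (2 ^ n * T) = lam ^ 2 * T := by
        rw [hσ]
        field_simp
      rw [← hq] at e ⊢
      rw [e]
      have hlog2 : Real.log 2 ≤ 1 := by linarith [Real.log_two_lt_d9]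
      have : (n : ℝ) * Real.log 2 ≤ n := mul_le_of_le_one_right (Nat.cast_nonneg n) hlog2
      have h2 : 0 < lam ^ 2 := by positivity
      push_cast
      nlinarith
  set V := trig (fun k => (2 ^ n * (freqSq k)⁻¹ : ℝ) * c k) (block n) with hV
  have hA : |avg φ lam (trig c (block n)) x| ≤ 2 * L * q := by
    have hb := hball _ (trig_smooth _ _).continuous (trig_periodic _ _) (hX _ (mem_insert _ _))
    have := abs_avg_le_ball hφ.2.2.1 (abs_le_one_of_mem_ballTests hφ) hβs.continuous hl.1 x
    have e : ∀ y, |trig c (block n) y| =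
        q * |trig (fun k => ((2 ^ n)⁻¹ : ℝ) * c k) (block n) y| := fun y => by
      have := trig_ofReal_mul ((2 ^ n)⁻¹ : ℝ) c (block n) y
      rw [this, abs_mul, abs_of_pos (by positivity : (0 : ℝ) < (2 ^ n)⁻¹), ← mul_assoc, hq,
        mul_inv_cancel₀ (by positivity), one_mul]
    simp only [e, integral_const_mul] at this
    refine this.trans ?_
    calc 1 * σ ^ 2 * (q * ∫ y in Metric.ball x lam,
          |trig (fun k => ((2 ^ n)⁻¹ : ℝ) * c k) (block n) y|)
        ≤ 1 * σ ^ 2 * (q * (lam ^ 2 * L)) := by gcongr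
      _ = L * q := by rw [hσ]; field_simp
      _ ≤ 2 * L * q := by nlinarith [mul_pos hL0 hq0]
  have hB : |avg φ lam (trig c (block n)) x| ≤ 2 * L * (q⁻¹ * σ ^ 2) := by
    have hb := hball V (trig_smooth _ _).continuous (trig_periodic _ _)
      (hX _ (mem_insert_of_mem _ (mem_singleton _)))
    set γ := trig (fun k => ((freqSq k)⁻¹ : ℝ) * c k) (block n) with hγ
    have hγs : IsSmooth γ := trig_smooth _ _
    have eV : ∀ y, |γ y| = q⁻¹ * |V y| := fun y => by
      have := trig_ofReal_mul (2 ^ n) (fun k => ((freqSq k)⁻¹ : ℝ) * c k) (block n) y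
      have e : V y = q * γ y := by
        rw [hV, hγ, ← this]
        simp only [Complex.ofReal_mul, mul_assoc]
      rw [e, abs_mul, abs_of_pos hq0, inv_mul_cancel_left₀ hq0.ne']
    have e1 : ∀ i, lam * (lam * avg φ lam (pd i (pd i γ)) x) = avg (pd i (pd i φ)) lam γ x :=
      fun i => by
      rw [mul_avg_pd hφ.1 hφ.2.1 (hγs.pd i), mul_neg, mul_avg_pd (hφ.1.pd i)
        (hasCompactSupport_pd hφ.2.1 i) hγs, neg_neg]
    have e2 : avg φ lam (trig c (block n)) x =
        -(avg φ lam (pd 0 (pd 0 γ)) x + avg φ lam (pd 1 (pd 1 γ)) x) := by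
      have := laplacian_trig c (block n) (fun k hk => ne_zero_of_mem_block hk)
      simp only [avg]
      rw [← integral_add (integrable_avg hφ.1.continuous hφ.2.1 ((hγs.pd 0).pd 0).continuous lam x)
        (integrable_avg hφ.1.continuous hφ.2.1 ((hγs.pd 1).pd 1).continuous lam x),
        ← integral_neg]
      congr 1 with y
      rw [← smul_add, this, smul_neg, neg_neg]
    have e3 : ∀ i, |avg φ lam (pd i (pd i γ)) x| ≤ σ ^ 2 * (L * q⁻¹) := fun i => by
      have hs2 : tsupport (pd i (pd i φ)) ⊆ Metric.ball 0 1 :=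
        ((tsupport_pd_subset _ i).trans (tsupport_pd_subset _ i)).trans hφ.2.2.1
      have := abs_avg_le_ball hs2 (abs_pd_pd_le_one_of_mem_ballTests hφ i) hγs.continuous hl.1 x
      rw [← e1] at this
      simp only [eV, integral_const_mul] at this
      rw [abs_mul, abs_mul, abs_of_pos hl0] at this
      have h2 : lam * (lam * |avg φ lam (pd i (pd i γ)) x|) ≤ L * q⁻¹ := by
        refine this.trans ?_
        calc 1 * σ ^ 2 * (q⁻¹ * ∫ y in Metric.ball x lam, |V y|)
            ≤ 1 * σ ^ 2 * (q⁻¹ * (lam ^ 2 * L)) := by gcongr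
          _ = L * q⁻¹ := by rw [hσ]; field_simp
      calc |avg φ lam (pd i (pd i γ)) x|
          = σ ^ 2 * (lam * (lam * |avg φ lam (pd i (pd i γ)) x|)) := by rw [hσ]; field_simp
        _ ≤ _ := by gcongr
    rw [e2, abs_neg]
    refine (abs_add_le _ _).trans ((add_le_add (e3 0) (e3 1)).trans (le_of_eq ?_))
    ring
  have hp0 : 0 ≤ 1 / 2 - κ / 16 := by linarith
  have hp1 : 1 / 2 - κ / 16 ≤ 1 := by linarith
  -- The exponent `p = 1/2 - κ/16` gives `2^(n(2p-1)) = 2^(-nκ/8)` and `λ^(-2(1-p)) = λ^(-1-κ/8)`,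
  -- which leaves a factor `λ^(-κ/8)` to absorb the logarithm in `L`.
  refine (le_rpow_mul_rpow (abs_nonneg _) hA hB hp0 hp1).trans ?_
  set p := 1 / 2 - κ / 16 with hp
  have e1 : (2 * L * q) ^ p * (2 * L * (q⁻¹ * σ ^ 2)) ^ (1 - p) =
      2 * L * (q ^ (-(κ / 8)) * σ ^ (1 + κ / 8)) := by
    have h2L : 0 ≤ 2 * L := by positivity
    rw [Real.mul_rpow h2L hq0.le, Real.mul_rpow h2L (by positivity),
      Real.mul_rpow (x := q⁻¹) (by positivity) (by positivity), Real.inv_rpow hq0.le, ← Real.rpow_neg hq0.le,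
      ← Real.rpow_natCast σ 2, ← Real.rpow_mul hσ0.le,
      show -(κ / 8) = p + -(1 - p) by rw [hp]; ring, Real.rpow_add hq0,
      show 1 + κ / 8 = ((2 : ℕ) : ℝ) * (1 - p) by rw [hp]; push_cast; ring]
    have : (2 * L) ^ p * (2 * L) ^ (1 - p) = 2 * L := by
      rw [← Real.rpow_add (by positivity), add_sub_cancel, Real.rpow_one]
    linear_combination (q ^ p * q ^ (-(1 - p)) * σ ^ (((2 : ℕ) : ℝ) * (1 - p))) * this
  rw [e1]
  have hLle : L ≤ (4 * n + 64 / κ + T) * σ ^ (κ / 8) := by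
    have h2 := Real.log_le_rpow_div hσ0.le (show 0 < κ / 8 by linarith)
    have h3 : 1 ≤ σ ^ (κ / 8) := Real.one_le_rpow hσ1 (by linarith)
    have h4 : σ ^ (κ / 8) / (κ / 8) = 8 / κ * σ ^ (κ / 8) := by field_simp
    rw [h4] at h2
    have h5 : 8 * Real.log σ ≤ 64 / κ * σ ^ (κ / 8) := by
      calc 8 * Real.log σ ≤ 8 * (8 / κ * σ ^ (κ / 8)) := by linarith
        _ = _ := by ring
    have h6 : (4 * n + T) * 1 ≤ (4 * n + T) * σ ^ (κ / 8) := by gcongr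
    rw [hL]
    linarith
  have e2 : q ^ (-(κ / 8)) = ((2 : ℝ) ^ (-(κ / 8))) ^ n := by
    rw [hq, ← Real.rpow_natCast, ← Real.rpow_mul zero_le_two, mul_comm, Real.rpow_mul zero_le_two,
      Real.rpow_natCast]
  have e3 : lam ^ (-1 - κ / 4) = σ ^ (κ / 8) * σ ^ (1 + κ / 8) := by
    rw [← Real.rpow_add hσ0, hσ, Real.inv_rpow hl0.le, ← Real.rpow_neg hl0.le]
    congr 1
    ring
  rw [e3, blockBound, ← e2]
  calc 2 * L * (q ^ (-(κ / 8)) * σ ^ (1 + κ / 8))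
      ≤ 2 * ((4 * n + 64 / κ + T) * σ ^ (κ / 8)) * (q ^ (-(κ / 8)) * σ ^ (1 + κ / 8)) := by gcongr
    _ = _ := by ring

end DyadicBlocks

end TorusCR

namespace TorusCR

/-! ### Almost sure regularity of white noise -/

noncomputable section NoiseSeries

theorem funDist_trig (c : (Fin 2 → ℤ) → ℂ) (B : Finset (Fin 2 → ℤ)) (φ : TestSpace) :
    funDist (trig c B) φ = ∑ k ∈ B, ∫ y in cell, (φ : Plane → ℝ) y * (c k * character k y).re := by
  simp only [funDist, trig, smul_eq_mul, Finset.mul_sum]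
  refine integral_finsetSum _ fun k _ => integrableOn_cell (φ.2.1.continuous.mul ?_)
  exact Complex.continuous_re.comp (continuous_const.mul (isSmooth_character k).continuous)

theorem hzBound_box_sub {c : (Fin 2 → ℤ) → ℂ} {α : ℝ} {b : ℕ → ℝ}
    (hb : ∀ n, HZBound α (funDist (trig c (block n))) (b n)) (n : ℕ) {m : ℕ} (hm : n ≤ m) :
    HZBound α (fun φ => funDist (trig c (box m)) φ - funDist (trig c (box n)) φ)
      (∑ i ∈ Finset.Ico n m, b i) := by
  induction m, hm using Nat.le_induction with
  | base =>
    intro x lam hl φ hφ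
    simp
  | succ m hm ih =>
    rw [Finset.sum_Ico_succ_top hm]
    convert ih.add (hb m) using 2 with φ
    have : funDist (trig c (block m)) φ + funDist (trig c (box m)) φ =
        funDist (trig c (box (m + 1))) φ := by
      simp only [funDist_trig]
      exact Finset.sum_sdiff (monotone_box m.le_succ)
    rw [← this]
    ring

/-- The boxes exhaust all frequencies, so the partial sums converge weakly to `w`; the distance to
`w` in norm is at most the tail of the summable block bounds, by lower semicontinuity. -/
theorem approximates_of_blocks {w : TorusDist ℝ} {c : (Fin 2 → ℤ) → ℂ}
    (hw : ∀ φ : TestSpace,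
      HasSum (fun k => ∫ y in cell, (φ : Plane → ℝ) y * (c k * character k y).re) (w φ))
    (hb : ∀ κ : ℝ, 0 < κ → κ < 1 / 2 → ∃ b : ℕ → ℝ, Summable b ∧ (∀ n, 0 ≤ b n) ∧
      ∀ n, HZBound (-1 - κ / 4) (funDist (trig c (block n))) (b n)) :
    Approximates (fun n => trig c (box n)) w := by
  have htend : ∀ φ, Tendsto (fun n => funDist (trig c (box n)) φ) atTop (𝓝 (w φ)) := fun φ => by
    simp only [funDist_trig]
    exact (hw φ).comp (monotone_box.tendsto_atTop_finset exists_mem_box)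
  refine ⟨fun n => trig_smooth c _, fun n => trig_periodic c _, htend, fun κ h0 h1 δ hδ => ?_⟩
  obtain ⟨b, hs, hb0, hB⟩ := hb κ h0 h1
  have ht := (tendsto_sum_nat_add b).eventually_le_const hδ
  filter_upwards [ht] with n hn
  have key : HZBound (-1 - κ / 4) (fun φ => w φ - funDist (trig c (box n)) φ) δ := by
    refine HZBound.of_tendsto (l := atTop)
      (F := fun m φ => funDist (trig c (box m)) φ - funDist (trig c (box n)) φ)
      (fun φ => (htend φ).sub_const _) tendsto_const_nhds ?_
    filter_upwards [eventually_ge_atTop n] with m hm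
    refine (hzBound_box_sub hB n hm).mono (le_trans ?_ hn)
    rw [Finset.sum_Ico_eq_sum_range]
    simp only [add_comm n]
    exact ((summable_nat_add_iff n).2 hs).sum_le_tsum _ fun i _ => hb0 _
  simpa using key.neg

variable {Ω : Type*} [MeasurableSpace Ω] {P : Measure Ω} {v : ℝ≥0}
  {W : Fin 3 → Ω → TorusDist ℝ} {η : (Fin 2 → ℤ) → Fin 3 → Ω → ℂ}

theorem IsWhiteNoise.exp_linear (h : IsWhiteNoise P v W η) {k : Fin 2 → ℤ} (hk : k ≠ 0)
    (j : Fin 3) (p q : ℝ) :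
    Integrable (fun ω => Real.exp (p * (η k j ω).re + q * (η k j ω).im)) P ∧
    ∫ ω, Real.exp (p * (η k j ω).re + q * (η k j ω).im) ∂P =
      Real.exp (v * (p ^ 2 + q ^ 2) / 2) := by
  have hm : Measurable fun ω => ((η k j ω).re, (η k j ω).im) :=
    (Complex.measurable_re.comp (h.meas k j)).prodMk (Complex.measurable_im.comp (h.meas k j))
  have hl := h.law k hk j
  have hi : Integrable (fun z : ℝ × ℝ => Real.exp (p * z.1) * Real.exp (q * z.2))
      (P.map fun ω => ((η k j ω).re, (η k j ω).im)) := by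
    rw [hl]
    exact (integrable_exp_mul_gaussianReal p).mul_prod (integrable_exp_mul_gaussianReal q)
  have hval : ∀ t : ℝ, ∫ y, Real.exp (t * y) ∂(gaussianReal 0 v) = Real.exp (v * t ^ 2 / 2) :=
    fun t => by
    have := congrFun (mgf_id_gaussianReal (μ := 0) (v := v)) t
    simpa [mgf] using this
  simp only [Real.exp_add]
  refine ⟨(integrable_map_measure hi.1 hm.aemeasurable).1 hi, ?_⟩
  have h2 := integral_map hm.aemeasurable hi.1
  rw [hl, integral_prod_mul (fun y => Real.exp (p * y)) (fun y => Real.exp (q * y)), hval, hval,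
    ← Real.exp_add] at h2
  rw [← h2]
  congr 1
  ring

/-- At a fixed point the polynomial is a sum of independent centred Gaussians. As characters have
modulus one and the two parts of each coefficient share the variance `v`, the law does not depend on
the point. -/
theorem IsWhiteNoise.exp_trig (h : IsWhiteNoise P v W η) (j : Fin 3)
    {B : Finset (Fin 2 → ℤ)} (hB : ∀ k ∈ B, k ≠ 0) (a : (Fin 2 → ℤ) → ℝ) (x : Plane) (t : ℝ) :
    Integrable (fun ω => Real.exp (t * trig (fun k => (a k : ℂ) * η k j ω) B x)) P ∧
    ∫ ω, Real.exp (t * trig (fun k => (a k : ℂ) * η k j ω) B x) ∂P =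
      Real.exp (v * t ^ 2 * (∑ k ∈ B, a k ^ 2) / 2) := by
  set Y : (Fin 2 → ℤ) → Ω → ℝ := fun k ω => ((a k : ℂ) * η k j ω * character k x).re with hY
  have hind : iIndepFun Y P := by
    have h1 := h.indep.precomp (g := fun k : Fin 2 → ℤ => (k, j)) fun k k' hkk => by
      simpa using hkk
    exact h1.comp (fun k z => ((a k : ℂ) * z * character k x).re) fun k => by fun_prop
  have hmeas : ∀ k, Measurable (Y k) := fun k => by
    have := h.meas k j
    fun_prop
  have hlin : ∀ k ω, t * Y k ω = (t * (a k * (character k x).re)) * (η k j ω).re +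
      (t * (-(a k * (character k x).im))) * (η k j ω).im := fun k ω => by
    simp only [hY, Complex.mul_re, Complex.mul_im, Complex.ofReal_re, Complex.ofReal_im]
    ring
  have hsq : ∀ k, (t * (a k * (character k x).re)) ^ 2 +
      (t * (-(a k * (character k x).im))) ^ 2 = t ^ 2 * a k ^ 2 := fun k => by
    have h1 := Complex.sq_norm (character k x)
    rw [norm_character, Complex.normSq_apply] at h1
    linear_combination (-(t ^ 2 * a k ^ 2)) * h1
  have hint : ∀ k ∈ B, Integrable (fun ω => Real.exp (t * Y k ω)) P := fun k hk => by
    simp only [hlin]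
    exact (h.exp_linear (hB k hk) j _ _).1
  have e : ∀ ω, trig (fun k => (a k : ℂ) * η k j ω) B x = (∑ k ∈ B, Y k) ω := fun ω => by
    simp [trig, hY]
  simp only [e]
  have := hind.isProbabilityMeasure
  refine ⟨hind.integrable_exp_mul_sum hmeas hint, ?_⟩
  have hmgf := hind.mgf_sum hmeas B (t := t)
  rw [mgf] at hmgf
  rw [hmgf]
  have : ∀ k ∈ B, mgf (Y k) P t = Real.exp (v * (t ^ 2 * a k ^ 2) / 2) := fun k hk => by
    rw [mgf, ← hsq]
    simp only [hlin]
    exact (h.exp_linear (hB k hk) j _ _).2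
  rw [Finset.prod_congr rfl this, ← Real.exp_sum, ← Finset.sum_div, ← Finset.mul_sum,
    ← Finset.mul_sum, mul_assoc]

theorem IsWhiteNoise.measurable_trig (h : IsWhiteNoise P v W η) (j : Fin 3)
    (B : Finset (Fin 2 → ℤ)) (a : (Fin 2 → ℤ) → ℝ) :
    Measurable fun p : Ω × Plane => trig (fun k => (a k : ℂ) * η k j p.1) B p.2 := by
  refine Finset.measurable_sum _ fun k _ => ?_
  have h1 : Measurable fun p : Ω × Plane => η k j p.1 := (h.meas k j).comp measurable_fst
  have h2 : Measurable fun p : Ω × Plane => character k p.2 :=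
    (isSmooth_character k).continuous.measurable.comp measurable_snd
  exact Complex.measurable_re.comp ((measurable_const.mul h1).mul h2)

theorem IsWhiteNoise.lintegral_trig_le (h : IsWhiteNoise P v W η) (j : Fin 3)
    {B : Finset (Fin 2 → ℤ)} (hB : ∀ k ∈ B, k ≠ 0) {a : (Fin 2 → ℤ) → ℝ} {A : ℝ}
    (ha : ∑ k ∈ B, a k ^ 2 ≤ A) :
    ∫⁻ ω, (∫⁻ y in cell, ENNReal.ofReal (Real.exp (trig (fun k => (a k : ℂ) * η k j ω) B y) +
      Real.exp (-trig (fun k => (a k : ℂ) * η k j ω) B y))) ∂P ≤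
      ENNReal.ofReal (2 * Real.exp (v * A / 2)) * volume cell := by
  have hm := h.measurable_trig j B a
  have := h.indep.isProbabilityMeasure
  rw [lintegral_lintegral_swap (by
    simp only [Function.uncurry_def]
    exact (((Real.measurable_exp.comp hm).add
      (Real.measurable_exp.comp hm.neg)).ennreal_ofReal).aemeasurable)]
  rw [← setLIntegral_const]
  refine lintegral_mono fun y => ?_
  have h1 := h.exp_trig j hB a y 1
  have h2 := h.exp_trig j hB a y (-1)
  simp only [one_mul, neg_one_mul] at h1 h2
  have hi : Integrable (fun ω => Real.exp (trig (fun k => (a k : ℂ) * η k j ω) B y) +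
      Real.exp (-trig (fun k => (a k : ℂ) * η k j ω) B y)) P := h1.1.add h2.1
  rw [← ofReal_integral_eq_lintegral_ofReal hi (ae_of_all _ fun ω => by
    simp only [Pi.zero_apply]; positivity)]
  refine ENNReal.ofReal_le_ofReal ?_
  rw [integral_add h1.1 h2.1, h1.2, h2.2, two_mul]
  have hv : (0 : ℝ) ≤ v := v.2
  have hle : (v : ℝ) * (∑ k ∈ B, a k ^ 2) ≤ v * A := mul_le_mul_of_nonneg_left ha hv
  refine add_le_add (Real.exp_le_exp.2 ?_) (Real.exp_le_exp.2 ?_) <;> nlinarith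

/-- The sum of `r i * f i` has finite expectation and is therefore almost surely finite, and it
dominates each term. Adding one makes `T` positive. -/
theorem ae_bounded_of_tsum {ι : Type*} [Countable ι] {f : ι → Ω → ℝ≥0∞} {r : ι → ℝ} {K : ℝ≥0∞}
    (hf : ∀ i, AEMeasurable (f i) P) (hr : ∀ i, 0 < r i) (hs : Summable r) (hK : K ≠ ⊤)
    (h : ∀ i, ∫⁻ ω, f i ω ∂P ≤ K) :
    ∀ᵐ ω ∂P, ∃ T : ℝ, 0 < T ∧ ∀ i, f i ω ≤ ENNReal.ofReal ((r i)⁻¹ * T) := by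
  have hfin : ∫⁻ ω, ∑' i, ENNReal.ofReal (r i) * f i ω ∂P ≠ ⊤ := by
    rw [lintegral_tsum fun i => (hf i).const_mul _]
    refine ne_top_of_le_ne_top (b := (∑' i, ENNReal.ofReal (r i)) * K)
      (ENNReal.mul_ne_top hs.tsum_ofReal_ne_top hK) ?_
    rw [← ENNReal.tsum_mul_right]
    refine ENNReal.tsum_le_tsum fun i => ?_
    rw [lintegral_const_mul'' _ (hf i)]
    gcongr
    exact h i
  filter_upwards [ae_lt_top' (AEMeasurable.tsum fun i => (hf i).const_mul _) hfin] with ω hω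
  refine ⟨(∑' i, ENNReal.ofReal (r i) * f i ω).toReal + 1, by positivity, fun i => ?_⟩
  have h1 : ENNReal.ofReal (r i) * f i ω ≤
      ENNReal.ofReal ((∑' i, ENNReal.ofReal (r i) * f i ω).toReal + 1) := by
    refine (ENNReal.le_tsum (f := fun i => ENNReal.ofReal (r i) * f i ω) i).trans ?_
    conv_lhs => rw [← ENNReal.ofReal_toReal hω.ne]
    exact ENNReal.ofReal_le_ofReal (by linarith)
  have h2 : ENNReal.ofReal (r i)⁻¹ * (ENNReal.ofReal (r i) * f i ω) = f i ω := by
    rw [← mul_assoc, ← ENNReal.ofReal_mul (inv_nonneg.2 (hr i).le), inv_mul_cancel₀ (hr i).ne',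
      ENNReal.ofReal_one, one_mul]
  rw [← h2, ENNReal.ofReal_mul (inv_nonneg.2 (hr i).le)]
  gcongr

/-- The expectations are bounded uniformly in `n`; the weights `2⁻ⁿ` cost a factor `2ⁿ`, which
`hzBound_block` feels only through a logarithm. -/
theorem IsWhiteNoise.ae_block_bound (h : IsWhiteNoise P v W η) (j : Fin 3)
    {a : ℕ → (Fin 2 → ℤ) → ℝ} {A : ℝ} (ha : ∀ n, ∑ k ∈ block n, a n k ^ 2 ≤ A) :
    ∀ᵐ ω ∂P, ∃ T : ℝ, 0 < T ∧ ∀ n, ∫ y in cell,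
      (Real.exp (trig (fun k => (a n k : ℂ) * η k j ω) (block n) y) +
        Real.exp (-trig (fun k => (a n k : ℂ) * η k j ω) (block n) y)) ≤ 2 ^ n * T := by
  have hm := fun n => h.measurable_trig j (block n) (a n)
  have := ae_bounded_of_tsum (P := P) (r := fun n => (1 / 2 : ℝ) ^ n)
    (f := fun n ω => ∫⁻ y in cell, ENNReal.ofReal
      (Real.exp (trig (fun k => (a n k : ℂ) * η k j ω) (block n) y) +
        Real.exp (-trig (fun k => (a n k : ℂ) * η k j ω) (block n) y)))
    (fun n => (Measurable.lintegral_prod_right' (((Real.measurable_exp.comp (hm n)).add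
      (Real.measurable_exp.comp (hm n).neg)).ennreal_ofReal)).aemeasurable)
    (fun n => by positivity) summable_geometric_two
    (ENNReal.mul_ne_top ENNReal.ofReal_ne_top volume_cell_lt_top.ne)
    fun n => h.lintegral_trig_le j (fun k hk => ne_zero_of_mem_block hk) (ha n)
  filter_upwards [this] with ω hω
  obtain ⟨T, hT, hb⟩ := hω
  refine ⟨T, hT, fun n => ?_⟩
  have hc := (trig_smooth (fun k => (a n k : ℂ) * η k j ω) (block n)).continuous
  have hint := integrableOn_cell (g := fun y =>
    Real.exp (trig (fun k => (a n k : ℂ) * η k j ω) (block n) y) +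
      Real.exp (-trig (fun k => (a n k : ℂ) * η k j ω) (block n) y)) (by fun_prop)
  have k := hb n
  rw [← ofReal_integral_eq_lintegral_ofReal hint (ae_of_all _ fun y => by
    simp only [Pi.zero_apply]; positivity)] at k
  have k2 := (ENNReal.ofReal_le_ofReal_iff (by positivity)).1 k
  simpa using k2

/-- Needed for smoothness of the mollifications. The coefficients are dominated by exponentials with
bounded expectation, via `|s| ≤ e^s + e^(-s)`, and weighted by the summable `(1 + ‖k‖)⁻³`. -/
theorem IsWhiteNoise.ae_polyGrowth (h : IsWhiteNoise P v W η) (j : Fin 3) :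
    ∀ᵐ ω ∂P, PolyGrowth fun k => η k j ω := by
  set f : (Fin 2 → ℤ) → Ω → ℝ := fun k ω => if k = 0 then 0 else
    (Real.exp (1 * (η k j ω).re + 0 * (η k j ω).im) +
      Real.exp (-1 * (η k j ω).re + 0 * (η k j ω).im)) +
    (Real.exp (0 * (η k j ω).re + 1 * (η k j ω).im) +
      Real.exp (0 * (η k j ω).re + -1 * (η k j ω).im)) with hf
  have hf0 : ∀ k ω, 0 ≤ f k ω := fun k ω => by
    simp only [hf]
    split_ifs <;> positivity
  have key : ∀ k, Integrable (f k) P ∧ ∫ ω, f k ω ∂P ≤ 4 * Real.exp (v / 2) := fun k => by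
    by_cases hk : k = 0
    · simp only [hf, hk, if_true]
      exact ⟨integrable_zero _ _ _, by rw [integral_zero]; positivity⟩
    · simp only [hf, hk, if_false]
      have i := fun p q => h.exp_linear hk j p q
      have hi1 := (i 1 0).1.add (i (-1) 0).1
      have hi2 := (i 0 1).1.add (i 0 (-1)).1
      refine ⟨hi1.add hi2, le_of_eq ?_⟩
      refine (integral_add hi1 hi2).trans ?_
      rw [integral_add' (i 1 0).1 (i (-1) 0).1, integral_add' (i 0 1).1 (i 0 (-1)).1, (i 1 0).2, (i (-1) 0).2, (i 0 1).2, (i 0 (-1)).2]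
      norm_num
      ring
  have := ae_bounded_of_tsum (P := P) (r := fun k : Fin 2 → ℤ => ((1 + ‖k‖) ^ 3)⁻¹)
    (f := fun k ω => ENNReal.ofReal (f k ω)) (fun k => (key k).1.1.aemeasurable.ennreal_ofReal)
    (fun k => by positivity) summable_weight (ENNReal.ofReal_ne_top (r := 4 * Real.exp (v / 2)))
    fun k => by
      rw [← ofReal_integral_eq_lintegral_ofReal (key k).1 (ae_of_all _ (hf0 k))]
      exact ENNReal.ofReal_le_ofReal (key k).2
  filter_upwards [this] with ω hω
  obtain ⟨T, hT, hb⟩ := hω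
  -- The zero mode has a different law, or vanishes, and is simply added to the constant.
  refine ⟨3, T + ‖η 0 j ω‖, by positivity, fun k => ?_⟩
  have h1 : (1 : ℝ) ≤ (1 + ‖k‖) ^ 3 := one_le_pow₀ (by linarith [norm_nonneg k])
  by_cases hk : k = 0
  · rw [hk] at h1 ⊢
    nlinarith [norm_nonneg (η 0 j ω)]
  · have h2 := (ENNReal.ofReal_le_ofReal_iff (by positivity)).1 (hb k)
    rw [inv_inv] at h2
    have hex : ∀ s : ℝ, |s| ≤ Real.exp s + Real.exp (-s) := fun s => by
      rcases abs_cases s with ⟨h, -⟩ | ⟨h, -⟩ <;> rw [h]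
      · linarith [Real.exp_pos (-s), Real.add_one_le_exp s]
      · linarith [Real.exp_pos s, Real.add_one_le_exp (-s)]
    have h3 : ‖η k j ω‖ ≤ f k ω := by
      refine (Complex.norm_le_abs_re_add_abs_im _).trans ?_
      simp only [hf, hk, if_false, one_mul, zero_mul, add_zero, zero_add, neg_one_mul]
      exact add_le_add (hex _) (hex _)
    refine h3.trans (h2.trans ?_)
    nlinarith [norm_nonneg (η 0 j ω)]

/-- A block has at most `25 * 4ⁿ` frequencies, each with squared weight at most `4⁻ⁿ` in both
normalizations, so both variances are bounded by `25 v`. The random constant `T` does not involve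
`κ`, so one null set serves every `κ`. -/
theorem IsWhiteNoise.ae_approximates (h : IsWhiteNoise P v W η) (j : Fin 3) :
    ∀ᵐ ω ∂P, Approximates (fun n => trig (fun k => η k j ω) (box n)) (W j ω) := by
  have hX := h.ae_block_bound j (a := fun n _ => ((2 : ℝ) ^ n)⁻¹) (A := 25) fun n => by
    rw [Finset.sum_const, nsmul_eq_mul, ← inv_pow, ← pow_mul, mul_comm n, pow_mul]
    have h4 : (0 : ℝ) < 4 ^ n := by positivity
    calc ((block n).card : ℝ) * ((2 : ℝ)⁻¹ ^ 2) ^ n ≤ 25 * 4 ^ n * ((2 : ℝ)⁻¹ ^ 2) ^ n := by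
          gcongr
          exact card_block_le n
      _ = 25 := by
          rw [mul_assoc, ← mul_pow]
          norm_num
  have hV := h.ae_block_bound j (a := fun n k => 2 ^ n * (freqSq k)⁻¹) (A := 25) fun n => by
    have h4 : (0 : ℝ) < 4 ^ n := by positivity
    have h2 : ((2 : ℝ) ^ n) ^ 2 = 4 ^ n := by
      rw [← pow_mul, mul_comm, pow_mul]
      norm_num
    calc ∑ k ∈ block n, (2 ^ n * (freqSq k)⁻¹) ^ 2 ≤ ∑ k ∈ block n, ((4 : ℝ) ^ n)⁻¹ := by
          refine Finset.sum_le_sum fun k hk => ?_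
          have := four_pow_le_freqSq hk
          calc (2 ^ n * (freqSq k)⁻¹) ^ 2 ≤ (2 ^ n * ((4 : ℝ) ^ n)⁻¹) ^ 2 := by
                have : 0 < freqSq k := h4.trans_le this
                gcongr
            _ = ((4 : ℝ) ^ n)⁻¹ := by
                rw [mul_pow, h2]
                field_simp
      _ = (block n).card * ((4 : ℝ) ^ n)⁻¹ := by rw [Finset.sum_const, nsmul_eq_mul]
      _ ≤ 25 * 4 ^ n * ((4 : ℝ) ^ n)⁻¹ := by
          gcongr
          exact card_block_le n
      _ = 25 := by field_simp
  filter_upwards [hX, hV, h.series] with ω ⟨T₁, hT₁, h₁⟩ ⟨T₂, hT₂, h₂⟩ hs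
  have hT : 0 < T₁ + T₂ := by positivity
  refine approximates_of_blocks (hs j) fun κ h0 h1 => ⟨blockBound κ (T₁ + T₂),
    summable_blockBound h0 _, blockBound_nonneg h0 hT.le, fun n => ?_⟩
  refine hzBound_block hT ?_ h0 h1
  have h2n : (0 : ℝ) < 2 ^ n := by positivity
  rintro X (rfl | rfl)
  · exact (h₁ n).trans (by nlinarith)
  · exact (h₂ n).trans (by nlinarith)

/-- Almost every realization of the noise is admissible. -/
theorem IsWhiteNoise.ae_admissible (h : IsWhiteNoise P v W η) {ρ : Plane → ℝ}
    (hρ : IsMollifier ρ) : ∀ᵐ ω ∂P, Admissible ρ (fun k => W k ω) := by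
  filter_upwards [ae_all_iff.2 h.ae_approximates, ae_all_iff.2 h.ae_polyGrowth, h.series]
    with ω ha hp hs
  exact ⟨hρ, fun j => ⟨_, ha j⟩, fun j ε hε => mollify_smooth_of_series (hp j) (hs j) hρ hε⟩

end NoiseSeries

end TorusCR

/-! ### The main theorem -/

theorem mainTheorem2 :
    ∃ C : ℝ → ℝ≥0, ∀ (ρ : TorusCR.Plane → ℝ), TorusCR.IsMollifier ρ →
    ∀ (Ω : Type*) [MeasurableSpace Ω] (P : Measure Ω) [IsProbabilityMeasure P] (v : ℝ≥0)
      (W : Fin 3 → Ω → TorusCR.TorusDist ℝ) (η : (Fin 2 → ℤ) → Fin 3 → Ω → ℂ),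
    TorusCR.IsWhiteNoise P v W η →
    ∀ᵐ ω ∂P,
      (∀ ε : ℝ, 0 < ε → ∀ j,
        TorusCR.IsSmooth (TorusCR.thetaEps ρ ε (fun k => W k ω) j) ∧
        TorusCR.IsSmooth (TorusCR.zetaEps ρ ε (fun k => W k ω) j)) ∧
      ∃ θ ζ : Fin 3 → TorusCR.TorusDist ℂ,
        (∀ j φ, Tendsto (fun ε => TorusCR.funDist (TorusCR.thetaEps ρ ε (fun k => W k ω) j) φ)
          (𝓝[>] (0 : ℝ)) (𝓝 (θ j φ))) ∧
        (∀ j φ, Tendsto (fun ε => TorusCR.funDist (TorusCR.zetaEps ρ ε (fun k => W k ω) j) φ)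
          (𝓝[>] (0 : ℝ)) (𝓝 (ζ j φ))) ∧
        (∀ j, ∃ h : TorusCR.TorusDist ℂ, TorusCR.IsConvG (θ j) h ∧ ∀ φ, ζ j φ = 2 * h φ) ∧
        ∀ κ : ℝ, 0 < κ → κ < 1 / 2 →
          (∀ j, TorusCR.MemLittleHZ (-1 - κ / 4) (W j ω).toComplex) ∧
          TorusCR.MemE (-κ) θ ∧
          (∀ j, TorusCR.hzNorm (-κ) (θ j) ≤
            C κ * TorusCR.hzReal (-1 - κ / 4) (W (j + 1) ω) *
              TorusCR.hzReal (-1 - κ / 4) (W (j + 2) ω)) ∧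
          (∀ ε : ℝ, 0 < ε → ∀ j,
            TorusCR.hzNorm (-κ)
                (TorusCR.funDist (TorusCR.thetaEps ρ ε (fun k => W k ω) j)) ≤
              C κ * TorusCR.hzReal (-1 - κ / 4) (W (j + 1) ω) *
                TorusCR.hzReal (-1 - κ / 4) (W (j + 2) ω)) ∧
          (∀ ε : ℝ, 0 < ε → ∀ j,
            TorusCR.hzNorm (-κ) (fun φ =>
                TorusCR.funDist (TorusCR.thetaEps ρ ε (fun k => W k ω) j) φ - θ j φ) ≤
              C κ *
                (TorusCR.hzReal (-1 - κ / 4) (fun φ =>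
                    TorusCR.funDist (TorusCR.mollify ρ ε (W (j + 1) ω)) φ - W (j + 1) ω φ) *
                  TorusCR.hzReal (-1 - κ / 4) (W (j + 2) ω) +
                TorusCR.hzReal (-1 - κ / 4) (fun φ =>
                    TorusCR.funDist (TorusCR.mollify ρ ε (W (j + 2) ω)) φ - W (j + 2) ω φ) *
                  TorusCR.hzReal (-1 - κ / 4) (W (j + 1) ω))) ∧
          TorusCR.MemE (1 - κ) ζ ∧
          TorusCR.l2norm (fun j => TorusCR.hzNorm (1 - κ) (ζ j)) ≤
            C κ * TorusCR.l2norm (fun j => TorusCR.hzReal (-1 - κ / 4) (W j ω)) ^ 2 ∧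
          (∀ ε : ℝ, 0 < ε →
            TorusCR.l2norm (fun j => TorusCR.hzNorm (1 - κ)
                (TorusCR.funDist (TorusCR.zetaEps ρ ε (fun k => W k ω) j))) ≤
              C κ * TorusCR.l2norm (fun j => TorusCR.hzReal (-1 - κ / 4) (W j ω)) ^ 2) ∧
          (∀ ε : ℝ, 0 < ε → ∀ j,
            TorusCR.hzNorm (1 - κ) (fun φ =>
                TorusCR.funDist (TorusCR.zetaEps ρ ε (fun k => W k ω) j) φ - ζ j φ) ≤
              C κ *
                (TorusCR.hzReal (-1 - κ / 4) (fun φ =>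
                    TorusCR.funDist (TorusCR.mollify ρ ε (W (j + 1) ω)) φ - W (j + 1) ω φ) *
                  TorusCR.hzReal (-1 - κ / 4) (W (j + 2) ω) +
                TorusCR.hzReal (-1 - κ / 4) (fun φ =>
                    TorusCR.funDist (TorusCR.mollify ρ ε (W (j + 2) ω)) φ - W (j + 2) ω φ) *
                  TorusCR.hzReal (-1 - κ / 4) (W (j + 1) ω))) := by
  -- The constants must be fixed before the mollifier and the noise. Outside `(0, 1/2)` the value is
  -- the irrelevant default `0`.
  have hC : ∀ κ : ℝ, ∃ C : ℝ≥0, ∀ (h0 : 0 < κ) (h1 : κ < 1 / 2),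
      C = (TorusCR.exists_constants h0 h1).choose := fun κ => by
    by_cases h : 0 < κ ∧ κ < 1 / 2
    · exact ⟨(TorusCR.exists_constants h.1 h.2).choose, fun _ _ => rfl⟩
    · exact ⟨0, fun h0 h1 => absurd ⟨h0, h1⟩ h⟩
  choose C hC using hC
  refine ⟨C, fun ρ hρ Ω _ P _ v W η hW => ?_⟩
  filter_upwards [hW.ae_admissible hρ] with ω H
  refine ⟨fun ε hε j => ⟨H.thetaEps_smooth hε j, H.zetaEps_smooth hε j⟩, ?_⟩
  choose θ hθ using fun j => H.exists_theta j
  choose ζ hζ using fun j => H.exists_zeta j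
  refine ⟨θ, ζ, hθ, hζ, fun j => ⟨(ζ j).half, H.isConvG (hθ j) (hζ j), fun φ => ?_⟩,
    fun κ h0 h1 => ?_⟩
  · show ζ j φ = 2 * ((1 / 2 : ℝ) • ζ j φ)
    rw [Complex.real_smul]
    push_cast
    ring
  · rw [hC κ h0 h1]
    exact (TorusCR.exists_constants h0 h1).choose_spec ρ _ H θ ζ hθ hζ
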